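/- A $(v,k,\lambda)$ symmetric design consists of $v$ points and $v$ blocks such that every point lies on $k$ blocks, every block contains $k$ points, any two distinct points lie on exactly $\lambda$ common blocks, and any two distinct blocks meet in exactly $\lambda$ points. It has the symmetric difference property (SDP) if the symmetric difference of any three blocks is a block or the complement of a block. An *SDP design on $v$ points* is a $(v,k,\lambda)$ symmetric design with the SDP and $0<k\le v/2$ (so a design and its complement are not counted separately). Two designs are isomorphic if there are bijections between their points and between their blocks that preserve incidence in both directions. A $(v,k,\lambda)$ difference set in a group $G$ of order $v$ is a $k$-subset $D\subseteq G$ such that every non-identity element of $G$ equals $d_1d_2^{-1}$ for exactly $\lambda$ pairs $(d_1,d_2)\in D\times D$. For a subset $D$ of a group $G$, its development has the elements of $G$ as points and the left translates $gD$ ($g\in G$) as blocks. A design *comes from the product construction* if it is isomorphic to the development, in the direct product $G_1\times G_2$, of $$D=\bigl(D_1\times(G_2\setminus D_2)\bigr)\cup\bigl((G_1\setminus D_1)\times D_2\bigr),$$ where $D_1,D_2$ are difference sets in nontrivial finite groups $G_1,G_2$. **Corollary 5.3.** Up to isomorphism, there are exactly four SDP designs on $256$ points that come from the product construction. -/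

import Mathlib

universe u v

/-- An incidence structure: points, blocks, and an incidence relation between them. -/
structure IncidenceStructure where
  Point : Type u
  Block : Type u
  incident : Point → Block → Prop

namespace IncidenceStructure

/-- The set of points incident with a block. -/
def pointsOf (X : IncidenceStructure.{u}) (b : X.Block) : Set X.Point :=
  {p | X.incident p b}

/-- The set of blocks incident with a point. -/
def blocksOf (X : IncidenceStructure.{u}) (p : X.Point) : Set X.Block :=
  {b | X.incident p b}

/-- `X` is a symmetric design with parameters `(n, k, l)`. -/
structure IsSymmetricDesign (X : IncidenceStructure.{u}) (n k l : ℕ) : Prop where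
  finite_point : Finite X.Point
  finite_block : Finite X.Block
  card_point : Nat.card X.Point = n
  card_block : Nat.card X.Block = n
  ncard_blocksOf : ∀ p : X.Point, (X.blocksOf p).ncard = k
  ncard_pointsOf : ∀ b : X.Block, (X.pointsOf b).ncard = k
  ncard_blocksOf_inter : ∀ p q : X.Point, p ≠ q → (X.blocksOf p ∩ X.blocksOf q).ncard = l
  ncard_pointsOf_inter : ∀ b c : X.Block, b ≠ c → (X.pointsOf b ∩ X.pointsOf c).ncard = l

/-- The symmetric difference property: the symmetric difference of any three blocks is a block
or the complement of a block. -/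
def HasSDP (X : IncidenceStructure.{u}) : Prop :=
  ∀ a b c : X.Block, ∃ d : X.Block,
    symmDiff (symmDiff (X.pointsOf a) (X.pointsOf b)) (X.pointsOf c) = X.pointsOf d ∨
    symmDiff (symmDiff (X.pointsOf a) (X.pointsOf b)) (X.pointsOf c) = (X.pointsOf d)ᶜ

/-- An SDP design on `n` points. As usual, a design and its complement are not counted
separately, so the block size `k` is at most `n / 2`, and the degenerate design with empty
blocks is excluded. -/
def IsSDPDesign (X : IncidenceStructure.{u}) (n : ℕ) : Prop :=
  ∃ k l : ℕ, 0 < k ∧ 2 * k ≤ n ∧ X.IsSymmetricDesign n k l ∧ X.HasSDP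

/-- Isomorphism: bijections of the points and of the blocks that preserve incidence in both
directions. -/
def Isomorphic (X : IncidenceStructure.{u}) (Y : IncidenceStructure.{v}) : Prop :=
  ∃ (φ : X.Point ≃ Y.Point) (ψ : X.Block ≃ Y.Block),
    ∀ (p : X.Point) (b : X.Block), X.incident p b ↔ Y.incident (φ p) (ψ b)

end IncidenceStructure

/-- `D` is an `(n, k, l)` difference set in the group `G`: every non-identity element of `G`
is of the form `d₁ * d₂⁻¹` for exactly `l` pairs of elements of `D`. -/
structure IsDifferenceSet {G : Type u} [Group G] (D : Set G) (n k l : ℕ) : Prop where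
  finite_group : Finite G
  card_group : Nat.card G = n
  ncard_set : D.ncard = k
  ncard_pairs : ∀ g : G, g ≠ 1 →
    {d : G × G | d.1 ∈ D ∧ d.2 ∈ D ∧ d.1 * d.2⁻¹ = g}.ncard = l

/-- The development of `D`: the points are the elements of `G`, and the block indexed by `g`
is the left translate `g D`. -/
def development {G : Type u} [Group G] (D : Set G) : IncidenceStructure.{u} where
  Point := G
  Block := G
  incident := fun x g => x ∈ (fun d => g * d) '' D

/-- The set `(D₁ × (G₂ - D₂)) ∪ ((G₁ - D₁) × D₂)`. -/
def productConstruction {G₁ : Type u} {G₂ : Type u} (D₁ : Set G₁) (D₂ : Set G₂) :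
    Set (G₁ × G₂) :=
  (D₁ ×ˢ D₂ᶜ) ∪ (D₁ᶜ ×ˢ D₂)

/-- `X` comes from the product construction: it is (isomorphic to) the development, in the
direct product of two nontrivial groups, of the product construction of a difference set in
each factor. -/
def IsFromProductConstruction (X : IncidenceStructure.{u}) : Prop :=
  ∃ (G₁ G₂ : Type u) (_ : Group G₁) (_ : Group G₂) (D₁ : Set G₁) (D₂ : Set G₂)
    (n₁ k₁ l₁ n₂ k₂ l₂ : ℕ),
    Nontrivial G₁ ∧ Nontrivial G₂ ∧
    IsDifferenceSet D₁ n₁ k₁ l₁ ∧ IsDifferenceSet D₂ n₂ k₂ l₂ ∧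
    X.Isomorphic (development (productConstruction D₁ D₂))

/-!
A `(v, k, λ)` symmetric design with the symmetric difference property that is the development of a
difference set `D` is controlled by the indicator function `F` of `D`: the SDP says that the sum of
three translates of `F` is a translate of `F`, up to a constant. If `D` comes from the product
construction then `F(x₁, x₂) = F₁(x₁) + F₂(x₂)`, and comparing the inner products of the translates
of the signs `(-1) ^ F` with those of the factors shows that distinct translates of each factor are
orthogonal (`orthogonal_of_isSDPDesign`). The functions `x ↦ Fᵢ(g⁻¹ x) + Fᵢ(x)`, normalised to
vanish at the identity, then form a vector space over the field with two elements, of the same size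
as the group, and evaluation identifies the group with the dual of this space, in such a way that `Fᵢ`
becomes a bent function (`HasOrthogonalTranslates.exists_coordinates`). The design is the design of
the orthogonal sum of two bent functions: the blocks are the supports of the sums of this function
and an affine function, one of any two complementary ones.

Bent functions exist only on spaces with `4 ^ m` elements, so for 256 points the two spaces have `4`
and `64`, or `16` and `16` elements. Up to affine changes of coordinates and addition of affine
functions, there is one bent function on two bits, one on four bits, and there are four on six bits
(`IsBent.exists_equiv_bentRep`). For the last fact, a bent function of six bits has degree at most
three, hence its second derivatives are affine; counting those that are constant shows that one of
them vanishes, so that the function is affine along a family of parallel planes. The fibres of the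
linear parts are four affine planes which have a common direction (`exists_common_direction`), and
so the function is equivalent to `(x, y) ↦ π(y) · x + h(y)` with `x`, `y` of three bits and `π` a
permutation. Permutations of three bits fall into four classes under affine bijections, and `h` can
be absorbed. The sum of two functions of four bits is the quadratic function of eight bits, which is
also a sum of a function of two bits and one of six bits. This gives at most four designs.

Conversely, each of the four bent functions of six bits is realised by a group law on six bits whose
translations change the function by affine functions only (`hasAffineTranslates_repEquiv`), and then
the design of the sum with the function of two bits is the development of a product construction.
Finally, an isomorphism between the designs of bent functions is an equivalence of the functions,
because differences of blocks are affine (`EAEquiv.of_isomorphic`), and the four functions differ in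
the number of directions in which the derivative is affine: `64`, `8`, `2` and `1` on the part of
six bits.
-/

namespace BentDesign

/-! ### Signs, affine maps, bent functions and their equivalence -/

/-- The sign `(-1) ^ a` of a bit. -/
def sgn (a : ZMod 2) : ℤ := if a = 0 then 1 else -1

lemma sgn_add (a b : ZMod 2) : sgn (a + b) = sgn a * sgn b := by revert a b; decide

@[simp] lemma sgn_zero : sgn 0 = 1 := rfl

@[simp] lemma sgn_one : sgn 1 = -1 := rfl

lemma sgn_mul_self (a : ZMod 2) : sgn a * sgn a = 1 := by revert a; decide

lemma sgn_eq (a : ZMod 2) : sgn a = 1 ∨ sgn a = -1 := by revert a; decide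

lemma zmod_two_cases (a : ZMod 2) : a = 0 ∨ a = 1 := by revert a; decide

lemma bit_add_self (a : ZMod 2) : a + a = 0 := by revert a; decide

lemma eq_of_add_eq_zero {a b : ZMod 2} (h : a + b = 0) : a = b := by revert a b; decide

section Affine

variable {V W U : Type*} [AddCommGroup V] [AddCommGroup W] [AddCommGroup U]

/-- Affine maps between abelian groups, without a chosen linear part. -/
def IsAffine (φ : V → W) : Prop := ∀ x y, φ (x + y) + φ 0 = φ x + φ y

lemma isAffine_const (c : W) : IsAffine (fun _ : V => c) := fun _ _ => rfl

lemma isAffine_id : IsAffine (id : V → V) := fun x y => by simp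

lemma isAffine_linear [Module (ZMod 2) V] [Module (ZMod 2) W] (u : V →ₗ[ZMod 2] W) :
    IsAffine u := fun x y => by simp

lemma isAffine_linearEquiv [Module (ZMod 2) V] [Module (ZMod 2) W] (u : V ≃ₗ[ZMod 2] W) :
    IsAffine u := fun x y => by simp

lemma IsAffine.add {φ ψ : V → W} (h : IsAffine φ) (k : IsAffine ψ) :
    IsAffine (fun x => φ x + ψ x) := fun x y => by
  change φ (x + y) + ψ (x + y) + (φ 0 + ψ 0) = φ x + ψ x + (φ y + ψ y)
  rw [add_add_add_comm, h x y, k x y, add_add_add_comm]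

lemma IsAffine.comp {ψ : W → U} {φ : V → W} (k : IsAffine ψ) (h : IsAffine φ) :
    IsAffine (fun x => ψ (φ x)) := fun x y => by
  have h1 : φ (x + y) = φ x + φ y - φ 0 := eq_sub_of_add_eq (h x y)
  have h2 : ∀ a b, ψ (a + b) = ψ a + ψ b - ψ 0 := fun a b => eq_sub_of_add_eq (k a b)
  have h3 : ∀ a b, ψ (a - b) = ψ a - ψ b + ψ 0 := fun a b => by
    have := k (a - b) b
    rw [sub_add_cancel] at this
    rw [sub_add_eq_add_sub, this, add_sub_cancel_right]
  simp only [h1, h2, h3]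
  abel

lemma IsAffine.symm {φ : V ≃ W} (h : IsAffine φ) : IsAffine φ.symm := fun x y => by
  have h2 : ∀ a b, φ (a + b) = φ a + φ b - φ 0 := fun a b => eq_sub_of_add_eq (h a b)
  apply φ.injective
  simp [h2]

lemma IsAffine.prodMap {V' W' : Type*} [AddCommGroup V'] [AddCommGroup W']
    {φ : V → W} {ψ : V' → W'} (h : IsAffine φ) (k : IsAffine ψ) : IsAffine (Prod.map φ ψ) :=
  fun x y => Prod.ext (h x.1 y.1) (k x.2 y.2)

lemma isAffine_fst : IsAffine (Prod.fst : V × W → V) := fun _ _ => by simp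

lemma isAffine_snd : IsAffine (Prod.snd : V × W → W) := fun _ _ => by simp

lemma IsAffine.prodMk {φ : U → V} {ψ : U → W} (h : IsAffine φ) (k : IsAffine ψ) :
    IsAffine (fun x => (φ x, ψ x)) := fun x y => Prod.ext (h x y) (k x y)

lemma IsAffine.exists_linear [Module (ZMod 2) V] {f : V → ZMod 2} (h : IsAffine f) :
    ∃ u : V →ₗ[ZMod 2] ZMod 2, ∀ x, f x = u x + f 0 := by
  let a : V →+ ZMod 2 :=
    { toFun := fun x => f x + f 0
      map_zero' := bit_add_self _
      map_add' := fun x y => by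
        have e := h x y
        calc f (x + y) + f 0 = f x + f y := e
          _ = f x + f y + (f 0 + f 0) := by rw [bit_add_self, add_zero]
          _ = _ := by ring }
  refine ⟨a.toZModLinearMap 2, fun x => ?_⟩
  change f x = f x + f 0 + f 0
  rw [add_assoc, bit_add_self, add_zero]

/-- Extended affine equivalence of Boolean functions: `g ∘ φ` and `f` differ by an affine function,
for some affine bijection `φ`. -/
def EAEquiv (f : V → ZMod 2) (g : W → ZMod 2) : Prop :=
  ∃ φ : V ≃ W, IsAffine φ ∧ IsAffine (fun x => g (φ x) + f x)

lemma EAEquiv.refl (f : V → ZMod 2) : EAEquiv f f :=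
  ⟨Equiv.refl V, isAffine_id, by simpa [bit_add_self] using isAffine_const (V := V) (0 : ZMod 2)⟩

lemma EAEquiv.symm {f : V → ZMod 2} {g : W → ZMod 2} (h : EAEquiv f g) : EAEquiv g f := by
  obtain ⟨φ, h1, h2⟩ := h
  refine ⟨φ.symm, h1.symm, ?_⟩
  have := h2.comp h1.symm
  simpa [add_comm] using this

lemma EAEquiv.trans {f : V → ZMod 2} {g : W → ZMod 2} {k : U → ZMod 2} (h : EAEquiv f g)
    (h' : EAEquiv g k) : EAEquiv f k := by
  obtain ⟨φ, h1, h2⟩ := h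
  obtain ⟨ψ, h3, h4⟩ := h'
  refine ⟨φ.trans ψ, h3.comp h1, ?_⟩
  have := (h4.comp h1).add h2
  convert this using 2 with x
  have := bit_add_self (g (φ x))
  simp only [Equiv.trans_apply]
  linear_combination -this

/-- The orthogonal sum of two Boolean functions. -/
def boxSum (f : V → ZMod 2) (g : W → ZMod 2) : V × W → ZMod 2 := fun p => f p.1 + g p.2

lemma EAEquiv.boxSum {V' W' : Type*} [AddCommGroup V'] [AddCommGroup W'] {f : V → ZMod 2}
    {g : W → ZMod 2} {f' : V' → ZMod 2} {g' : W' → ZMod 2} (h : EAEquiv f f')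
    (k : EAEquiv g g') : EAEquiv (boxSum f g) (boxSum f' g') := by
  obtain ⟨φ, h1, h2⟩ := h
  obtain ⟨ψ, h3, h4⟩ := k
  refine ⟨φ.prodCongr ψ, h1.prodMap h3, ?_⟩
  have := (h2.comp (isAffine_fst (W := W))).add (h4.comp (isAffine_snd (V := V)))
  convert this using 2 with x
  simp only [BentDesign.boxSum, Equiv.prodCongr_apply, Prod.map]
  ring

lemma EAEquiv.of_equiv (f : W → ZMod 2) (e : V ≃ W) (he : IsAffine e) :
    EAEquiv f (fun x => f (e x)) :=
  EAEquiv.symm ⟨e, he, by simpa [bit_add_self] using isAffine_const (V := V) (0 : ZMod 2)⟩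

/-- A Boolean function is bent if all its correlations with affine functions have absolute value
`√(card V)`. -/
def IsBent [Fintype V] (f : V → ZMod 2) : Prop :=
  ∀ l : V → ZMod 2, IsAffine l → (∑ x, sgn (f x + l x)) ^ 2 = (Fintype.card V : ℤ)

lemma IsBent.congr [Fintype V] [Fintype W] {f : V → ZMod 2} {g : W → ZMod 2} (hf : IsBent f)
    (h : EAEquiv f g) : IsBent g := by
  obtain ⟨φ, h1, h2⟩ := h
  intro l hl
  rw [← Fintype.card_congr φ, ← hf _ (h2.add (hl.comp h1)), ← Equiv.sum_comp φ]
  congr 2 with x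
  congr 1
  have := bit_add_self (f x)
  linear_combination -this

lemma IsBent.boxSum [Fintype V] [Fintype W] {f : V → ZMod 2} {g : W → ZMod 2} (hf : IsBent f)
    (hg : IsBent g) : IsBent (boxSum f g) := by
  intro l hl
  have h1 : IsAffine (fun x : V => l (x, 0)) := hl.comp (isAffine_id.prodMk (isAffine_const 0))
  have h2 : IsAffine (fun y : W => l (0, y) + l 0) :=
    (hl.comp ((isAffine_const 0).prodMk isAffine_id)).add (isAffine_const _)
  have h3 : ∀ x y, l (x, y) = l (x, 0) + (l (0, y) + l 0) := fun x y => by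
    have e := hl (x, 0) (0, y)
    simp only [Prod.mk_add_mk, add_zero, zero_add] at e
    linear_combination e - bit_add_self (l 0)
  have : ∑ x, sgn (BentDesign.boxSum f g x + l x)
      = (∑ x, sgn (f x + l (x, 0))) * ∑ y, sgn (g y + (l (0, y) + l 0)) := by
    rw [Fintype.sum_prod_type, Finset.sum_mul_sum]
    refine Finset.sum_congr rfl fun x _ => Finset.sum_congr rfl fun y _ => ?_
    rw [h3, ← sgn_add]
    congr 1
    simp only [BentDesign.boxSum]
    ring
  rw [this, mul_pow, hf _ h1, hg _ h2, Fintype.card_prod]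
  push_cast
  rfl

end Affine

/-! ### Fourier analysis on binary vector spaces -/

section Fourier

variable {V : Type*} [AddCommGroup V]

lemma sum_sgn_eq_zero_of_shift {T : Type*} [Fintype T] {g : T → ZMod 2} (σ : T ≃ T)
    (h : ∀ x, g (σ x) = g x + 1) : ∑ x, sgn (g x) = 0 := by
  have h1 : ∑ x, sgn (g x) = ∑ x, sgn (g (σ x)) := (Equiv.sum_comp σ (fun x => sgn (g x))).symm
  simp only [h, sgn_add, sgn_one, mul_neg, mul_one, Finset.sum_neg_distrib] at h1
  omega

lemma IsAffine.sum_sgn_eq_zero [Fintype V] {l : V → ZMod 2} (hl : IsAffine l)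
    (h : ∃ x, l x ≠ l 0) : ∑ x, sgn (l x) = 0 := by
  obtain ⟨a, ha⟩ := h
  refine sum_sgn_eq_zero_of_shift (Equiv.addRight a) fun x => ?_
  have e := hl x a
  have : l a = l 0 + 1 := by
    revert ha; generalize l a = p; generalize l 0 = q; revert p q; decide
  simp only [Equiv.coe_addRight]
  linear_combination e + this - bit_add_self (l 0) + bit_add_self (l 0)

variable [Module (ZMod 2) V]

lemma add_self_vec (x : V) : x + x = 0 := ZModModule.add_self x

lemma vec_eq_of_add_eq_zero {x y : V} (h : x + y = 0) : x = y := by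
  rw [← ZModModule.sub_eq_add] at h
  exact sub_eq_zero.1 h

noncomputable instance [Finite V] : Fintype (V →ₗ[ZMod 2] ZMod 2) :=
  have : Finite (V →ₗ[ZMod 2] ZMod 2) := Finite.of_injective _ DFunLike.coe_injective
  Fintype.ofFinite _

lemma card_dual [Fintype V] : Fintype.card (V →ₗ[ZMod 2] ZMod 2) = Fintype.card V := by
  have : Module.Finite (ZMod 2) V := Module.Finite.of_finite
  rw [Module.card_eq_pow_finrank (K := ZMod 2) (V := V),
    Module.card_eq_pow_finrank (K := ZMod 2) (V := V →ₗ[ZMod 2] ZMod 2)]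
  congr 1
  exact Subspace.dual_finrank_eq

lemma exists_dual_eq_one {x : V} (hx : x ≠ 0) : ∃ u : V →ₗ[ZMod 2] ZMod 2, u x = 1 := by
  by_contra! h
  apply hx
  rw [← Module.forall_dual_apply_eq_zero_iff (ZMod 2) x]
  intro u
  exact (zmod_two_cases (u x)).resolve_right (h u)

lemma sum_dual_sgn_of_ne [Fintype V] {x : V} (hx : x ≠ 0) :
    ∑ u : V →ₗ[ZMod 2] ZMod 2, sgn (u x) = 0 := by
  obtain ⟨u, hu⟩ := exists_dual_eq_one hx
  exact sum_sgn_eq_zero_of_shift (Equiv.addRight u) fun v => by simp [hu]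

open Classical in
lemma sum_dual_sgn [Fintype V] (x : V) :
    ∑ u : V →ₗ[ZMod 2] ZMod 2, sgn (u x) = if x = 0 then (Fintype.card V : ℤ) else 0 := by
  split_ifs with h
  · simp [h, card_dual]
  · exact sum_dual_sgn_of_ne h

lemma sum_linear_sgn_of_ne [Fintype V] {u : V →ₗ[ZMod 2] ZMod 2} (hu : u ≠ 0) :
    ∑ x, sgn (u x) = 0 := by
  refine (isAffine_linear u).sum_sgn_eq_zero ?_
  by_contra! h
  exact hu (LinearMap.ext fun x => by simpa using h x)

/-- Fourier inversion. -/
lemma sum_walsh_mul_sgn [Fintype V] (f : V → ZMod 2) (y : V) :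
    ∑ u : V →ₗ[ZMod 2] ZMod 2, (∑ x, sgn (f x + u x)) * sgn (u y) =
      Fintype.card V * sgn (f y) := by
  classical
  calc _ = ∑ u : V →ₗ[ZMod 2] ZMod 2, ∑ x, sgn (f x) * sgn (u (x + y)) := by
        refine Finset.sum_congr rfl fun u _ => ?_
        rw [Finset.sum_mul]
        refine Finset.sum_congr rfl fun x _ => ?_
        rw [map_add, sgn_add, sgn_add, mul_assoc]
    _ = ∑ x, sgn (f x) * ∑ u : V →ₗ[ZMod 2] ZMod 2, sgn (u (x + y)) := by
        rw [Finset.sum_comm]; simp only [Finset.mul_sum]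
    _ = ∑ x, if x = y then (Fintype.card V : ℤ) * sgn (f y) else 0 := by
        refine Finset.sum_congr rfl fun x _ => ?_
        rw [sum_dual_sgn]
        by_cases h : x = y
        · subst h; simp [add_self_vec, mul_comm]
        · have : x + y ≠ 0 := fun h' => h (vec_eq_of_add_eq_zero h')
          simp [h, this]
    _ = _ := by simp

/-- The derivatives of a bent function are balanced. -/
lemma IsBent.sum_sgn_derivative [Fintype V] {f : V → ZMod 2} (hf : IsBent f) {s : V}
    (hs : s ≠ 0) : ∑ x, sgn (f x + f (x + s)) = 0 := by
  classical
  have h1 : (Fintype.card V : ℤ) * ∑ x, sgn (f x + f (x + s)) = 0 := by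
    calc (Fintype.card V : ℤ) * ∑ x, sgn (f x + f (x + s))
        = ∑ x, sgn (f (x + s)) * (Fintype.card V * sgn (f x)) := by
          rw [Finset.mul_sum]
          refine Finset.sum_congr rfl fun x _ => ?_
          rw [sgn_add]; ring
      _ = ∑ x, ∑ u : V →ₗ[ZMod 2] ZMod 2,
            sgn (f (x + s)) * ((∑ x, sgn (f x + u x)) * sgn (u x)) := by
          simp only [← sum_walsh_mul_sgn, Finset.mul_sum]
      _ = ∑ u : V →ₗ[ZMod 2] ZMod 2, sgn (u s) * (∑ x, sgn (f x + u x)) ^ 2 := by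
          rw [Finset.sum_comm]
          refine Finset.sum_congr rfl fun u _ => ?_
          have : ∑ x, sgn (f x + u x) = ∑ x, sgn (f (x + s)) * sgn (u x) * sgn (u s) := by
            rw [← Equiv.sum_comp (Equiv.addRight s)]
            refine Finset.sum_congr rfl fun x _ => ?_
            simp only [Equiv.coe_addRight, map_add, sgn_add]
            ring
          rw [pow_two]
          nth_rewrite 3 [this]
          rw [Finset.mul_sum, Finset.mul_sum]
          refine Finset.sum_congr rfl fun x _ => ?_
          have := sgn_mul_self (u s)
          linear_combination (-sgn (f (x + s)) * (∑ x, sgn (f x + u x)) * sgn (u x)) * this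
      _ = ∑ u : V →ₗ[ZMod 2] ZMod 2, sgn (u s) * (Fintype.card V : ℤ) := by
          refine Finset.sum_congr rfl fun u _ => ?_
          rw [hf _ (isAffine_linear u)]
      _ = 0 := by rw [← Finset.sum_mul, sum_dual_sgn_of_ne hs, zero_mul]
  rcases mul_eq_zero.1 h1 with h | h
  · have : Nonempty V := ⟨s⟩
    exact absurd h (by exact_mod_cast Fintype.card_ne_zero)
  · exact h

/-- A bent function on a space with `4 ^ m` elements sums to zero over the translates of the image
of every space with `2 ^ (m + 1)` elements. By Poisson summation the signed sum over such an image
is twice a sum of signs over a nontrivial annihilator, hence divisible by four. This is the bound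
on the degree of a bent function. -/
lemma IsBent.sum_subspace_eq_zero [Fintype V] {f : V → ZMod 2} (hf : IsBent f) {T : Type*}
    [AddCommGroup T] [Module (ZMod 2) T] [Fintype T] {m : ℕ} (hm : 2 ≤ m)
    (hV : Fintype.card V = 4 ^ m) (hT : Fintype.card T = 2 ^ (m + 1)) (θ : T →ₗ[ZMod 2] V)
    (x : V) : ∑ t, f (x + θ t) = 0 := by
  classical
  have fV : Module.Finite (ZMod 2) V := Module.Finite.of_finite
  have fT : Module.Finite (ZMod 2) T := Module.Finite.of_finite
  have rV : Module.finrank (ZMod 2) V = 2 * m := by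
    have := Module.card_eq_pow_finrank (K := ZMod 2) (V := V)
    rw [hV, ZMod.card, show 4 = 2 ^ 2 by rfl, ← pow_mul] at this
    exact (Nat.pow_right_injective le_rfl this).symm
  have rT : Module.finrank (ZMod 2) T = m + 1 := by
    have := Module.card_eq_pow_finrank (K := ZMod 2) (V := T)
    rw [hT, ZMod.card] at this
    exact (Nat.pow_right_injective le_rfl this).symm
  let R : (V →ₗ[ZMod 2] ZMod 2) →ₗ[ZMod 2] (T →ₗ[ZMod 2] ZMod 2) := θ.dualMap
  let N := LinearMap.ker R
  have hN : N ≠ ⊥ := by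
    apply LinearMap.ker_ne_bot_of_finrank_lt
    have e1 := Subspace.dual_finrank_eq (K := ZMod 2) (V := V)
    have e2 := Subspace.dual_finrank_eq (K := ZMod 2) (V := T)
    change Module.finrank (ZMod 2) (Module.Dual (ZMod 2) T)
      < Module.finrank (ZMod 2) (Module.Dual (ZMod 2) V)
    omega
  have mN : ∀ u, u ∈ N ↔ ∀ t, u (θ t) = 0 := fun u => by
    rw [LinearMap.mem_ker]
    exact LinearMap.ext_iff
  have cN : Even (Finset.univ.filter fun u => u ∈ N).card := by
    have : (Finset.univ.filter fun u => u ∈ N).card = Fintype.card N := by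
      rw [Fintype.card_subtype]
    rw [this, Module.card_eq_pow_finrank (K := ZMod 2) (V := N), ZMod.card]
    refine (even_two).pow_of_ne_zero ?_
    exact fun h => hN (Submodule.finrank_eq_zero.1 h)
  have hW : ∀ u : V →ₗ[ZMod 2] ZMod 2, ∃ ε : ZMod 2, ∑ y, sgn (f y + u y) = 2 ^ m * sgn ε := by
    intro u
    have := hf _ (isAffine_linear u)
    rw [hV] at this
    have h2 : (∑ y, sgn (f y + u y)) ^ 2 = (2 ^ m) ^ 2 := by
      rw [this]; push_cast; rw [← pow_mul, mul_comm m 2, pow_mul]; norm_num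
    rcases sq_eq_sq_iff_eq_or_eq_neg.1 h2 with h | h
    · exact ⟨0, by simp [h]⟩
    · exact ⟨1, by simp [h]⟩
  choose ε hε using hW
  have hT0 : ∀ u : V →ₗ[ZMod 2] ZMod 2, ∑ t, sgn (u (θ t)) = if u ∈ N then 2 ^ (m + 1) else 0 := by
    intro u
    split_ifs with h
    · rw [mN] at h
      simp [h, hT]
    · refine sum_linear_sgn_of_ne (u := u.comp θ) fun h' => h ?_
      rw [mN]
      exact fun t => LinearMap.congr_fun h' t
  have key : (∑ t, sgn (f (x + θ t)))
      = 2 * ∑ u ∈ Finset.univ.filter (fun u => u ∈ N), sgn (ε u + u x) := by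
    have h4 : (4 : ℤ) ^ m * ∑ t, sgn (f (x + θ t))
        = 4 ^ m * (2 * ∑ u ∈ Finset.univ.filter (fun u => u ∈ N), sgn (ε u + u x)) := by
      calc (4 : ℤ) ^ m * ∑ t, sgn (f (x + θ t))
          = ∑ t, (Fintype.card V : ℤ) * sgn (f (x + θ t)) := by
            rw [Finset.mul_sum, hV]; push_cast; rfl
        _ = ∑ u : V →ₗ[ZMod 2] ZMod 2, ∑ t, 2 ^ m * sgn (ε u) * sgn (u x) * sgn (u (θ t)) := by
            simp only [← sum_walsh_mul_sgn]
            rw [Finset.sum_comm]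
            refine Finset.sum_congr rfl fun u _ => Finset.sum_congr rfl fun t _ => ?_
            rw [hε, map_add, sgn_add]; ring
        _ = ∑ u : V →ₗ[ZMod 2] ZMod 2,
              if u ∈ N then 2 ^ m * 2 ^ (m + 1) * sgn (ε u + u x) else 0 := by
            refine Finset.sum_congr rfl fun u _ => ?_
            rw [← Finset.mul_sum, hT0, sgn_add]
            split_ifs <;> ring
        _ = _ := by
            rw [← Finset.sum_filter, ← Finset.mul_sum]
            have : (2 : ℤ) ^ m * 2 ^ (m + 1) = 4 ^ m * 2 := by
              rw [pow_succ, show (4 : ℤ) = 2 * 2 by norm_num, mul_pow]; ring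
            rw [this]; ring
    exact mul_left_cancel₀ (by positivity) h4
  have hpar : ∀ (A : Finset (V →ₗ[ZMod 2] ZMod 2)) (g : (V →ₗ[ZMod 2] ZMod 2) → ZMod 2),
      Even (A.card) → (2 : ℤ) ∣ ∑ u ∈ A, sgn (g u) := by
    intro A g hA
    have h1 : (2 : ℤ) ∣ ∑ u ∈ A, (sgn (g u) - 1) := Finset.dvd_sum fun u _ => by
      rcases sgn_eq (g u) with h | h <;> rw [h] <;> norm_num
    rw [Finset.sum_sub_distrib] at h1
    have h2 : (2 : ℤ) ∣ ∑ u ∈ A, (1 : ℤ) := by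
      simpa using (even_iff_two_dvd.1 (by exact_mod_cast hA : Even (A.card : ℤ)))
    simpa using dvd_add h1 h2
  have h4 : (4 : ℤ) ∣ ∑ t, sgn (f (x + θ t)) := by
    rw [key]
    obtain ⟨k, hk⟩ := hpar _ (fun u => ε u + u x) cN
    exact ⟨k, by rw [hk]; ring⟩
  have h5 : ∑ t, sgn (f (x + θ t)) = 2 ^ (m + 1) - 2 * ∑ t, ((f (x + θ t)).val : ℤ) := by
    have : ∀ a : ZMod 2, sgn a = 1 - 2 * (a.val : ℤ) := by decide
    simp only [this, Finset.sum_sub_distrib, ← Finset.mul_sum]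
    simp [hT]
  have h6 : (2 : ℤ) ∣ ∑ t, ((f (x + θ t)).val : ℤ) := by
    have : (4 : ℤ) ∣ 2 ^ (m + 1) := by
      obtain ⟨k, rfl⟩ : ∃ k, m = k + 1 := ⟨m - 1, by omega⟩
      exact ⟨2 ^ k, by ring⟩
    omega
  have h7 : ((∑ t, (f (x + θ t)).val : ℕ) : ZMod 2) = ∑ t, f (x + θ t) := by
    push_cast
    exact Finset.sum_congr rfl fun t _ => ZMod.natCast_zmod_val _
  rw [← h7, ZMod.natCast_eq_zero_iff]
  exact_mod_cast h6

end Fourier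

end BentDesign

namespace BentDesign

/-! ### Vanishing second derivatives -/

section SecondDerivative

variable {V : Type*} [AddCommGroup V]

/-- The second derivative of `f` in the directions `a` and `b`. -/
def secondDeriv (f : V → ZMod 2) (a b x : V) : ZMod 2 :=
  f x + f (x + a) + f (x + b) + f (x + (a + b))

lemma secondDeriv_comm (f : V → ZMod 2) (a b x : V) :
    secondDeriv f a b x = secondDeriv f b a x := by
  simp only [secondDeriv, add_comm b a]; ring

lemma secondDeriv_zero (f : V → ZMod 2) (a x : V) : secondDeriv f a 0 x = 0 := by
  simp only [secondDeriv, add_zero]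
  linear_combination bit_add_self (f x) + bit_add_self (f (x + a))

variable [Module (ZMod 2) V]

lemma secondDeriv_self (f : V → ZMod 2) (a x : V) : secondDeriv f a a x = 0 := by
  simp only [secondDeriv, add_self_vec, add_zero]
  linear_combination bit_add_self (f x) + bit_add_self (f (x + a))

lemma secondDeriv_add_self (f : V → ZMod 2) (a b x : V) :
    secondDeriv f a (a + b) x = secondDeriv f a b x := by
  simp only [secondDeriv, ← add_assoc a a b, add_self_vec, zero_add]
  ring

lemma sum_zmod_two {M : Type*} [AddCommMonoid M] (g : ZMod 2 → M) : ∑ t, g t = g 0 + g 1 :=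
  Fin.sum_univ_two g

variable [Fintype V]

lemma IsBent.secondDeriv_const {f : V → ZMod 2} (hf : IsBent f) (hV : Fintype.card V = 16)
    (a b x c : V) : secondDeriv f a b (x + c) = secondDeriv f a b x := by
  have h := hf.sum_subspace_eq_zero (m := 2) (T := ZMod 2 × ZMod 2 × ZMod 2) le_rfl hV
    (by simp) ((LinearMap.fst (ZMod 2) _ _).smulRight a +
      ((LinearMap.fst (ZMod 2) _ _).comp (LinearMap.snd (ZMod 2) _ _)).smulRight b +
      ((LinearMap.snd (ZMod 2) _ _).comp (LinearMap.snd (ZMod 2) _ _)).smulRight c) x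
  simp only [Fintype.sum_prod_type, sum_zmod_two] at h
  simp at h
  apply eq_of_add_eq_zero
  rw [← h]
  simp only [secondDeriv]
  ac_nf

lemma IsBent.isAffine_secondDeriv {f : V → ZMod 2} (hf : IsBent f) (hV : Fintype.card V = 64)
    (a b : V) : IsAffine (secondDeriv f a b) := by
  intro c d
  have h := hf.sum_subspace_eq_zero (m := 3) (T := ZMod 2 × ZMod 2 × ZMod 2 × ZMod 2)
    (by norm_num) hV
    (by simp) ((LinearMap.fst (ZMod 2) _ _).smulRight a +
      ((LinearMap.fst (ZMod 2) _ _).comp (LinearMap.snd (ZMod 2) _ _)).smulRight b +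
      ((LinearMap.fst (ZMod 2) _ _).comp
        ((LinearMap.snd (ZMod 2) _ _).comp (LinearMap.snd (ZMod 2) _ _))).smulRight c +
      ((LinearMap.snd (ZMod 2) _ _).comp
        ((LinearMap.snd (ZMod 2) _ _).comp (LinearMap.snd (ZMod 2) _ _))).smulRight d) 0
  simp only [Fintype.sum_prod_type, sum_zmod_two] at h
  simp at h
  apply eq_of_add_eq_zero
  rw [← h]
  simp only [secondDeriv, zero_add]
  ac_nf

/-- For a bent function, the second derivatives with one fixed direction are as often constantly
zero as they are constantly one, provided all of them are affine. -/
lemma IsBent.card_secondDeriv_eq {f : V → ZMod 2} (hf : IsBent f) {a : V} (ha : a ≠ 0)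
    (hd : ∀ b, IsAffine (secondDeriv f a b)) [DecidablePred fun b => ∀ x, secondDeriv f a b x = 0]
    [DecidablePred fun b => ∀ x, secondDeriv f a b x = 1] :
    (Finset.univ.filter fun b => ∀ x, secondDeriv f a b x = 0).card =
      (Finset.univ.filter fun b => ∀ x, secondDeriv f a b x = 1).card := by
  classical
  have h1 : ∑ b, ∑ x, sgn (secondDeriv f a b x) = 0 := by
    calc ∑ b, ∑ x, sgn (secondDeriv f a b x)
        = ∑ x, sgn (f x + f (x + a)) * ∑ b, sgn (f (x + b) + f (x + b + a)) := by
          rw [Finset.sum_comm]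
          refine Finset.sum_congr rfl fun x _ => ?_
          rw [Finset.mul_sum]
          refine Finset.sum_congr rfl fun b _ => ?_
          rw [← sgn_add]
          congr 1
          simp only [secondDeriv, add_assoc, add_comm a b]
      _ = ∑ x, sgn (f x + f (x + a)) * 0 := by
          refine Finset.sum_congr rfl fun x _ => ?_
          have := Equiv.sum_comp (Equiv.addLeft x) (fun y => sgn (f y + f (y + a)))
          simp only [Equiv.coe_addLeft] at this
          rw [this, hf.sum_sgn_derivative ha]
      _ = 0 := by simp
  have h2 : ∀ b, ∑ x, sgn (secondDeriv f a b x) =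
      (if ∀ x, secondDeriv f a b x = 0 then (Fintype.card V : ℤ) else 0) -
      (if ∀ x, secondDeriv f a b x = 1 then (Fintype.card V : ℤ) else 0) := by
    intro b
    by_cases h : ∃ x, secondDeriv f a b x ≠ secondDeriv f a b 0
    · rw [(hd b).sum_sgn_eq_zero h, if_neg, if_neg, sub_zero]
      · rintro h'; obtain ⟨x, hx⟩ := h; exact hx (by rw [h', h'])
      · rintro h'; obtain ⟨x, hx⟩ := h; exact hx (by rw [h', h'])
    · push Not at h
      simp only [h]
      rcases zmod_two_cases (secondDeriv f a b 0) with h0 | h0 <;> simp [h0]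
  simp only [h2, Finset.sum_sub_distrib, ← Finset.sum_filter, Finset.sum_const, nsmul_eq_mul,
    ← sub_mul] at h1
  rcases mul_eq_zero.1 h1 with h | h
  · have := sub_eq_zero.1 h
    exact_mod_cast this
  · have : Nonempty V := ⟨a⟩
    exact absurd h (by exact_mod_cast Fintype.card_ne_zero)

lemma IsBent.exists_secondDeriv_eq_zero_of_card_sixteen {f : V → ZMod 2} (hf : IsBent f)
    (hV : Fintype.card V = 16) :
    ∃ a b : V, a ≠ 0 ∧ b ≠ 0 ∧ a ≠ b ∧ ∀ x, secondDeriv f a b x = 0 := by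
  classical
  have : Nontrivial V := Fintype.one_lt_card_iff_nontrivial.1 (by omega)
  obtain ⟨a, ha⟩ := exists_ne (0 : V)
  have hc := hf.secondDeriv_const hV a
  have hc0 : ∀ b x, secondDeriv f a b x = secondDeriv f a b 0 := fun b x => by
    simpa using hc b 0 x
  have h1 := hf.card_secondDeriv_eq ha fun b x y => by simp only [hc0 b (_ + _), hc0 b x, hc0 b y]
  have h2 : (Finset.univ.filter fun b => ∀ x, secondDeriv f a b x = 0).card +
      (Finset.univ.filter fun b => ∀ x, secondDeriv f a b x = 1).card = 16 := by
    rw [← hV, ← Finset.card_univ, ← Finset.card_union_of_disjoint]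
    · congr 1
      ext b
      simp only [Finset.mem_union, Finset.mem_filter, Finset.mem_univ, true_and, iff_true, hc0 b]
      simpa using zmod_two_cases (secondDeriv f a b 0)
    · rw [Finset.disjoint_filter]
      intro b _ h h'
      exact zero_ne_one ((h 0).symm.trans (h' 0))
  have h3 : ({0, a} : Finset V).card <
      (Finset.univ.filter fun b => ∀ x, secondDeriv f a b x = 0).card := by
    have := Finset.card_le_two (a := (0 : V)) (b := a)
    omega
  obtain ⟨b, hb, hb'⟩ := Finset.exists_mem_notMem_of_card_lt_card h3
  simp only [Finset.mem_filter, Finset.mem_univ, true_and, Finset.mem_insert,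
    Finset.mem_singleton, not_or] at hb hb'
  exact ⟨a, b, ha, hb'.1, Ne.symm hb'.2, hb⟩

/-- A bent function on a space with `64` elements has a vanishing second derivative. Otherwise the
pairs of directions whose second derivative is constantly one would partition the nonzero vectors
into `21` lines, on each of which `f + f 0` has odd weight, and `f` would have odd weight. -/
lemma IsBent.exists_secondDeriv_eq_zero_of_card_sixtyFour {f : V → ZMod 2} (hf : IsBent f)
    (hV : Fintype.card V = 64) :
    ∃ a b : V, a ≠ 0 ∧ b ≠ 0 ∧ a ≠ b ∧ ∀ x, secondDeriv f a b x = 0 := by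
  classical
  by_contra! hcon
  let P : V → V → Prop := fun a b => ∀ x, secondDeriv f a b x = 1
  have Pcomm : ∀ a b, P a b ↔ P b a := fun a b => by
    simp only [P, secondDeriv_comm f a b]
  have Padd : ∀ a b, P a (a + b) ↔ P a b := fun a b => by
    simp only [P, secondDeriv_add_self]
  have P0 : ∀ b, ¬ P 0 b := fun b h => by
    have := h 0
    rw [secondDeriv_comm, secondDeriv_zero] at this
    exact zero_ne_one this
  have hcard : ∀ a, a ≠ 0 → (Finset.univ.filter fun b => P a b).card = 2 := by
    intro a ha
    rw [← hf.card_secondDeriv_eq ha (hf.isAffine_secondDeriv hV a)]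
    rw [Finset.card_eq_two]
    refine ⟨0, a, ha.symm, ?_⟩
    ext b
    simp only [Finset.mem_filter, Finset.mem_univ, true_and, Finset.mem_insert,
      Finset.mem_singleton]
    constructor
    · intro h
      by_contra! hb
      obtain ⟨x, hx⟩ := hcon a b ha hb.1 (Ne.symm hb.2)
      exact hx (h x)
    · rintro (rfl | rfl) x
      · exact secondDeriv_zero f a x
      · exact secondDeriv_self f b x
  let v : V → ℕ := fun x => (f x + f 0).val
  have v0 : v 0 = 0 := by simp [v, bit_add_self]
  have hPsum : ∀ a, a ≠ 0 → ∀ k : ℕ, (∑ b, if P a b then k else 0) = 2 * k := by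
    intro a ha k
    rw [← Finset.sum_filter, Finset.sum_const, hcard a ha, smul_eq_mul]
  have hs1 : ∑ a, ∑ b, (if P a b then v a else 0) = 2 * ∑ a, v a := by
    rw [Finset.mul_sum]
    refine Finset.sum_congr rfl fun a _ => ?_
    by_cases ha : a = 0
    · subst ha; simp [v0]
    · exact hPsum a ha _
  have hs2 : ∑ a, ∑ b, (if P a b then v b else 0) = 2 * ∑ a, v a := by
    rw [← hs1, Finset.sum_comm]
    simp only [Pcomm]
  have hs3 : ∑ a, ∑ b, (if P a b then v (a + b) else 0) = 2 * ∑ a, v a := by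
    rw [← hs2]
    refine Finset.sum_congr rfl fun a _ => ?_
    rw [← Equiv.sum_comp (Equiv.addLeft a)]
    refine Finset.sum_congr rfl fun b _ => ?_
    simp only [Equiv.coe_addLeft, Padd, ← add_assoc, add_self_vec, zero_add]
  have hs4 : ∑ a, ∑ b, (if P a b then 1 else 0) = 126 := by
    rw [← Finset.sum_erase_add _ _ (Finset.mem_univ (0 : V))]
    have : ∀ a ∈ Finset.univ.erase (0 : V), (∑ b, if P a b then 1 else 0) = 2 := fun a ha =>
      hPsum a (Finset.ne_of_mem_erase ha) 1
    rw [Finset.sum_congr rfl this, Finset.sum_const, Finset.card_erase_of_mem (Finset.mem_univ _),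
      Finset.card_univ, hV]
    simp [P0]
  have hs5 : Even (∑ a, ∑ b, (if P a b then v a * (v b * v (a + b)) else 0)) := by
    refine Finset.even_sum _ fun a _ => ?_
    by_cases ha : a = 0
    · subst ha; simp [v0]
    · rw [← Finset.sum_filter]
      obtain ⟨p, q, hpq, hpq'⟩ := Finset.card_eq_two.1 (hcard a ha)
      have hp : P a p := by
        have : p ∈ Finset.univ.filter fun b => P a b := by rw [hpq']; simp
        simpa using this
      have hq : a + p = q := by
        have : a + p ∈ Finset.univ.filter fun b => P a b := by simpa [Padd] using hp
        rw [hpq'] at this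
        simp only [Finset.mem_insert, Finset.mem_singleton] at this
        exact this.resolve_left fun h => ha (by simpa using h)
      have hq' : a + q = p := by rw [← hq, ← add_assoc, add_self_vec, zero_add]
      rw [hpq', Finset.sum_pair hpq, hq, hq']
      exact ⟨v a * (v p * v q), by ring⟩
  have hodd : ∀ a b, P a b → v a + v b + v (a + b) = 1 + 2 * (v a * (v b * v (a + b))) := by
    intro a b h
    have h0 := h 0
    simp only [secondDeriv, zero_add] at h0
    have : (f a + f 0) + (f b + f 0) + (f (a + b) + f 0) = 1 := by
      linear_combination h0 + bit_add_self (f 0)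
    simp only [v]
    revert this
    generalize f a + f 0 = p
    generalize f b + f 0 = q
    generalize f (a + b) + f 0 = r
    revert p q r
    decide
  have hN : 6 * ∑ a, v a
      = 126 + 2 * ∑ a, ∑ b, (if P a b then v a * (v b * v (a + b)) else 0) := by
    calc 6 * ∑ a, v a = ∑ a, ∑ b, (if P a b then v a + v b + v (a + b) else 0) := by
          have : ∀ a b, (if P a b then v a + v b + v (a + b) else 0) =
              (if P a b then v a else 0) + (if P a b then v b else 0) +
              (if P a b then v (a + b) else 0) := fun a b => by split_ifs <;> rfl
          simp only [this, Finset.sum_add_distrib, hs1, hs2, hs3]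
          ring
      _ = ∑ a, ∑ b, ((if P a b then 1 else 0) +
            2 * (if P a b then v a * (v b * v (a + b)) else 0)) := by
          refine Finset.sum_congr rfl fun a _ => Finset.sum_congr rfl fun b _ => ?_
          split_ifs with h
          · rw [hodd a b h]
          · rfl
      _ = _ := by simp only [Finset.sum_add_distrib, hs4, ← Finset.mul_sum]
  have hw : (∑ x, sgn (f x + f 0)) ^ 2 = 64 := by
    rw [hf _ (isAffine_const _), hV]; rfl
  have hw2 : ∑ x, sgn (f x + f 0) = 64 - 2 * ((∑ a, v a : ℕ) : ℤ) := by
    have : ∀ a : ZMod 2, sgn a = 1 - 2 * (a.val : ℤ) := by decide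
    simp only [this, Finset.sum_sub_distrib, ← Finset.mul_sum]
    simp [hV, v]
  have hw3 : ∑ x, sgn (f x + f 0) = 8 ∨ ∑ x, sgn (f x + f 0) = -8 :=
    sq_eq_sq_iff_eq_or_eq_neg.1 (hw.trans (by norm_num))
  obtain ⟨k, hk⟩ := hs5
  omega

end SecondDerivative

end BentDesign

namespace BentDesign

/-! ### Functions that are affine along a family of parallel subspaces -/

section MaioranaMcFarland

variable {V : Type*} [AddCommGroup V] [Module (ZMod 2) V]
variable {X : Type*} [AddCommGroup X] [Module (ZMod 2) X]
variable {Y : Type*} [AddCommGroup Y]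

/-- The function `(x, y) ↦ ψ(y)(x) + h(y)`, affine along the cosets of `X × 0`. -/
def mmForm (ψ : Y → X →ₗ[ZMod 2] ZMod 2) (h : Y → ZMod 2) : X × Y → ZMod 2 :=
  fun p => ψ p.2 p.1 + h p.2

/-- The substitution of a linear bijection for `x` and of an affine bijection for `y`. -/
lemma mmForm_congr {X' Y' : Type*} [AddCommGroup X'] [Module (ZMod 2) X'] [AddCommGroup Y']
    {ψ : Y → X →ₗ[ZMod 2] ZMod 2} {ψ' : Y' → X' →ₗ[ZMod 2] ZMod 2}
    {h : Y → ZMod 2} (T : X ≃ₗ[ZMod 2] X') (B : Y' ≃ Y) (hB : IsAffine B)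
    (c : X →ₗ[ZMod 2] ZMod 2) (hψ : ∀ y x, ψ (B y) x = ψ' y (T x) + c x) :
    EAEquiv (mmForm ψ h) (mmForm ψ' fun y => h (B y)) := by
  refine ⟨T.toEquiv.prodCongr B.symm, (isAffine_linearEquiv T).prodMap hB.symm, ?_⟩
  convert (isAffine_linear c).comp (isAffine_fst (W := Y)) using 2 with p
  have h1 := hψ (B.symm p.2) p.1
  rw [B.apply_symm_apply] at h1
  have h2 := bit_add_self (h p.2)
  have h3 := bit_add_self (ψ' (B.symm p.2) (T p.1))
  simp only [mmForm, Equiv.prodCongr_apply, Prod.map, B.apply_symm_apply, h1,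
    LinearEquiv.coe_toEquiv]
  linear_combination h2 + h3

open Classical in
lemma sum_mmForm {Y : Type*} [Fintype X] [Fintype Y] (ψ : Y → X →ₗ[ZMod 2] ZMod 2)
    (h : Y → ZMod 2) (u : X →ₗ[ZMod 2] ZMod 2) (v : Y → ZMod 2) :
    ∑ p : X × Y, sgn (mmForm ψ h p + (u p.1 + v p.2)) =
      Fintype.card X * ∑ y ∈ Finset.univ.filter (fun y => ψ y = u), sgn (h y + v y) := by
  rw [Fintype.sum_prod_type, Finset.sum_comm, Finset.mul_sum, Finset.sum_filter]
  refine Finset.sum_congr rfl fun y _ => ?_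
  have : ∀ x, sgn (mmForm ψ h (x, y) + (u x + v y)) = sgn ((ψ y + u) x) * sgn (h y + v y) := by
    intro x
    rw [← sgn_add]
    congr 1
    simp only [mmForm, LinearMap.add_apply]
    ring
  simp only [this, ← Finset.sum_mul]
  split_ifs with hy
  · subst hy
    simp [bit_add_self]
  · rw [sum_linear_sgn_of_ne, zero_mul]
    exact fun h0 => hy (vec_eq_of_add_eq_zero h0)

variable [Module (ZMod 2) Y]

/-- An injective linear map extends to an isomorphism from a product with any space of the
complementary size. -/
lemma exists_linearEquiv_extending [Fintype V] [Fintype X] [Fintype Y] (θ : X →ₗ[ZMod 2] V)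
    (hθ : Function.Injective θ) (hc : Fintype.card X * Fintype.card Y = Fintype.card V) :
    ∃ e : (X × Y) ≃ₗ[ZMod 2] V, ∀ x, e (x, 0) = θ x := by
  classical
  have fV : Module.Finite (ZMod 2) V := Module.Finite.of_finite
  have fY : Module.Finite (ZMod 2) Y := Module.Finite.of_finite
  obtain ⟨C, hC⟩ := Submodule.exists_isCompl (LinearMap.range θ)
  let e1 : X ≃ₗ[ZMod 2] LinearMap.range θ := LinearEquiv.ofInjective θ hθ
  let e2 := Submodule.prodEquivOfIsCompl _ _ hC
  have hcard : Fintype.card X * Fintype.card C = Fintype.card V := by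
    rw [Fintype.card_congr e1.toEquiv, ← Fintype.card_prod, Fintype.card_congr e2.toEquiv]
  have hYC : Fintype.card Y = Fintype.card C :=
    Nat.eq_of_mul_eq_mul_left Fintype.card_pos (hc.trans hcard.symm)
  have hr : Module.finrank (ZMod 2) Y = Module.finrank (ZMod 2) C := by
    rw [Module.card_eq_pow_finrank (K := ZMod 2) (V := Y),
      Module.card_eq_pow_finrank (K := ZMod 2) (V := C), ZMod.card] at hYC
    exact Nat.pow_right_injective le_rfl hYC
  refine ⟨(e1.prodCongr (LinearEquiv.ofFinrankEq Y C hr)).trans e2, fun x => ?_⟩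
  simp [e2, e1]

variable [Fintype X] [Fintype Y]

open Classical in
lemma IsBent.sum_fiber_sq {ψ : Y → X →ₗ[ZMod 2] ZMod 2} {h : Y → ZMod 2}
    (hf : IsBent (mmForm ψ h)) (u : X →ₗ[ZMod 2] ZMod 2) (v : Y →ₗ[ZMod 2] ZMod 2) :
    Fintype.card X * (∑ y ∈ Finset.univ.filter (fun y => ψ y = u), sgn (h y + v y)) ^ 2
      = (Fintype.card Y : ℤ) := by
  have h1 := hf (fun p => u p.1 + v p.2)
    (((isAffine_linear u).comp isAffine_fst).add ((isAffine_linear v).comp isAffine_snd))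
  rw [sum_mmForm, Fintype.card_prod] at h1
  push_cast at h1
  have h2 : (Fintype.card X : ℤ) ≠ 0 := by exact_mod_cast Fintype.card_ne_zero
  apply mul_left_cancel₀ h2
  rw [← h1]
  ring

open Classical in
/-- The fibres of `ψ` all have the same size: by Parseval, summing `IsBent.sum_fiber_sq` over the
functionals `v` counts the fibre. -/
lemma IsBent.card_fiber {ψ : Y → X →ₗ[ZMod 2] ZMod 2} {h : Y → ZMod 2}
    (hf : IsBent (mmForm ψ h)) (u : X →ₗ[ZMod 2] ZMod 2) :
    Fintype.card X * (Finset.univ.filter fun y => ψ y = u).card = Fintype.card Y := by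
  set P := Finset.univ.filter fun y => ψ y = u
  have h1 : ∑ v : Y →ₗ[ZMod 2] ZMod 2, (∑ y ∈ P, sgn (h y + v y)) ^ 2
      = Fintype.card Y * P.card := by
    calc _ = ∑ v : Y →ₗ[ZMod 2] ZMod 2, ∑ y ∈ P, ∑ z ∈ P,
            sgn (h y) * sgn (h z) * sgn (v (y + z)) := by
          refine Finset.sum_congr rfl fun v _ => ?_
          rw [pow_two, Finset.sum_mul_sum]
          refine Finset.sum_congr rfl fun y _ => Finset.sum_congr rfl fun z _ => ?_
          rw [map_add, sgn_add, sgn_add, sgn_add]; ring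
      _ = ∑ y ∈ P, ∑ z ∈ P, sgn (h y) * sgn (h z) *
            ∑ v : Y →ₗ[ZMod 2] ZMod 2, sgn (v (y + z)) := by
          rw [Finset.sum_comm]
          refine Finset.sum_congr rfl fun y _ => ?_
          rw [Finset.sum_comm]
          simp only [Finset.mul_sum]
      _ = ∑ y ∈ P, ∑ z ∈ P, if y = z then (Fintype.card Y : ℤ) else 0 := by
          refine Finset.sum_congr rfl fun y _ => Finset.sum_congr rfl fun z _ => ?_
          rw [sum_dual_sgn]
          by_cases hyz : y = z
          · subst hyz; simp [add_self_vec, sgn_mul_self]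
          · have : y + z ≠ 0 := fun h' => hyz (vec_eq_of_add_eq_zero h')
            simp [hyz, this]
      _ = _ := by
          simp only [Finset.sum_ite_eq]
          rw [Finset.sum_congr rfl fun y hy => if_pos hy]
          simp [mul_comm]
  have h2 : (Fintype.card Y : ℤ) * (Fintype.card X * P.card) = Fintype.card Y * Fintype.card Y := by
    calc (Fintype.card Y : ℤ) * (Fintype.card X * P.card)
        = ∑ v : Y →ₗ[ZMod 2] ZMod 2, Fintype.card X * (∑ y ∈ P, sgn (h y + v y)) ^ 2 := by
          rw [← Finset.mul_sum, h1]; ring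
      _ = ∑ v : Y →ₗ[ZMod 2] ZMod 2, (Fintype.card Y : ℤ) :=
          Finset.sum_congr rfl fun v _ => hf.sum_fiber_sq u v
      _ = _ := by simp [card_dual]
  have h3 : (Fintype.card Y : ℤ) ≠ 0 := by exact_mod_cast Fintype.card_ne_zero
  exact_mod_cast mul_left_cancel₀ h3 h2

lemma IsBent.bijective_of_card_eq {ψ : Y → X →ₗ[ZMod 2] ZMod 2} {h : Y → ZMod 2}
    (hf : IsBent (mmForm ψ h)) (hc : Fintype.card X = Fintype.card Y) :
    Function.Bijective ψ := by
  classical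
  rw [Fintype.bijective_iff_surjective_and_card, card_dual]
  refine ⟨fun u => ?_, hc.symm⟩
  have h1 := hf.card_fiber u
  have h2 : (Finset.univ.filter fun y => ψ y = u).Nonempty := by
    rw [← Finset.card_pos]
    by_contra! h0
    have h3 : (Finset.univ.filter fun y => ψ y = u).card = 0 := by omega
    rw [h3, mul_zero] at h1
    exact Fintype.card_ne_zero h1.symm
  obtain ⟨y, hy⟩ := h2
  exact ⟨y, by simpa using hy⟩

lemma isBent_mmForm {ψ : Y → X →ₗ[ZMod 2] ZMod 2} (hψ : Function.Bijective ψ) (h : Y → ZMod 2) :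
    IsBent (mmForm ψ h) := by
  classical
  intro l hl
  obtain ⟨w, hw⟩ := hl.exists_linear
  let u : X →ₗ[ZMod 2] ZMod 2 := w.comp (LinearMap.inl _ _ _)
  have hl' : ∀ p : X × Y, l p = u p.1 + (w (0, p.2) + l 0) := fun p => by
    rw [hw]
    simp only [u, LinearMap.comp_apply, LinearMap.inl_apply, ← add_assoc, ← map_add, Prod.mk_add_mk,
      add_zero, zero_add]
  have hsum : ∑ p, sgn (mmForm ψ h p + l p)
      = ∑ p : X × Y, sgn (mmForm ψ h p + (u p.1 + (w (0, p.2) + l 0))) :=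
    Finset.sum_congr rfl fun p _ => by rw [hl' p]
  rw [hsum, sum_mmForm ψ h u (fun y => w (0, y) + l 0)]
  obtain ⟨y, hy⟩ := hψ.2 u
  have : (Finset.univ.filter fun y => ψ y = u) = {y} := by
    ext z
    simp only [Finset.mem_filter, Finset.mem_univ, true_and, Finset.mem_singleton, ← hy]
    exact hψ.1.eq_iff
  rw [this, Finset.sum_singleton, mul_pow, pow_two (sgn _), sgn_mul_self, mul_one,
    Fintype.card_prod, ← card_dual (V := X), ← Fintype.card_of_bijective hψ]
  push_cast
  ring

/-- In the case of a two-dimensional `X` and a four-dimensional `Y`, the fibres of `ψ` are affine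
planes. -/
lemma IsBent.fiber_add_mem {ψ : Y → X →ₗ[ZMod 2] ZMod 2} {h : Y → ZMod 2}
    (hf : IsBent (mmForm ψ h)) (hX : Fintype.card X = 4) (hY : Fintype.card Y = 16) {p q r : Y}
    (hpq : p ≠ q) (hpr : p ≠ r) (hqr : q ≠ r) (hq : ψ q = ψ p) (hr : ψ r = ψ p) :
    ψ (p + q + r) = ψ p := by
  classical
  have hc := hf.card_fiber (ψ p)
  set P := Finset.univ.filter fun y => ψ y = ψ p with hP
  have h3 : ({p, q, r} : Finset Y).card < P.card := by
    have := Finset.card_le_three (a := p) (b := q) (c := r)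
    rw [hX, hY] at hc
    omega
  obtain ⟨s, hs, hs'⟩ := Finset.exists_mem_notMem_of_card_lt_card h3
  simp only [Finset.mem_insert, Finset.mem_singleton, not_or] at hs'
  have hPe : P = {p, q, r, s} := by
    symm
    apply Finset.eq_of_subset_of_card_le
    · intro y hy
      simp only [Finset.mem_insert, Finset.mem_singleton] at hy
      rcases hy with rfl | rfl | rfl | rfl
      · simp [hP]
      · simpa [hP] using hq
      · simpa [hP] using hr
      · exact hs
    · rw [hX, hY] at hc
      rw [Finset.card_insert_of_notMem, Finset.card_insert_of_notMem, Finset.card_pair]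
      · omega
      · exact fun e => hs'.2.2 e.symm
      · simp only [Finset.mem_insert, Finset.mem_singleton, not_or]
        exact ⟨hqr, fun e => hs'.2.1 e.symm⟩
      · simp only [Finset.mem_insert, Finset.mem_singleton, not_or]
        exact ⟨hpq, hpr, fun e => hs'.1 e.symm⟩
  have hodd : ∀ v : Y →ₗ[ZMod 2] ZMod 2,
      (h p + v p) + (h q + v q) + (h r + v r) + (h s + v s) = 1 := by
    intro v
    have h1 := hf.sum_fiber_sq (ψ p) v
    rw [← hP, hPe, hX, hY, Finset.sum_insert, Finset.sum_insert, Finset.sum_pair] at h1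
    · have h2 : (sgn (h p + v p) + (sgn (h q + v q) + (sgn (h r + v r) + sgn (h s + v s)))) ^ 2
          = 4 := by push_cast at h1; linarith
      revert h2
      generalize h p + v p = a
      generalize h q + v q = b
      generalize h r + v r = c
      generalize h s + v s = d
      revert a b c d
      decide
    · exact fun e => hs'.2.2 e.symm
    · simp only [Finset.mem_insert, Finset.mem_singleton, not_or]
      exact ⟨hqr, fun e => hs'.2.1 e.symm⟩
    · simp only [Finset.mem_insert, Finset.mem_singleton, not_or]
      exact ⟨hpq, hpr, fun e => hs'.1 e.symm⟩
  have h0 := hodd 0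
  simp only [LinearMap.zero_apply, add_zero] at h0
  have hsum : p + q + r + s = 0 := by
    rw [← Module.forall_dual_apply_eq_zero_iff (ZMod 2)]
    intro v
    have := hodd v
    simp only [map_add]
    linear_combination this - h0
  rw [vec_eq_of_add_eq_zero hsum]
  exact (Finset.mem_filter.1 hs).2

end MaioranaMcFarland

/-! ### Partitions of a four-dimensional space into four affine planes -/

section Partition

variable {Y Z : Type*} [AddCommGroup Y]

/-- The translations that preserve the fibre of `ψ` over `s`. -/
def fiberDirections [Finite Y] (ψ : Y → Z) (s : Z) : AddSubgroup Y where
  carrier := {d | ∀ y, ψ y = s → ψ (y + d) = s}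
  zero_mem' := fun y hy => by simpa using hy
  add_mem' := fun {d e} hd he y hy => by rw [← add_assoc]; exact he _ (hd _ hy)
  neg_mem' := fun {d} hd y hy => by
    -- translation by `d` permutes the finite fibre
    have hinj : Function.Injective fun z : {z // ψ z = s} =>
        (⟨z.1 + d, hd _ z.2⟩ : {z // ψ z = s}) :=
      fun a b hab => Subtype.ext (add_right_cancel (congrArg Subtype.val hab))
    obtain ⟨⟨z, hz⟩, hzy⟩ := Finite.surjective_of_injective hinj ⟨y, hy⟩
    have : z + d = y := congrArg Subtype.val hzy
    rw [← this]
    simpa using hz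

/-- Two elements of a subgroup outside a subgroup of index two in it differ by an element of the
latter. -/
lemma add_mem_of_card_eq_two_mul [Finite Y] {D H : AddSubgroup Y} (hDH : D ≤ H)
    (hc : Nat.card H = 2 * Nat.card D) {a b : Y} (ha : a ∈ H) (hb : b ∈ H) (ha' : a ∉ D)
    (hb' : b ∉ D) : a + b ∈ D := by
  have h1 : (D.addSubgroupOf H).index = 2 := by
    have h2 := (D.addSubgroupOf H).card_mul_index
    rw [Nat.card_congr (AddSubgroup.addSubgroupOfEquivOfLe hDH).toEquiv, hc, mul_comm] at h2
    exact Nat.eq_of_mul_eq_mul_right Nat.card_pos h2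
  have h2 := AddSubgroup.add_mem_iff_of_index_two h1 (a := ⟨a, ha⟩) (b := ⟨b, hb⟩)
  simp only [AddSubgroup.mem_addSubgroupOf] at h2
  exact h2.2 ⟨fun h => absurd h ha', fun h => absurd h hb'⟩

variable [Module (ZMod 2) Y] [Fintype Y] {ψ : Y → Z}

lemma add_mem_fiberDirections
    (hp : ∀ p q r, p ≠ q → p ≠ r → q ≠ r → ψ q = ψ p → ψ r = ψ p → ψ (p + q + r) = ψ p)
    {s : Z} {p q : Y} (h1 : ψ p = s) (h2 : ψ q = s) : p + q ∈ fiberDirections ψ s := by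
  intro y hy
  rw [← add_assoc]
  by_cases e1 : y = p
  · rw [e1, add_self_vec, zero_add, h2]
  by_cases e2 : y = q
  · rw [e2, add_assoc, add_comm p, ← add_assoc, add_self_vec, zero_add, h1]
  by_cases e3 : p = q
  · rw [e3, add_assoc, add_self_vec, add_zero, hy]
  rw [hp y p q e1 e2 e3 (h1.trans hy.symm) (h2.trans hy.symm), hy]

lemma add_mem_fiberDirections_iff
    (hp : ∀ p q r, p ≠ q → p ≠ r → q ≠ r → ψ q = ψ p → ψ r = ψ p → ψ (p + q + r) = ψ p)
    {s : Z} {p q : Y} (h1 : ψ p = s) : p + q ∈ fiberDirections ψ s ↔ ψ q = s := by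
  refine ⟨fun h => ?_, add_mem_fiberDirections hp h1⟩
  have := h p h1
  rwa [← add_assoc, add_self_vec, zero_add] at this

open Classical in
lemma card_fiberDirections
    (hp : ∀ p q r, p ≠ q → p ≠ r → q ≠ r → ψ q = ψ p → ψ r = ψ p → ψ (p + q + r) = ψ p)
    {s : Z} {p : Y} (h1 : ψ p = s) :
    Nat.card (fiberDirections ψ s) = (Finset.univ.filter fun y => ψ y = s).card := by
  rw [← Fintype.card_subtype, ← Nat.card_eq_fintype_card]
  refine Nat.card_congr ((Equiv.addLeft p).subtypeEquiv fun d => ?_)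
  rw [Equiv.coe_addLeft, ← add_mem_fiberDirections_iff hp h1, ← add_assoc, add_self_vec, zero_add]

/-- If a space with `16` elements is partitioned into four affine planes, then the planes have a
common direction. Two of the direction planes, if distinct, meet in a line, because the affine
planes are disjoint, and they span a hyperplane; the other affine planes fill up its two cosets. -/
lemma exists_common_direction (hY : Fintype.card Y = 16)
    (hψ : Function.Surjective ψ) (hcard : ∀ s, Nat.card (fiberDirections ψ s) = 4)
    (hp : ∀ p q r, p ≠ q → p ≠ r → q ≠ r → ψ q = ψ p → ψ r = ψ p → ψ (p + q + r) = ψ p) :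
    ∃ c, c ≠ 0 ∧ ∀ y, ψ (y + c) = ψ y := by
  classical
  set D := fiberDirections ψ with hD
  by_cases hall : ∀ s t, D s = D t
  · have : (D (ψ 0)) ≠ ⊥ := fun h => by
      have := hcard (ψ 0)
      rw [h] at this
      simp at this
    obtain ⟨c, hc⟩ := AddSubgroup.ne_bot_iff_exists_ne_zero.1 this
    exact ⟨c, fun h => hc (Subtype.ext h), fun y => by
      have h2 : (c : Y) ∈ D (ψ y) := by
        rw [← hall (ψ 0)]
        exact c.2
      exact h2 y rfl⟩
  push Not at hall
  obtain ⟨s, t, hst⟩ := hall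
  obtain ⟨ps, hps⟩ := hψ s
  obtain ⟨pt, hpt⟩ := hψ t
  have hne : s ≠ t := fun h => hst (by rw [h])
  have hsum : ∀ d ∈ D s, ∀ e ∈ D t, ps + pt ≠ d + e := by
    intro d hd e he h
    have h1 : ps + d = pt + e := by
      have : ps + d + (pt + e) = 0 := by
        rw [add_add_add_comm, ← h, add_self_vec]
      exact vec_eq_of_add_eq_zero this
    exact hne (by rw [← hd ps hps, ← he pt hpt, h1])
  set H := D s ⊔ D t with hH
  have hH16 : ps + pt ∉ H := fun h => by
    obtain ⟨d, hd, e, he, h'⟩ := AddSubgroup.mem_sup.1 h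
    exact hsum d hd e he h'.symm
  have hsH : D s ≤ H := le_sup_left
  have htH : D t ≤ H := le_sup_right
  have hcs := hcard s
  have hct := hcard t
  have hcY : Nat.card Y = 16 := by rw [Nat.card_eq_fintype_card, hY]
  have hcH : Nat.card H = 8 := by
    have h1 : 4 ∣ Nat.card H := by rw [← hcs]; exact AddSubgroup.card_dvd_of_le hsH
    have h2 : Nat.card H ∣ 16 := by rw [← hcY]; exact H.card_addSubgroup_dvd_card
    have h3 : Nat.card H ≠ 4 := fun h => hst <| by
      rw [AddSubgroup.eq_of_le_of_card_ge hsH (by omega),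
        AddSubgroup.eq_of_le_of_card_ge htH (by omega)]
    have h4 : Nat.card H ≠ 16 := fun h => hH16 <| by
      rw [(AddSubgroup.card_eq_iff_eq_top H).1 (h.trans hcY.symm)]
      exact AddSubgroup.mem_top _
    obtain ⟨k, hk⟩ := h1
    have : Nat.card H ≤ 16 := Nat.le_of_dvd (by norm_num) h2
    have hk4 : k ≤ 4 := by omega
    rw [hk] at h2 h3 h4 ⊢
    interval_cases k <;> omega
  have hHi : H.index = 2 := by
    have := H.card_mul_index
    rw [hcH, hcY] at this
    omega
  -- every vector lies in exactly one of the cosets `ps + H` and `pt + H`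
  have hor : ∀ y, ps + y ∈ H ∨ pt + y ∈ H := by
    intro y
    by_contra! h
    have h1 : (ps + y) + (pt + y) ∈ H :=
      (AddSubgroup.add_mem_iff_of_index_two hHi).2
        ⟨fun h' => absurd h' h.1, fun h' => absurd h' h.2⟩
    rw [add_add_add_comm, add_self_vec, add_zero] at h1
    exact hH16 h1
  have hinter : ∃ c, c ≠ 0 ∧ c ∈ D s ∧ c ∈ D t := by
    by_contra! h
    have hinj : Function.Injective fun p : D s × D t => (p.1 : Y) + p.2 := by
      rintro ⟨⟨d, hd⟩, ⟨e, he⟩⟩ ⟨⟨d', hd'⟩, ⟨e', he'⟩⟩ heq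
      simp only at heq
      have h1 : d + d' = e + e' := by
        apply vec_eq_of_add_eq_zero
        rw [add_add_add_comm, heq, add_add_add_comm, add_self_vec, add_self_vec, add_zero]
      have h2 : d + d' = 0 := by
        by_contra h0
        exact h _ h0 ((D s).add_mem hd hd') (h1 ▸ (D t).add_mem he he')
      rw [Prod.mk.injEq, Subtype.mk.injEq, Subtype.mk.injEq]
      exact ⟨vec_eq_of_add_eq_zero h2, vec_eq_of_add_eq_zero (h1 ▸ h2)⟩
    have hbij := (Nat.bijective_iff_injective_and_card _).2 ⟨hinj, by
      rw [Nat.card_prod, hcs, hct, hcY]⟩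
    obtain ⟨⟨d, e⟩, hde⟩ := hbij.2 (ps + pt)
    exact hsum d d.2 e e.2 hde.symm
  obtain ⟨c, hc0, hcs', hct'⟩ := hinter
  have huniq : ∀ d, d ≠ 0 → d ∈ D s → d ∈ D t → d = c := by
    intro d hd0 hds hdt
    by_contra hdc
    apply hst
    have hsub : ∀ E : AddSubgroup Y, Nat.card E = 4 → c ∈ E → d ∈ E →
        (E : Set Y) = ({0, c, d, c + d} : Finset Y) := by
      intro E hE hcE hdE
      symm
      refine Set.eq_of_subset_of_ncard_le ?_ ?_ (Set.toFinite _)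
      · intro x hx
        simp only [Finset.coe_insert, Finset.coe_singleton, Set.mem_insert_iff,
          Set.mem_singleton_iff] at hx
        rcases hx with rfl | rfl | rfl | rfl
        exacts [E.zero_mem, hcE, hdE, E.add_mem hcE hdE]
      · rw [Set.ncard_coe_finset, Finset.card_insert_of_notMem, Finset.card_insert_of_notMem,
          Finset.card_pair]
        · exact hE.le
        · exact fun h => hc0 (by simpa using h)
        · simp only [Finset.mem_insert, Finset.mem_singleton, not_or]
          exact ⟨fun h => hdc h.symm, fun h => hd0 (by simpa using h)⟩
        · simp only [Finset.mem_insert, Finset.mem_singleton, not_or]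
          exact ⟨hc0.symm, hd0.symm, fun h => hdc (vec_eq_of_add_eq_zero
            (by rw [add_comm]; exact h.symm))⟩
    exact SetLike.coe_injective ((hsub _ hcs hcs' hds).trans (hsub _ hct hct' hdt).symm)
  -- two elements of a fibre over another point in the same coset differ by a common direction
  have hdir : ∀ w z z' d, ψ z = w → ∀ u, u ≠ w → ψ z' = u →
      D w ≤ H → Nat.card (D w) = 4 → d ∈ D u → d ∈ H → z + z' ∈ H → d ∈ D w := by
    intro w z z' d hz u huw hz' hwH hw4 hdu hdH hzz
    have h1 : z + z' ∉ D w := fun h =>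
      huw (hz'.symm.trans ((add_mem_fiberDirections_iff hp hz).1 h))
    have h2 : z + (z' + d) ∉ D w := fun h =>
      huw ((hdu z' hz').symm.trans ((add_mem_fiberDirections_iff hp hz).1 h))
    have h3 := add_mem_of_card_eq_two_mul hwH (by omega) hzz
      (by rw [← add_assoc]; exact H.add_mem hzz hdH) h1 h2
    rwa [← add_assoc, ← add_assoc, add_comm (z + z') z, ← add_assoc, add_self_vec, zero_add,
      add_self_vec, zero_add] at h3
  refine ⟨c, hc0, fun y => ?_⟩
  suffices h : ∀ u, c ∈ D u from h (ψ y) y rfl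
  intro u
  by_cases hus : u = s
  · rwa [hus]
  by_cases hut : u = t
  · rwa [hut]
  have hcu := hcard u
  -- if a fibre lies in one coset then it is parallel to the given plane in that coset
  have hone : ∀ w z, ψ z = w → u ≠ w → D w ≤ H → Nat.card (D w) = 4 →
      (∀ y, ψ y = u → z + y ∈ H) → D u = D w := by
    intro w z hz huw hwH hw4 hin
    obtain ⟨z', hz'⟩ := hψ u
    apply AddSubgroup.eq_of_le_of_card_ge _ (by omega)
    intro d hd
    have h1 : d ∈ H := by
      have := H.add_mem (hin z' hz') (hin _ (hd z' hz'))
      rwa [← add_assoc, ← add_assoc, add_comm (z + z') z, ← add_assoc, add_self_vec, zero_add,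
        add_self_vec, zero_add] at this
    have h2 : z + z' ∉ D w := fun h =>
      huw (hz'.symm.trans ((add_mem_fiberDirections_iff hp hz).1 h))
    have h3 : z + (z' + d) ∉ D w := fun h =>
      huw ((hd z' hz').symm.trans ((add_mem_fiberDirections_iff hp hz).1 h))
    have h4 := add_mem_of_card_eq_two_mul hwH (by omega) (hin z' hz') (hin _ (hd z' hz')) h2 h3
    rwa [← add_assoc, ← add_assoc, add_comm (z + z') z, ← add_assoc, add_self_vec, zero_add,
      add_self_vec, zero_add] at h4
  by_cases h1 : ∀ y, ψ y = u → ps + y ∈ H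
  · rwa [hone s ps hps hus hsH hcs h1]
  by_cases h2 : ∀ y, ψ y = u → pt + y ∈ H
  · rwa [hone t pt hpt hut htH hct h2]
  push Not at h1 h2
  obtain ⟨y1, hy1, hy1'⟩ := h1
  obtain ⟨y2, hy2, hy2'⟩ := h2
  have hy1s := (hor y1).resolve_left hy1'
  have hy2s := (hor y2).resolve_right hy2'
  obtain ⟨d, hd0, hdu, hdH⟩ : ∃ d, d ≠ 0 ∧ d ∈ D u ∧ d ∈ H := by
    by_contra! hno
    have hsub : ∀ a ∈ D u, ∀ b ∈ D u, a ≠ 0 → b ≠ 0 → a = b := by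
      intro a ha b hb ha0 hb0
      by_contra hab
      have h3 : a + b ∈ H := (AddSubgroup.add_mem_iff_of_index_two hHi).2
        ⟨fun h' => absurd h' (hno a ha0 ha), fun h' => absurd h' (hno b hb0 hb)⟩
      exact hno (a + b) (fun h => hab (vec_eq_of_add_eq_zero h)) ((D u).add_mem ha hb) h3
    have h3 : 2 < Fintype.card (D u) := by rw [← Nat.card_eq_fintype_card, hcu]; norm_num
    obtain ⟨a, b, c', hab, hac, hbc⟩ := Fintype.two_lt_card_iff.1 h3
    by_cases ha : (a : Y) = 0
    · have hb : (b : Y) ≠ 0 := fun h => hab (Subtype.ext (ha.trans h.symm))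
      have hc : (c' : Y) ≠ 0 := fun h => hac (Subtype.ext (ha.trans h.symm))
      exact hbc (Subtype.ext (hsub _ b.2 _ c'.2 hb hc))
    by_cases hb : (b : Y) = 0
    · have hc : (c' : Y) ≠ 0 := fun h => hbc (Subtype.ext (hb.trans h.symm))
      exact hac (Subtype.ext (hsub _ a.2 _ c'.2 ha hc))
    exact hab (Subtype.ext (hsub _ a.2 _ b.2 ha hb))
  have hds := hdir s ps y2 d hps u hus hy2 hsH hcs hdu hdH hy2s
  have hdt := hdir t pt y1 d hpt u hut hy1 htH hct hdu hdH hy1s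
  rw [← huniq d hd0 hds hdt]
  exact hdu

end Partition

end BentDesign

namespace BentDesign

/-! ### Normal forms of bent functions in two, four and six variables -/

section NormalForms

/-- Two bits. -/
abbrev Bits2 := ZMod 2 × ZMod 2

/-- Three bits. -/
abbrev Bits3 := ZMod 2 × ZMod 2 × ZMod 2

/-- The linear functional with coefficient vector `w`. -/
def dual2 (w : Bits2) : Bits2 →ₗ[ZMod 2] ZMod 2 where
  toFun x := w.1 * x.1 + w.2 * x.2
  map_add' x y := by simp only [Prod.fst_add, Prod.snd_add]; ring
  map_smul' a x := by simp only [Prod.smul_fst, Prod.smul_snd, smul_eq_mul, RingHom.id_apply]; ring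

/-- The linear functional with coefficient vector `w`. -/
def dual3 (w : Bits3) : Bits3 →ₗ[ZMod 2] ZMod 2 where
  toFun x := w.1 * x.1 + w.2.1 * x.2.1 + w.2.2 * x.2.2
  map_add' x y := by simp only [Prod.fst_add, Prod.snd_add]; ring
  map_smul' a x := by simp only [Prod.smul_fst, Prod.smul_snd, smul_eq_mul, RingHom.id_apply]; ring

lemma dual2_apply (w x : Bits2) : dual2 w x = w.1 * x.1 + w.2 * x.2 := rfl

lemma dual3_apply (w x : Bits3) : dual3 w x = w.1 * x.1 + w.2.1 * x.2.1 + w.2.2 * x.2.2 := rfl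

lemma dual2_injective : Function.Injective dual2 := by
  intro w w' h
  have h1 := LinearMap.congr_fun h (1, 0)
  have h2 := LinearMap.congr_fun h (0, 1)
  simp only [dual2_apply, mul_one, mul_zero, add_zero, zero_add] at h1 h2
  exact Prod.ext h1 h2

lemma dual3_injective : Function.Injective dual3 := by
  intro w w' h
  have h1 := LinearMap.congr_fun h (1, 0, 0)
  have h2 := LinearMap.congr_fun h (0, 1, 0)
  have h3 := LinearMap.congr_fun h (0, 0, 1)
  simp only [dual3_apply, mul_one, mul_zero, add_zero, zero_add] at h1 h2 h3
  exact Prod.ext h1 (Prod.ext h2 h3)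

lemma dual2_bijective : Function.Bijective dual2 :=
  (Fintype.bijective_iff_injective_and_card _).2 ⟨dual2_injective, card_dual.symm⟩

lemma dual3_bijective : Function.Bijective dual3 :=
  (Fintype.bijective_iff_injective_and_card _).2 ⟨dual3_injective, card_dual.symm⟩

/-- The linear map with columns `b₁`, `b₂`, `b₃`. -/
def lin3 (b₁ b₂ b₃ y : Bits3) : Bits3 :=
  (y.1 * b₁.1 + y.2.1 * b₂.1 + y.2.2 * b₃.1,
    y.1 * b₁.2.1 + y.2.1 * b₂.2.1 + y.2.2 * b₃.2.1,
    y.1 * b₁.2.2 + y.2.1 * b₂.2.2 + y.2.2 * b₃.2.2)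

lemma isAffine_lin3 (b₁ b₂ b₃ : Bits3) : IsAffine (lin3 b₁ b₂ b₃) := by
  intro x y
  simp only [lin3, Prod.mk_add_mk, Prod.fst_add, Prod.snd_add, Prod.fst_zero, Prod.snd_zero]
  refine Prod.ext ?_ (Prod.ext ?_ ?_) <;> (dsimp only; ring)

/-- Four permutations of three bits. They represent all permutations up to composition with affine
bijections on both sides; the number of their nonzero component functions that are affine is
`7`, `3`, `1` and `0`. -/
def repPerm : Fin 4 → Bits3 → Bits3
  | 0, y => y
  | 1, y => (y.1, y.2.1, y.2.2 + y.1 * y.2.1)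
  | 2, y => (y.1, y.2.1 + y.1 * y.2.2, y.2.2 + y.1 * y.2.1 + y.1 * y.2.2)
  | 3, y => (y.1 + y.2.1 * y.2.2, y.2.1 + y.1 * y.2.1 + y.1 * y.2.2,
      y.2.2 + y.1 * y.2.1 + y.2.1 * y.2.2)

lemma repPerm_bijective (j : Fin 4) : Function.Bijective (repPerm j) := by
  rw [Fintype.bijective_iff_injective_and_card]
  refine ⟨?_, rfl⟩
  fin_cases j <;> (unfold Function.Injective; decide +kernel)

/-- The function `(x, y) ↦ π(y) · x + h(y)` of six bits. -/
def mm3 (π : Bits3 → Bits3) (h : Bits3 → ZMod 2) : Bits3 × Bits3 → ZMod 2 :=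
  mmForm (fun y => dual3 (π y)) h

/-- Four functions of six bits that represent all bent functions up to equivalence. -/
def bentRep (j : Fin 4) : Bits3 × Bits3 → ZMod 2 := mm3 (repPerm j) fun _ => 0

lemma isBent_bentRep (j : Fin 4) : IsBent (bentRep j) :=
  isBent_mmForm (ψ := fun y => dual3 (repPerm j y))
    (dual3_bijective.comp (repPerm_bijective j)) fun _ => 0

/-- The quadratic bent function of two bits. -/
def bentTwo (x : Bits2) : ZMod 2 := x.1 * x.2

/-! ### Permutations of three bits up to affine bijections -/

/-- The map that fixes zero and the unit vectors and takes given values at the other vectors. -/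
def frameMap (p q r s y : Bits3) : Bits3 :=
  if y = (1, 1, 0) then p else if y = (1, 0, 1) then q else if y = (0, 1, 1) then r else
    if y = (1, 1, 1) then s else y

/-- The three bits of a number, the lowest first. -/
def bits3 (n : ℕ) : Bits3 := ((n : ZMod 2), ((n / 2 : ℕ) : ZMod 2), ((n / 4 : ℕ) : ZMod 2))

/-- A list of pairs of linear maps `B`, `C`, given by their columns, with an index `j`, such that
for every permutation `π` of three bits that fixes zero and the unit vectors,
`π ∘ B = C ∘ repPerm j` for one of the entries. -/
def frameTable : List (Fin 4 × (ℕ × ℕ × ℕ) × (ℕ × ℕ × ℕ)) :=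
  [(0, (1, 2, 4), (1, 2, 4)), (1, (2, 4, 1), (2, 4, 1)), (1, (1, 4, 3), (1, 4, 3)),
   (2, (4, 2, 1), (4, 2, 1)), (2, (4, 1, 2), (4, 1, 2)), (1, (1, 4, 2), (1, 4, 2)),
   (1, (1, 2, 6), (1, 2, 6)), (2, (2, 1, 7), (2, 1, 6)), (2, (1, 3, 5), (1, 5, 6)),
   (3, (4, 1, 2), (4, 1, 2)), (3, (1, 2, 4), (1, 2, 4)), (2, (1, 4, 2), (1, 4, 2)),
   (2, (1, 3, 6), (1, 6, 5)), (3, (2, 1, 4), (2, 1, 4)), (1, (1, 2, 5), (1, 2, 5)),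
   (2, (2, 4, 1), (2, 4, 1)), (2, (1, 2, 7), (1, 2, 5)), (3, (4, 2, 1), (4, 2, 1)),
   (3, (1, 4, 2), (1, 4, 2)), (2, (1, 2, 4), (1, 2, 4)), (2, (2, 1, 4), (2, 1, 4)),
   (1, (1, 2, 4), (1, 2, 4)), (3, (2, 4, 1), (2, 4, 1)), (2, (1, 3, 4), (1, 7, 4))]

/-- The linear map whose columns are the bits of three numbers. -/
def linOfCode (c : ℕ × ℕ × ℕ) : Bits3 → Bits3 := lin3 (bits3 c.1) (bits3 c.2.1) (bits3 c.2.2)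

lemma frameTable_injective : ∀ w ∈ frameTable, (∀ x, linOfCode w.2.1 x = 0 → x = 0) ∧
    ∀ u : Bits3, (dual3 (bits3 w.2.2.1) u = 0 ∧ dual3 (bits3 w.2.2.2.1) u = 0 ∧
      dual3 (bits3 w.2.2.2.2) u = 0) → u = 0 := by
  simp only [dual3_apply]
  decide +kernel

lemma exists_mem_frameTable : ∀ p ∈ [3, 5, 6, 7].map bits3, ∀ q ∈ [3, 5, 6, 7].map bits3,
    ∀ r ∈ [3, 5, 6, 7].map bits3, ∀ s ∈ [3, 5, 6, 7].map bits3, [p, q, r, s].Nodup →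
    ∃ w ∈ frameTable, ∀ y, frameMap p q r s (linOfCode w.2.1 y)
      = linOfCode w.2.2 (repPerm w.1 y) := by
  decide +kernel

end NormalForms

end BentDesign

namespace BentDesign

section Shift

variable {X Y : Type*} [AddCommGroup X] [Module (ZMod 2) X] [AddCommGroup Y]

/-- The substitution `x ↦ x + g(y)` with `g` affine. -/
lemma mmForm_shift {ψ : Y → X →ₗ[ZMod 2] ZMod 2} {h k : Y → ZMod 2} {g : Y → X} (hg : IsAffine g)
    (hk : IsAffine fun y => ψ y (g y) + (h y + k y)) :
    EAEquiv (mmForm ψ h) (mmForm ψ k) := by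
  let φ : X × Y ≃ X × Y :=
    { toFun := fun p => (p.1 + g p.2, p.2)
      invFun := fun p => (p.1 + g p.2, p.2)
      left_inv := fun p => Prod.ext (by simp [add_assoc, add_self_vec]) rfl
      right_inv := fun p => Prod.ext (by simp [add_assoc, add_self_vec]) rfl }
  refine ⟨φ, (isAffine_fst.add (hg.comp isAffine_snd)).prodMk isAffine_snd, ?_⟩
  convert hk.comp (isAffine_snd (V := X)) using 2 with p
  have h1 := bit_add_self (ψ p.2 p.1)
  simp only [mmForm, φ, Equiv.coe_fn_mk, map_add]
  linear_combination h1

end Shift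

section Split

variable {V Y : Type*} [AddCommGroup V] [Module (ZMod 2) V] [AddCommGroup Y] [Module (ZMod 2) Y]
  [Fintype V] [Fintype Y]

/-- A function with a vanishing second derivative is affine along a family of parallel planes. -/
lemma exists_mmForm_of_secondDeriv {f : V → ZMod 2} (hY : 4 * Fintype.card Y = Fintype.card V)
    {a b : V} (ha : a ≠ 0) (hb : b ≠ 0) (hab : a ≠ b) (h : ∀ x, secondDeriv f a b x = 0) :
    ∃ (ψ : Y → Bits2 →ₗ[ZMod 2] ZMod 2) (k : Y → ZMod 2), EAEquiv f (mmForm ψ k) := by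
  let θ : Bits2 →ₗ[ZMod 2] V :=
    (LinearMap.fst (ZMod 2) _ _).smulRight a + (LinearMap.snd (ZMod 2) _ _).smulRight b
  have hθ : ∀ x, θ x = x.1 • a + x.2 • b := fun x => rfl
  have hinj : Function.Injective θ := by
    rw [← LinearMap.ker_eq_bot, LinearMap.ker_eq_bot']
    rintro ⟨s, t⟩ hst
    rw [hθ] at hst
    rcases zmod_two_cases s with rfl | rfl <;> rcases zmod_two_cases t with rfl | rfl
    · rfl
    · simp [hb] at hst
    · simp [ha] at hst
    · simp only [one_smul] at hst
      exact absurd (vec_eq_of_add_eq_zero hst) hab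
  obtain ⟨e, he⟩ := exists_linearEquiv_extending (Y := Y) θ hinj (by simpa using hY)
  have he' : ∀ x y, e (x, y) = e (0, y) + x.1 • a + x.2 • b := fun x y => by
    have : ((x, y) : Bits2 × Y) = (x, 0) + (0, y) := by simp
    rw [this, map_add, he, hθ, add_comm, add_assoc]
  let g : Bits2 × Y → ZMod 2 := fun p => f (e p)
  refine ⟨fun y => dual2 (g ((1, 0), y) + g (0, y), g ((0, 1), y) + g (0, y)), fun y => g (0, y),
    ?_⟩
  convert EAEquiv.of_equiv f e.toEquiv (isAffine_linearEquiv e) using 1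
  funext ⟨⟨s, t⟩, y⟩
  have h0 := h (e (0, y))
  simp only [secondDeriv] at h0
  have g0 : g (0, y) = f (e (0, y)) := rfl
  have g1 : g ((1, 0), y) = f (e (0, y) + a) := congrArg f (by rw [he']; simp)
  have g2 : g ((0, 1), y) = f (e (0, y) + b) := congrArg f (by rw [he']; simp)
  have g3 : g ((1, 1), y) = f (e (0, y) + (a + b)) := congrArg f (by rw [he']; simp [add_assoc])
  change (g ((1, 0), y) + g (0, y)) * s + (g ((0, 1), y) + g (0, y)) * t + g (0, y) = g ((s, t), y)
  have h1 := bit_add_self (g (0, y))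
  rcases zmod_two_cases s with rfl | rfl <;> rcases zmod_two_cases t with rfl | rfl
  · simp only [mul_zero, zero_add]; rfl
  · linear_combination h1
  · linear_combination h1
  · rw [← g0, ← g1, ← g2, ← g3] at h0
    linear_combination h0 - bit_add_self (g ((1, 1), y)) + h1

end Split

/-! ### The classification -/

section Two

lemma IsBent.equiv_bentTwo {V : Type*} [AddCommGroup V] [Module (ZMod 2) V] [Fintype V]
    {f : V → ZMod 2} (hf : IsBent f) (hV : Fintype.card V = 4) : EAEquiv f bentTwo := by
  have fV : Module.Finite (ZMod 2) V := Module.Finite.of_finite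
  let θ : (Fin 0 → ZMod 2) →ₗ[ZMod 2] V := 0
  obtain ⟨e, -⟩ := exists_linearEquiv_extending (Y := Bits2) θ
    (Function.injective_of_subsingleton _) (by simp [hV])
  let e' : Bits2 ≃ₗ[ZMod 2] V := (LinearEquiv.uniqueProd).symm.trans e
  have h1 := EAEquiv.of_equiv f e'.toEquiv (isAffine_linearEquiv e')
  refine h1.trans ?_
  have h2 := hf.congr h1
  refine ⟨Equiv.refl _, isAffine_id, ?_⟩
  have h3 := h2 (fun _ => 0) (isAffine_const 0)
  set g : Bits2 → ZMod 2 := fun x => f (e'.toEquiv x)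
  have h4 : g (0, 0) + g (0, 1) + g (1, 0) + g (1, 1) = 1 := by
    simp only [Fintype.sum_prod_type, sum_zmod_two, add_zero] at h3
    have h5 : (sgn (g (0, 0)) + sgn (g (0, 1)) + (sgn (g (1, 0)) + sgn (g (1, 1)))) ^ 2 = 4 := by
      rw [h3]; rfl
    revert h5
    generalize g (0, 0) = a
    generalize g (0, 1) = b
    generalize g (1, 0) = c
    generalize g (1, 1) = d
    revert a b c d
    decide
  have h6 : ∀ x, bentTwo (Equiv.refl _ x) + g x =
      g 0 + ((g (1, 0) + g 0) * x.1 + (g (0, 1) + g 0) * x.2) := by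
    rintro ⟨s, t⟩
    simp only [bentTwo, Equiv.refl_apply]
    change _ = g (0, 0) + ((g (1, 0) + g (0, 0)) * s + (g (0, 1) + g (0, 0)) * t)
    rcases zmod_two_cases s with rfl | rfl <;> rcases zmod_two_cases t with rfl | rfl <;>
    · revert h4
      generalize g (0, 0) = a
      generalize g (0, 1) = b
      generalize g (1, 0) = c
      generalize g (1, 1) = d
      revert a b c d
      decide
  simp only [h6]
  exact (isAffine_const (V := Bits2) (g 0)).add
    (isAffine_linear (dual2 (g (1, 0) + g 0, g (0, 1) + g 0)))

end Two

section Four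

/-- The quadratic bent function of four bits. -/
def bentFour : Bits2 × Bits2 → ZMod 2 := mmForm (fun y => dual2 y) fun _ => 0

lemma IsBent.equiv_bentFour {V : Type*} [AddCommGroup V] [Module (ZMod 2) V] [Fintype V]
    {f : V → ZMod 2} (hf : IsBent f) (hV : Fintype.card V = 16) : EAEquiv f bentFour := by
  obtain ⟨a, b, ha, hb, hab, h0⟩ := hf.exists_secondDeriv_eq_zero_of_card_sixteen hV
  obtain ⟨ψ, h, hE⟩ := exists_mmForm_of_secondDeriv (Y := Bits2) (by simp [hV]) ha hb hab h0
  refine hE.trans ?_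
  have hψ := (hf.congr hE).bijective_of_card_eq rfl
  set p := ψ (1, 0) + ψ 0 with hp
  set q := ψ (0, 1) + ψ 0 with hq
  have hinj : ∀ {y z}, ψ y + ψ z = 0 → y = z := fun {y z} e =>
    hψ.1 (vec_eq_of_add_eq_zero e)
  have hp0 : p ≠ 0 := fun e => absurd (hinj e) (by decide)
  have hq0 : q ≠ 0 := fun e => absurd (hinj e) (by decide)
  have hpq : p ≠ q := fun e => by
    have := hψ.1 (add_right_cancel e)
    exact absurd this (by decide)
  have hΦ : Function.Injective fun w : Bits2 => w.1 • p + w.2 • q := by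
    rintro ⟨s, t⟩ ⟨s', t'⟩ e
    have e1 : (s + s') • p + (t + t') • q = 0 := by
      simp only [add_smul]
      simp only at e
      rw [add_add_add_comm, e, ← add_add_add_comm, ← add_smul, ← add_smul, bit_add_self,
        bit_add_self]
      simp
    have e2 : s + s' = 0 ∧ t + t' = 0 := by
      rcases zmod_two_cases (s + s') with h1 | h1 <;> rcases zmod_two_cases (t + t') with h2 | h2
      · exact ⟨h1, h2⟩
      · simp [h1, h2, hq0] at e1
      · simp [h1, h2, hp0] at e1
      · simp only [h1, h2, one_smul] at e1
        exact absurd (vec_eq_of_add_eq_zero e1) hpq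
    exact Prod.ext (eq_of_add_eq_zero e2.1) (eq_of_add_eq_zero e2.2)
  have hΦ' := ((Fintype.bijective_iff_injective_and_card _).2 ⟨hΦ, card_dual.symm⟩).2
  let T : Bits2 ≃ₗ[ZMod 2] Bits2 := LinearEquiv.ofInjectiveEndo (p.prod q) <| by
    rw [← LinearMap.ker_eq_bot, LinearMap.ker_eq_bot']
    intro x hx
    have hx1 : p x = 0 := congrArg Prod.fst hx
    have hx2 : q x = 0 := congrArg Prod.snd hx
    by_contra hne
    obtain ⟨u, hu⟩ := exists_dual_eq_one hne
    obtain ⟨w, rfl⟩ := hΦ' u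
    simp [hx1, hx2] at hu
  have hT : ∀ x, T x = (p x, q x) := fun x => rfl
  choose π hπ using fun y => dual2_bijective.2 ((ψ y + ψ 0).comp T.symm.toLinearMap)
  have hπ' : ∀ y x, dual2 (π y) (T x) = ψ y x + ψ 0 x := fun y x => by rw [hπ]; simp
  have hπi : Function.Injective π := fun y z e => hψ.1 <| LinearMap.ext fun x => by
    have := (hπ' y x).symm.trans ((congrArg (fun v => dual2 v (T x)) e).trans (hπ' z x))
    exact add_right_cancel this
  have hfix : ∀ v w, (∀ x, dual2 v (T x) = ψ w x + ψ 0 x) → π w = v := fun v w hv =>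
    dual2_injective <| LinearMap.ext fun x => by
      obtain ⟨x, rfl⟩ := T.surjective x
      rw [hπ', hv]
  have e0 : π 0 = 0 := hfix _ _ fun x => by simp [dual2_apply, bit_add_self]
  have e1 : π (1, 0) = (1, 0) := hfix _ _ fun x => by simp [dual2_apply, hT, hp]
  have e2 : π (0, 1) = (0, 1) := hfix _ _ fun x => by simp [dual2_apply, hT, hq]
  have e3 : π (1, 1) = (1, 1) := by
    have h1 : π (1, 1) ≠ 0 := fun e => absurd (hπi (e.trans e0.symm)) (by decide)
    have h2 : π (1, 1) ≠ (1, 0) := fun e => absurd (hπi (e.trans e1.symm)) (by decide)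
    have h3 : π (1, 1) ≠ (0, 1) := fun e => absurd (hπi (e.trans e2.symm)) (by decide)
    revert h1 h2 h3
    generalize π (1, 1) = v
    revert v
    decide
  have hid : ∀ y, π y = y := by
    rintro ⟨s, t⟩
    rcases zmod_two_cases s with rfl | rfl <;> rcases zmod_two_cases t with rfl | rfl
    exacts [e0, e2, e1, e3]
  have hE2 : EAEquiv (mmForm ψ h) (mmForm (fun y => dual2 y) h) :=
    mmForm_congr T (Equiv.refl Bits2) isAffine_id (ψ 0) fun y x => by
      have := hπ' y x
      rw [hid] at this
      simp only [Equiv.refl_apply]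
      linear_combination - this - bit_add_self (ψ 0 x)
  refine hE2.trans (mmForm_shift
    (g := fun y => ((h (0, 0) + h (1, 0) + h (0, 1) + h (1, 1)) * y.2, 0)) ?_ ?_)
  · intro y z
    refine Prod.ext ?_ ?_ <;> simp
    ring
  · have h6 : ∀ y : Bits2,
        dual2 y ((h (0, 0) + h (1, 0) + h (0, 1) + h (1, 1)) * y.2, 0) + (h y + 0)
        = h 0 + ((h (1, 0) + h 0) * y.1 + (h (0, 1) + h 0) * y.2) := by
      rintro ⟨s, t⟩
      change s * ((h (0, 0) + h (1, 0) + h (0, 1) + h (1, 1)) * t) + t * 0 + (h (s, t) + 0) =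
        h (0, 0) + ((h (1, 0) + h (0, 0)) * s + (h (0, 1) + h (0, 0)) * t)
      rcases zmod_two_cases s with rfl | rfl <;> rcases zmod_two_cases t with rfl | rfl <;>
      · generalize h (0, 0) = a
        generalize h (0, 1) = b
        generalize h (1, 0) = c
        generalize h (1, 1) = d
        revert a b c d
        decide
    simp only [h6]
    exact (isAffine_const (V := Bits2) (h 0)).add
      (isAffine_linear (dual2 (h (1, 0) + h 0, h (0, 1) + h 0)))

end Four

end BentDesign

namespace BentDesign

section Six

/-- A bent function of six bits is affine along a family of parallel three-dimensional spaces. -/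
lemma IsBent.exists_mmForm {V : Type*} [AddCommGroup V] [Module (ZMod 2) V] [Fintype V]
    {f : V → ZMod 2} (hf : IsBent f) (hV : Fintype.card V = 64) :
    ∃ (ψ : Bits3 → Bits3 →ₗ[ZMod 2] ZMod 2) (h : Bits3 → ZMod 2),
      Function.Bijective ψ ∧ EAEquiv f (mmForm ψ h) := by
  classical
  obtain ⟨a, b, ha, hb, hab, h0⟩ := hf.exists_secondDeriv_eq_zero_of_card_sixtyFour hV
  obtain ⟨ψ, h, hE⟩ := exists_mmForm_of_secondDeriv (Y := ZMod 2 × Bits3) (by simp [hV])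
    ha hb hab h0
  have hg := hf.congr hE
  have hX : Fintype.card Bits2 = 4 := rfl
  have hY : Fintype.card (ZMod 2 × Bits3) = 16 := rfl
  have hfib : ∀ u, (Finset.univ.filter fun y => ψ y = u).card = 4 := fun u => by
    have := hg.card_fiber u
    rw [hX, hY] at this
    omega
  have hsurj : Function.Surjective ψ := fun u => by
    have : (Finset.univ.filter fun y => ψ y = u).Nonempty := by
      rw [← Finset.card_pos, hfib]; norm_num
    obtain ⟨y, hy⟩ := this
    exact ⟨y, (Finset.mem_filter.1 hy).2⟩
  have hp : ∀ p q r, p ≠ q → p ≠ r → q ≠ r → ψ q = ψ p → ψ r = ψ p → ψ (p + q + r) = ψ p :=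
    fun p q r h1 h2 h3 h4 h5 => hg.fiber_add_mem hX hY h1 h2 h3 h4 h5
  obtain ⟨c, hc0, hc⟩ := exists_common_direction hY hsurj (fun s => by
    obtain ⟨y, hy⟩ := hsurj s
    rw [card_fiberDirections hp hy]
    convert hfib s) hp
  let θ : ZMod 2 →ₗ[ZMod 2] ZMod 2 × Bits3 := LinearMap.toSpanSingleton _ _ c
  obtain ⟨e, he⟩ := exists_linearEquiv_extending (Y := Bits3) θ (by
    intro s t hst
    have e1 : (s + t) • c = 0 := by
      rw [add_smul]
      have : s • c = t • c := hst
      rw [this, add_self_vec]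
    rcases smul_eq_zero.1 e1 with h' | h'
    · exact eq_of_add_eq_zero h'
    · exact absurd h' hc0) rfl
  have he' : ∀ z, e (1, z) = e (0, z) + c := fun z => by
    have : ((1, z) : ZMod 2 × Bits3) = (1, 0) + (0, z) := by simp
    rw [this, map_add, he, add_comm]
    simp [θ]
  -- regroup the coordinates: the direction `c` joins the plane
  let R : (Bits3 × Bits3) ≃ₗ[ZMod 2] (Bits2 × (ZMod 2 × Bits3)) :=
    LinearEquiv.ofBijective
      (((LinearMap.fst (ZMod 2) _ _).comp (LinearMap.fst (ZMod 2) Bits3 Bits3)).prod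
        ((LinearMap.fst (ZMod 2) _ _).comp
          ((LinearMap.snd (ZMod 2) _ _).comp (LinearMap.fst (ZMod 2) Bits3 Bits3))) |>.prod
        (e.toLinearMap.comp
        (((LinearMap.snd (ZMod 2) _ _).comp
          ((LinearMap.snd (ZMod 2) _ _).comp (LinearMap.fst (ZMod 2) Bits3 Bits3))).prod
        (LinearMap.snd (ZMod 2) Bits3 Bits3)))) (by
      rw [Fintype.bijective_iff_injective_and_card]
      refine ⟨?_, rfl⟩
      rintro ⟨⟨x1, x2, x3⟩, y⟩ ⟨⟨x1', x2', x3'⟩, y'⟩ hxy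
      have h1 := congrArg (fun p => p.1.1) hxy
      have h2 := congrArg (fun p => p.1.2) hxy
      have h3 : ((x3, y) : ZMod 2 × Bits3) = (x3', y') :=
        e.injective (congrArg (fun p => p.2) hxy)
      simp only [Prod.mk.injEq] at h3
      exact Prod.ext (Prod.ext h1 (Prod.ext h2 h3.1)) h3.2)
  have hR : ∀ x1 x2 t z, R ((x1, x2, t), z) = ((x1, x2), e (t, z)) := fun _ _ _ _ => rfl
  have hE2 := hE.trans (EAEquiv.of_equiv (mmForm ψ h) R.toEquiv (isAffine_linearEquiv R))
  let ψ' : Bits3 → Bits3 →ₗ[ZMod 2] ZMod 2 := fun z =>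
    dual3 (ψ (e (0, z)) (1, 0), ψ (e (0, z)) (0, 1), h (e (1, z)) + h (e (0, z)))
  have key : (fun x => mmForm ψ h (R.toEquiv x)) = mmForm ψ' fun z => h (e (0, z)) := by
    funext ⟨⟨x1, x2, t⟩, z⟩
    have h1 : ψ (e (t, z)) = ψ (e (0, z)) := by
      rcases zmod_two_cases t with rfl | rfl
      · rfl
      · rw [he', hc]
    have h2 : ψ (e (0, z)) (x1, x2) = ψ (e (0, z)) (1, 0) * x1 + ψ (e (0, z)) (0, 1) * x2 := by
      have : ((x1, x2) : Bits2) = x1 • (1, 0) + x2 • (0, 1) := by simp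
      rw [this, map_add, map_smul, map_smul, smul_eq_mul, smul_eq_mul]
      ring
    have h3 : h (e (t, z)) = (h (e (1, z)) + h (e (0, z))) * t + h (e (0, z)) := by
      rcases zmod_two_cases t with rfl | rfl
      · simp
      · linear_combination -bit_add_self (h (e (0, z)))
    simp only [LinearEquiv.coe_toEquiv, hR, mmForm, ψ', dual3_apply, h1, h2]
    linear_combination h3
  rw [key] at hE2
  exact ⟨ψ', _, (hf.congr hE2).bijective_of_card_eq rfl, hE2⟩

/-- Affine changes of coordinates bring a bijection of three bits to one that fixes zero and the
unit vectors. -/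
lemma exists_normalized {ψ : Bits3 → Bits3 →ₗ[ZMod 2] ZMod 2} (hψ : Function.Bijective ψ)
    (h : Bits3 → ZMod 2) :
    ∃ (π : Bits3 → Bits3) (k : Bits3 → ZMod 2), Function.Injective π ∧ π 0 = 0 ∧
      π (1, 0, 0) = (1, 0, 0) ∧ π (0, 1, 0) = (0, 1, 0) ∧ π (0, 0, 1) = (0, 0, 1) ∧
      EAEquiv (mmForm ψ h) (mm3 π k) := by
  classical
  set p := ψ (1, 0, 0) + ψ 0 with hp
  set q := ψ (0, 1, 0) + ψ 0 with hq
  have hinj : ∀ {y z}, ψ y + ψ z = 0 → y = z := fun {y z} e =>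
    hψ.1 (vec_eq_of_add_eq_zero e)
  -- at most one of the two candidates for the third vector has a dependent image
  obtain ⟨c, hc, hcr⟩ : ∃ c : Bits3, (c = (0, 0, 1) ∨ c = (1, 0, 1)) ∧ ψ c + ψ 0 ≠ p + q := by
    by_cases h1 : ψ (0, 0, 1) + ψ 0 = p + q
    · refine ⟨(1, 0, 1), Or.inr rfl, fun h2 => ?_⟩
      exact absurd (hψ.1 (add_right_cancel (h1.trans h2.symm))) (by decide)
    · exact ⟨_, Or.inl rfl, h1⟩
  set r := ψ c + ψ 0 with hr
  have hp0 : p ≠ 0 := fun e => absurd (hinj e) (by decide)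
  have hq0 : q ≠ 0 := fun e => absurd (hinj e) (by decide)
  have hr0 : r ≠ 0 := fun e => absurd (hinj e) (by rcases hc with rfl | rfl <;> decide)
  have hpq : p ≠ q := fun e => absurd (hψ.1 (add_right_cancel e)) (by decide)
  have hpr : p ≠ r := fun e => absurd (hψ.1 (add_right_cancel e))
    (by rcases hc with rfl | rfl <;> decide)
  have hqr : q ≠ r := fun e => absurd (hψ.1 (add_right_cancel e))
    (by rcases hc with rfl | rfl <;> decide)
  have hΦ : Function.Injective fun w : Bits3 => w.1 • p + w.2.1 • q + w.2.2 • r := by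
    have hker : ∀ a b d : ZMod 2, a • p + b • q + d • r = 0 → a = 0 ∧ b = 0 ∧ d = 0 := by
      intro a b d e
      rcases zmod_two_cases a with rfl | rfl <;> rcases zmod_two_cases b with rfl | rfl <;>
        rcases zmod_two_cases d with rfl | rfl <;>
        simp only [zero_smul, one_smul, zero_add, add_zero] at e
      · exact ⟨rfl, rfl, rfl⟩
      · exact absurd e hr0
      · exact absurd e hq0
      · exact absurd (vec_eq_of_add_eq_zero e) hqr
      · exact absurd e hp0
      · exact absurd (vec_eq_of_add_eq_zero e) hpr
      · exact absurd (vec_eq_of_add_eq_zero e) hpq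
      · exact absurd (vec_eq_of_add_eq_zero e).symm hcr
    rintro ⟨a, b, d⟩ ⟨a', b', d'⟩ e
    have e1 : (a + a') • p + (b + b') • q + (d + d') • r = 0 := by
      have : (a + a') • p + (b + b') • q + (d + d') • r
          = (a • p + b • q + d • r) + (a' • p + b' • q + d' • r) := by
        simp only [add_smul]; abel
      rw [this]
      exact (congrArg (· + (a' • p + b' • q + d' • r)) e).trans (add_self_vec _)
    obtain ⟨e2, e3, e4⟩ := hker _ _ _ e1
    exact Prod.ext (eq_of_add_eq_zero e2) (Prod.ext (eq_of_add_eq_zero e3) (eq_of_add_eq_zero e4))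
  have hΦ' := ((Fintype.bijective_iff_injective_and_card _).2 ⟨hΦ, card_dual.symm⟩).2
  let T : Bits3 ≃ₗ[ZMod 2] Bits3 := LinearEquiv.ofInjectiveEndo (p.prod (q.prod r)) <| by
    rw [← LinearMap.ker_eq_bot, LinearMap.ker_eq_bot']
    intro x hx
    have hx1 : p x = 0 := congrArg Prod.fst hx
    have hx2 : q x = 0 := congrArg (fun v => v.2.1) hx
    have hx3 : r x = 0 := congrArg (fun v => v.2.2) hx
    by_contra hne
    obtain ⟨u, hu⟩ := exists_dual_eq_one hne
    obtain ⟨w, rfl⟩ := hΦ' u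
    simp [hx1, hx2, hx3] at hu
  have hT : ∀ x, T x = (p x, q x, r x) := fun x => rfl
  let B : Bits3 ≃ Bits3 := Equiv.ofBijective (lin3 (1, 0, 0) (0, 1, 0) c) <| by
    rw [Fintype.bijective_iff_injective_and_card]
    refine ⟨?_, rfl⟩
    rcases hc with rfl | rfl <;> (unfold Function.Injective; decide +kernel)
  have hB : IsAffine B := isAffine_lin3 _ _ _
  have hB0 : B 0 = 0 := by rcases hc with rfl | rfl <;> rfl
  have hB1 : B (1, 0, 0) = (1, 0, 0) := by rcases hc with rfl | rfl <;> rfl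
  have hB2 : B (0, 1, 0) = (0, 1, 0) := by rcases hc with rfl | rfl <;> rfl
  have hB3 : B (0, 0, 1) = c := by rcases hc with rfl | rfl <;> rfl
  choose π hπ using fun y => dual3_bijective.2 ((ψ (B y) + ψ 0).comp T.symm.toLinearMap)
  have hπ' : ∀ y x, dual3 (π y) (T x) = ψ (B y) x + ψ 0 x := fun y x => by rw [hπ]; simp
  have hπi : Function.Injective π := fun y z e => B.injective <| hψ.1 <| LinearMap.ext fun x => by
    have := (hπ' y x).symm.trans ((congrArg (fun v => dual3 v (T x)) e).trans (hπ' z x))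
    exact add_right_cancel this
  have hfix : ∀ v w, (∀ x, dual3 v (T x) = ψ (B w) x + ψ 0 x) → π w = v := fun v w hv =>
    dual3_injective <| LinearMap.ext fun x => by
      obtain ⟨x, rfl⟩ := T.surjective x
      rw [hπ', hv]
  refine ⟨π, fun y => h (B y), hπi, hfix _ _ fun x => ?_, hfix _ _ fun x => ?_,
    hfix _ _ fun x => ?_, hfix _ _ fun x => ?_, ?_⟩
  · simp [dual3_apply, hB0, bit_add_self]
  · simp [dual3_apply, hT, hB1, hp]
  · simp [dual3_apply, hT, hB2, hq]
  · simp [dual3_apply, hT, hB3, hr]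
  · exact mmForm_congr T B hB (ψ 0) fun y x => by
      linear_combination - hπ' y x - bit_add_self (ψ 0 x)

/-- Every permutation of three bits is one of the four representatives, up to affine bijections. -/
lemma exists_repPerm {π : Bits3 → Bits3} (hπ : Function.Injective π) (h0 : π 0 = 0)
    (h1 : π (1, 0, 0) = (1, 0, 0)) (h2 : π (0, 1, 0) = (0, 1, 0)) (h3 : π (0, 0, 1) = (0, 0, 1))
    (h : Bits3 → ZMod 2) : ∃ (j : Fin 4) (k : Bits3 → ZMod 2),
      EAEquiv (mm3 π h) (mm3 (repPerm j) k) := by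
  have hmem : ∀ v : Bits3, v ≠ 0 → v ≠ (1, 0, 0) → v ≠ (0, 1, 0) → v ≠ (0, 0, 1) →
      v ∈ [3, 5, 6, 7].map bits3 := by decide +kernel
  have hm : ∀ y : Bits3, y ≠ 0 → y ≠ (1, 0, 0) → y ≠ (0, 1, 0) → y ≠ (0, 0, 1) →
      π y ∈ [3, 5, 6, 7].map bits3 := fun y k0 k1 k2 k3 =>
    hmem _ (fun e => k0 (hπ (e.trans h0.symm))) (fun e => k1 (hπ (e.trans h1.symm)))
      (fun e => k2 (hπ (e.trans h2.symm))) (fun e => k3 (hπ (e.trans h3.symm)))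
  have hnd : [π (1, 1, 0), π (1, 0, 1), π (0, 1, 1), π (1, 1, 1)].Nodup := by
    have : ([(1, 1, 0), (1, 0, 1), (0, 1, 1), (1, 1, 1)] : List Bits3).Nodup := by decide
    exact this.map hπ
  obtain ⟨w, hw, hwπ⟩ := exists_mem_frameTable _
    (hm (1, 1, 0) (by decide) (by decide) (by decide) (by decide)) _
    (hm (1, 0, 1) (by decide) (by decide) (by decide) (by decide)) _
    (hm (0, 1, 1) (by decide) (by decide) (by decide) (by decide)) _
    (hm (1, 1, 1) (by decide) (by decide) (by decide) (by decide)) hnd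
  have hframe : ∀ y, frameMap (π (1, 1, 0)) (π (1, 0, 1)) (π (0, 1, 1)) (π (1, 1, 1)) y = π y := by
    rintro ⟨a, b, c⟩
    rcases zmod_two_cases a with rfl | rfl <;> rcases zmod_two_cases b with rfl | rfl <;>
      rcases zmod_two_cases c with rfl | rfl
    exacts [h0.symm, h3.symm, h2.symm, rfl, h1.symm, rfl, rfl, rfl]
  simp only [hframe] at hwπ
  obtain ⟨hw1, hw2⟩ := frameTable_injective w hw
  have hBa : IsAffine (linOfCode w.2.1) := isAffine_lin3 _ _ _
  have hB0 : linOfCode w.2.1 0 = 0 := by simp [linOfCode, lin3]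
  let B : Bits3 ≃ Bits3 := Equiv.ofBijective (linOfCode w.2.1) <| by
    rw [Fintype.bijective_iff_injective_and_card]
    refine ⟨fun x y hxy => vec_eq_of_add_eq_zero (hw1 _ ?_), rfl⟩
    have := hBa x y
    rw [hB0, add_zero, hxy, add_self_vec] at this
    exact this
  let T : Bits3 ≃ₗ[ZMod 2] Bits3 := LinearEquiv.ofInjectiveEndo
    ((dual3 (bits3 w.2.2.1)).prod ((dual3 (bits3 w.2.2.2.1)).prod (dual3 (bits3 w.2.2.2.2)))) <| by
    rw [← LinearMap.ker_eq_bot, LinearMap.ker_eq_bot']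
    exact fun x hx => hw2 x ⟨congrArg Prod.fst hx, congrArg (fun v => v.2.1) hx,
      congrArg (fun v => v.2.2) hx⟩
  have hT : ∀ x, T x = (dual3 (bits3 w.2.2.1) x, dual3 (bits3 w.2.2.2.1) x,
    dual3 (bits3 w.2.2.2.2) x) := fun x => rfl
  refine ⟨w.1, fun y => h (B y), mmForm_congr T B hBa 0 fun y x => ?_⟩
  have : π (B y) = linOfCode w.2.2 (repPerm w.1 y) := hwπ y
  rw [this, hT]
  simp only [dual3_apply, linOfCode, lin3, LinearMap.zero_apply]
  ring

/-- A linear-in-`y` (up to constants) translation of `x` that absorbs the nonaffine part of `h` into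
`π(y) · x`. -/
def absorb (j : Fin 4) (α β γ δ : ZMod 2) (y : Bits3) : Bits3 :=
  match j with
  | 0 => (α * y.2.1 + β * y.2.2, γ * y.2.2, 0)
  | 1 => (α * y.2.1 + β * y.2.2, γ * y.2.2, δ * y.2.2)
  | 2 => (α * y.2.1 + (β + γ) * y.2.2, γ * y.2.2 + δ * y.2.1, 0)
  | 3 => (γ + δ * y.1, β * y.1, α * y.2.1)

lemma isAffine_absorb (j : Fin 4) (α β γ δ : ZMod 2) : IsAffine (absorb j α β γ δ) := by
  intro x y
  fin_cases j <;> refine Prod.ext ?_ (Prod.ext ?_ ?_) <;> simp [absorb] <;> ring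

/-- The nonaffine part of a function of three bits. -/
def nonaffinePart (α β γ δ : ZMod 2) (y : Bits3) : ZMod 2 :=
  α * (y.1 * y.2.1) + β * (y.1 * y.2.2) + γ * (y.2.1 * y.2.2) + δ * (y.1 * y.2.1 * y.2.2)

lemma exists_nonaffinePart (h : Bits3 → ZMod 2) : ∃ α β γ δ, ∃ l : Bits3 → ZMod 2, IsAffine l ∧
    ∀ y, h y + l y = nonaffinePart α β γ δ y := by
  refine ⟨h (0, 0, 0) + h (1, 0, 0) + h (0, 1, 0) + h (1, 1, 0),
    h (0, 0, 0) + h (1, 0, 0) + h (0, 0, 1) + h (1, 0, 1),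
    h (0, 0, 0) + h (0, 1, 0) + h (0, 0, 1) + h (0, 1, 1),
    h (0, 0, 0) + h (1, 0, 0) + h (0, 1, 0) + h (1, 1, 0) +
    h (0, 0, 1) + h (1, 0, 1) + h (0, 1, 1) + h (1, 1, 1),
    fun y => h (0, 0, 0) + dual3 (h (0, 0, 0) + h (1, 0, 0), h (0, 0, 0) + h (0, 1, 0),
      h (0, 0, 0) + h (0, 0, 1)) y, (isAffine_const _).add (isAffine_linear _), ?_⟩
  rintro ⟨a, b, c⟩
  simp only [nonaffinePart, dual3_apply]
  generalize h000 : h (0, 0, 0) = z0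
  generalize h100 : h (1, 0, 0) = z1
  generalize h010 : h (0, 1, 0) = z2
  generalize h110 : h (1, 1, 0) = z3
  generalize h001 : h (0, 0, 1) = z4
  generalize h101 : h (1, 0, 1) = z5
  generalize h011 : h (0, 1, 1) = z6
  generalize h111 : h (1, 1, 1) = z7
  rcases zmod_two_cases a with rfl | rfl <;> rcases zmod_two_cases b with rfl | rfl <;>
    rcases zmod_two_cases c with rfl | rfl <;>
    simp only [h000, h100, h010, h110, h001, h101, h011, h111] <;>
    clear h000 h100 h010 h110 h001 h101 h011 h111 <;>
    revert z0 z1 z2 z3 z4 z5 z6 z7 <;> decide +kernel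

lemma dual3_absorb (j : Fin 4) (α β γ δ : ZMod 2) (y : Bits3) :
    dual3 (repPerm j y) (absorb j α β γ δ y) +
      (nonaffinePart α β γ δ y + nonaffinePart 0 0 0 (if j = 0 then δ else 0) y) =
    dual3 (if j = 1 then (0, 0, δ) else if j = 2 then (0, δ, 0) else
      if j = 3 then (γ + δ, 0, 0) else 0) y := by
  simp only [dual3_apply]
  revert j α β γ δ y
  decide +kernel

/-- The cubic monomial cannot be absorbed in `x · y`, but adding it is the same as passing to
the second permutation. -/
lemma equiv_of_cubic : EAEquiv (mm3 (repPerm 0) (nonaffinePart 0 0 0 1)) (bentRep 1) := by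
  let φ : Bits3 × Bits3 ≃ Bits3 × Bits3 :=
    { toFun := fun p => ((p.1.1, p.1.2.1, p.2.2.2), (p.2.1, p.2.2.1, p.1.2.2))
      invFun := fun p => ((p.1.1, p.1.2.1, p.2.2.2), (p.2.1, p.2.2.1, p.1.2.2))
      left_inv := fun _ => rfl
      right_inv := fun _ => rfl }
  refine ⟨φ, fun x y => (add_zero (φ (x + y))).trans rfl, ?_⟩
  convert isAffine_const (V := Bits3 × Bits3) (0 : ZMod 2) using 2 with p
  have h1 := bit_add_self (p.2.1 * p.1.1 + p.2.2.1 * p.1.2.1 + p.1.2.2 * p.2.2.2 +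
    p.2.1 * p.2.2.1 * p.2.2.2)
  simp only [bentRep, mm3, mmForm, φ, Equiv.coe_fn_mk, dual3_apply, repPerm, nonaffinePart]
  linear_combination h1

/-- The classification of bent functions of six bits. -/
theorem IsBent.exists_equiv_bentRep {V : Type*} [AddCommGroup V] [Module (ZMod 2) V] [Fintype V]
    {f : V → ZMod 2} (hf : IsBent f) (hV : Fintype.card V = 64) :
    ∃ j, EAEquiv f (bentRep j) := by
  obtain ⟨ψ, h, hψ, hE⟩ := hf.exists_mmForm hV
  obtain ⟨π, k, hπ, h0, h1, h2, h3, hE2⟩ := exists_normalized hψ h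
  obtain ⟨j, h', hE3⟩ := exists_repPerm hπ h0 h1 h2 h3 k
  obtain ⟨α, β, γ, δ, l, hl, hhl⟩ := exists_nonaffinePart h'
  have hE4 : EAEquiv (mm3 (repPerm j) h') (mm3 (repPerm j) (nonaffinePart α β γ δ)) :=
    mmForm_shift (isAffine_const 0) (by
      convert hl using 2 with y
      rw [map_zero, ← hhl]
      linear_combination bit_add_self (h' y))
  have hE5 := ((hE.trans hE2).trans hE3).trans hE4
  have hE6 := hE5.trans (mmForm_shift (k := nonaffinePart 0 0 0 (if j = 0 then δ else 0))
    (isAffine_absorb j α β γ δ) (by simpa only [dual3_absorb] using isAffine_linear _))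
  have h00 : nonaffinePart 0 0 0 0 = fun _ => 0 := funext fun y => by simp [nonaffinePart]
  by_cases hj : j = 0
  · subst hj
    rcases zmod_two_cases δ with rfl | rfl
    · rw [if_pos rfl, h00] at hE6
      exact ⟨0, hE6⟩
    · rw [if_pos rfl] at hE6
      exact ⟨1, hE6.trans equiv_of_cubic⟩
  · rw [if_neg hj, h00] at hE6
    exact ⟨j, hE6⟩

end Six

end BentDesign

namespace BentDesign

/-! ### Isomorphisms of incidence structures -/

section Isomorphism

universe w

variable {X : IncidenceStructure.{u}} {Y : IncidenceStructure.{v}} {Z : IncidenceStructure.{w}}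

lemma isomorphic_symm (h : X.Isomorphic Y) : Y.Isomorphic X := by
  obtain ⟨φ, ψ, h⟩ := h
  exact ⟨φ.symm, ψ.symm, fun p b => by rw [h]; simp⟩

lemma isomorphic_trans (h : X.Isomorphic Y) (k : Y.Isomorphic Z) : X.Isomorphic Z := by
  obtain ⟨φ, ψ, h⟩ := h
  obtain ⟨φ', ψ', k⟩ := k
  exact ⟨φ.trans φ', ψ.trans ψ', fun p b => by rw [h, k]; rfl⟩

lemma isomorphic_pointsOf {φ : X.Point ≃ Y.Point} {ψ : X.Block ≃ Y.Block}
    (h : ∀ p b, X.incident p b ↔ Y.incident (φ p) (ψ b)) (b : X.Block) :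
    Y.pointsOf (ψ b) = φ '' X.pointsOf b := by
  ext q
  obtain ⟨p, rfl⟩ := φ.surjective q
  rw [φ.injective.mem_set_image]
  exact (h p b).symm

lemma isomorphic_of_pointsOf (φ : X.Point ≃ Y.Point) (hX : Function.Injective X.pointsOf)
    (hY : Function.Injective Y.pointsOf) (h1 : ∀ b, ∃ c, φ '' X.pointsOf b = Y.pointsOf c)
    (h2 : ∀ c, ∃ b, φ '' X.pointsOf b = Y.pointsOf c) : X.Isomorphic Y := by
  choose ψ hψ using h1
  have hinj : Function.Injective ψ := fun b c hbc =>
    hX (φ.injective.image_injective ((hψ b).trans ((congrArg _ hbc).trans (hψ c).symm)))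
  have hsurj : Function.Surjective ψ := fun c => by
    obtain ⟨b, hb⟩ := h2 c
    exact ⟨b, hY ((hψ b).symm.trans hb)⟩
  refine ⟨φ, Equiv.ofBijective ψ ⟨hinj, hsurj⟩, fun p b => ?_⟩
  change p ∈ X.pointsOf b ↔ φ p ∈ Y.pointsOf (ψ b)
  rw [← hψ, φ.injective.mem_set_image]

end Isomorphism

/-! ### Counting with signs -/

section Counting

variable {T : Type*} [Fintype T]

lemma two_mul_ncard (g : T → ZMod 2) :
    2 * ({x | g x = 1}.ncard : ℤ) = Fintype.card T - ∑ x, sgn (g x) := by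
  classical
  have h1 : ∀ a : ZMod 2, sgn a = 1 - 2 * (if a = 1 then 1 else 0) := by decide
  simp only [h1, Finset.sum_sub_distrib, ← Finset.mul_sum]
  rw [Set.ncard_eq_toFinset_card']
  simp

lemma four_mul_ncard_inter (g h : T → ZMod 2) :
    4 * (({x | g x = 1} ∩ {x | h x = 1}).ncard : ℤ) = Fintype.card T - ∑ x, sgn (g x)
      - ∑ x, sgn (h x) + ∑ x, sgn (g x + h x) := by
  classical
  have h1 : ∀ a b : ZMod 2, sgn (a + b) = 4 * (if a = 1 ∧ b = 1 then 1 else 0) - 1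
    + sgn a + sgn b := by decide
  simp only [h1, Finset.sum_sub_distrib, Finset.sum_add_distrib, ← Finset.mul_sum]
  rw [Set.ncard_eq_toFinset_card']
  simp [← Finset.filter_and]

end Counting

section Support

variable {T : Type*}

lemma symmDiff_setOf (g h : T → ZMod 2) :
    symmDiff {x | g x = 1} {x | h x = 1} = {x | g x + h x = 1} := by
  have h1 : ∀ a b : ZMod 2, ((a = 1 ∧ ¬ b = 1) ∨ (b = 1 ∧ ¬ a = 1)) ↔ a + b = 1 := by decide
  ext x
  exact h1 (g x) (h x)

lemma compl_setOf (g : T → ZMod 2) : {x | g x = 1}ᶜ = {x | g x + 1 = 1} := by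
  have h1 : ∀ a : ZMod 2, (¬ a = 1) ↔ a + 1 = 1 := by decide
  ext x
  exact h1 (g x)

lemma eq_of_setOf_eq {g h : T → ZMod 2} (e : {x | g x = 1} = {x | h x = 1}) : g = h := by
  have h1 : ∀ a b : ZMod 2, (a = 1 ↔ b = 1) → a = b := by decide
  funext x
  exact h1 _ _ (Set.ext_iff.1 e x)

end Support

/-! ### The design of a bent function -/

section Design

/-- The incidence structure of a Boolean function `f` on `V`: the points are the vectors, and the
blocks are the supports of the functions `f + l`, with `l` affine, that contain less than half of
the points. -/
def bentDesign {V : Type u} [AddCommGroup V] (f : V → ZMod 2) : IncidenceStructure.{u} where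
  Point := V
  Block := {S : Set V // ∃ l, IsAffine l ∧ S = {x | f x + l x = 1} ∧ 2 * S.ncard < Nat.card V}
  incident := fun x S => x ∈ S.1

variable {V : Type u} [AddCommGroup V]

lemma pointsOf_bentDesign (f : V → ZMod 2) (b : (bentDesign f).Block) :
    (bentDesign f).pointsOf b = b.1 := rfl

lemma pointsOf_bentDesign_injective (f : V → ZMod 2) :
    Function.Injective (bentDesign f).pointsOf := fun _ _ h => Subtype.ext h

lemma exists_block_image {W : Type*} [AddCommGroup W] {f : V → ZMod 2} {g : W → ZMod 2}
    (φ : V ≃ W) (h1 : IsAffine φ) (h2 : IsAffine (fun x => g (φ x) + f x))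
    (b : (bentDesign f).Block) : ∃ c : (bentDesign g).Block, φ '' b.1 = c.1 := by
  obtain ⟨_, l, hl, rfl, hc⟩ := b
  have h3 : φ '' {x | f x + l x = 1}
      = {y | g y + (g y + f (φ.symm y) + l (φ.symm y)) = 1} := by
    ext y
    obtain ⟨x, rfl⟩ := φ.surjective y
    rw [φ.injective.mem_set_image]
    simp only [Set.mem_ofPred_eq, φ.symm_apply_apply]
    rw [← add_assoc, ← add_assoc, bit_add_self, zero_add]
  refine ⟨⟨_, _, ?_, h3, ?_⟩, rfl⟩
  · have := (h2.comp h1.symm).add (hl.comp h1.symm)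
    simpa using this
  · rwa [Set.ncard_image_of_injective _ φ.injective, ← Nat.card_congr φ]

/-- Equivalent functions have isomorphic designs. -/
lemma EAEquiv.isomorphic {W : Type*} [AddCommGroup W] {f : V → ZMod 2} {g : W → ZMod 2}
    (h : EAEquiv f g) : (bentDesign f).Isomorphic (bentDesign g) := by
  obtain ⟨φ, h1, h2⟩ := h
  refine isomorphic_of_pointsOf (X := bentDesign f) (Y := bentDesign g) φ
    (pointsOf_bentDesign_injective f) (pointsOf_bentDesign_injective g)
    (exists_block_image φ h1 h2) fun c => ?_
  have h4 : IsAffine (fun x => f (φ.symm x) + g x) := by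
    have := h2.comp h1.symm
    simpa [add_comm] using this
  obtain ⟨b, hb⟩ := exists_block_image φ.symm h1.symm h4 c
  refine ⟨b, ?_⟩
  rw [pointsOf_bentDesign, pointsOf_bentDesign, ← hb]
  exact φ.image_symm_image _

lemma exists_sign [Fintype V] {f : V → ZMod 2} (hf : IsBent f) {s : ℤ}
    (hs2 : s ^ 2 = Fintype.card V) {l : V → ZMod 2} (hl : IsAffine l) :
    ∃ c : ZMod 2, ∑ x, sgn (f x + (l x + c)) = s := by
  have h1 : (∑ x, sgn (f x + l x)) ^ 2 = s ^ 2 := (hf l hl).trans hs2.symm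
  have h2 : ∀ c : ZMod 2, ∑ x, sgn (f x + (l x + c)) = (∑ x, sgn (f x + l x)) * sgn c := by
    intro c
    rw [Finset.sum_mul]
    exact Finset.sum_congr rfl fun x _ => by rw [← add_assoc, sgn_add]
  rcases sq_eq_sq_iff_eq_or_eq_neg.1 h1 with h | h
  · exact ⟨0, by rw [h2, h]; simp⟩
  · exact ⟨1, by rw [h2, h]; simp⟩

lemma two_mul_ncard_lt_iff {T : Type*} [Fintype T] (g : T → ZMod 2) :
    2 * {x | g x = 1}.ncard < Nat.card T ↔ 0 < ∑ x, sgn (g x) := by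
  have := two_mul_ncard g
  rw [Nat.card_eq_fintype_card]
  omega

variable [Module (ZMod 2) V] [Fintype V]

/-- The blocks of the design of a bent function correspond to the linear functionals: one of any two
complementary supports is a block. -/
lemma exists_blockEquiv {f : V → ZMod 2} (hf : IsBent f) {s : ℤ} (hs : 0 < s)
    (hs2 : s ^ 2 = Fintype.card V) :
    ∃ (c : (V →ₗ[ZMod 2] ZMod 2) → ZMod 2) (E : (V →ₗ[ZMod 2] ZMod 2) ≃ (bentDesign f).Block),
      (∀ u, ∑ x, sgn (f x + (u x + c u)) = s) ∧ ∀ u, (E u).1 = {x | f x + (u x + c u) = 1} := by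
  choose c hc using fun u : V →ₗ[ZMod 2] ZMod 2 => exists_sign hf hs2 (isAffine_linear u)
  let E : (V →ₗ[ZMod 2] ZMod 2) → (bentDesign f).Block := fun u =>
    ⟨{x | f x + (u x + c u) = 1}, _, (isAffine_linear u).add (isAffine_const (c u)), rfl, by
      rw [two_mul_ncard_lt_iff, hc]; exact hs⟩
  have hE : Function.Bijective E := by
    constructor
    · intro u v huv
      have h1 := eq_of_setOf_eq (congrArg Subtype.val huv)
      have h2 : ∀ x, u x + c u = v x + c v := fun x => add_left_cancel (congrFun h1 x)
      have h3 := h2 0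
      simp only [map_zero, zero_add] at h3
      exact LinearMap.ext fun x => by simpa [h3] using h2 x
    · rintro ⟨_, l, hl, rfl, hlt⟩
      obtain ⟨u, hu⟩ := hl.exists_linear
      refine ⟨u, Subtype.ext ?_⟩
      have h1 : l 0 = c u := by
        by_contra hne
        have h2 : ∀ x, l x = u x + c u + 1 := by
          have : l 0 = c u + 1 := by
            revert hne; generalize l 0 = a; generalize c u = b; revert a b; decide
          intro x
          rw [hu, this, add_assoc]
        rw [two_mul_ncard_lt_iff] at hlt
        have h3 : ∑ x, sgn (f x + l x) = -s := by
          rw [← hc u, ← Finset.sum_neg_distrib]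
          refine Finset.sum_congr rfl fun x _ => ?_
          rw [h2, ← add_assoc, sgn_add]
          simp
        omega
      change {x | f x + (u x + c u) = 1} = {x | f x + l x = 1}
      ext x
      rw [Set.mem_ofPred_eq, Set.mem_ofPred_eq, hu x, h1]
  exact ⟨c, Equiv.ofBijective E hE, hc, fun u => rfl⟩

lemma card_block_bentDesign {f : V → ZMod 2} (hf : IsBent f) {s : ℤ} (hs : 0 < s)
    (hs2 : s ^ 2 = Fintype.card V) : Nat.card (bentDesign f).Block = Fintype.card V := by
  obtain ⟨c, E, -, -⟩ := exists_blockEquiv hf hs hs2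
  rw [← Nat.card_congr E, Nat.card_eq_fintype_card, card_dual]

/-- The design of a bent function of eight bits is an SDP design. -/
lemma IsBent.isSDPDesign {f : V → ZMod 2} (hf : IsBent f) (hV : Fintype.card V = 256) :
    (bentDesign f).IsSDPDesign 256 := by
  have hs2 : (16 : ℤ) ^ 2 = Fintype.card V := by rw [hV]; norm_num
  obtain ⟨c, E, hc, hE⟩ := exists_blockEquiv hf (by norm_num) hs2
  have hD : Fintype.card (V →ₗ[ZMod 2] ZMod 2) = 256 := card_dual.trans hV
  have hblocksOf : ∀ p : V, (bentDesign f).blocksOf p = E '' {u | f p + (u p + c u) = 1} := by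
    intro p
    ext b
    obtain ⟨u, rfl⟩ := E.surjective b
    rw [E.injective.mem_set_image]
    change p ∈ (E u).1 ↔ _
    rw [hE]
    rfl
  have hpointsOf : ∀ u, (bentDesign f).pointsOf (E u) = {x | f x + (u x + c u) = 1} := hE
  -- the dual function `c` behaves like a bent function: this is Fourier inversion for `f`
  have hsum : ∀ p, ∑ u : V →ₗ[ZMod 2] ZMod 2, sgn (f p + (u p + c u)) = 16 := by
    intro p
    have h1 : ∀ u : V →ₗ[ZMod 2] ZMod 2, ∑ x, sgn (f x + u x) = 16 * sgn (c u) := by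
      intro u
      rw [← hc u, Finset.sum_mul]
      refine Finset.sum_congr rfl fun x _ => ?_
      rw [← add_assoc, sgn_add _ (c u), mul_assoc, sgn_mul_self, mul_one]
    have h2 := sum_walsh_mul_sgn f p
    rw [hV] at h2
    have h3 : (16 : ℤ) * ∑ u : V →ₗ[ZMod 2] ZMod 2, sgn (f p + (u p + c u)) = 16 * 16 := by
      calc (16 : ℤ) * ∑ u : V →ₗ[ZMod 2] ZMod 2, sgn (f p + (u p + c u))
          = sgn (f p) * ∑ u : V →ₗ[ZMod 2] ZMod 2, (∑ x, sgn (f x + u x)) * sgn (u p) := by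
            rw [Finset.mul_sum, Finset.mul_sum]
            refine Finset.sum_congr rfl fun u _ => ?_
            rw [h1, sgn_add, sgn_add]; ring
        _ = _ := by rw [h2]; linear_combination 256 * sgn_mul_self (f p)
    omega
  -- blocks have `(256 - 16) / 2 = 120` points, and two of them share `(256 - 2 * 16) / 4 = 56`
  refine ⟨120, 56, by norm_num, by norm_num, ⟨?_, ?_, ?_, ?_, ?_, ?_, ?_, ?_⟩, ?_⟩
  · exact inferInstanceAs (Finite V)
  · exact Finite.of_equiv _ E
  · exact (Nat.card_eq_fintype_card (α := V)).trans hV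
  · rw [← Nat.card_congr E, Nat.card_eq_fintype_card, hD]
  · intro (p : V)
    rw [hblocksOf p, Set.ncard_image_of_injective _ E.injective]
    have := two_mul_ncard fun u : V →ₗ[ZMod 2] ZMod 2 => f p + (u p + c u)
    rw [hsum, hD] at this
    omega
  · intro b
    obtain ⟨u, rfl⟩ := E.surjective b
    rw [hpointsOf]
    change ({x : V | f x + (u x + c u) = 1} : Set V).ncard = 120
    have := two_mul_ncard fun x => f x + (u x + c u)
    rw [hc, hV] at this
    omega
  · intro (p : V) (q : V) hpq
    rw [hblocksOf p, hblocksOf q, ← Set.image_inter E.injective,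
      Set.ncard_image_of_injective _ E.injective]
    have h1 := four_mul_ncard_inter (fun u : V →ₗ[ZMod 2] ZMod 2 => f p + (u p + c u))
      (fun u => f q + (u q + c u))
    have h2 : ∑ u : V →ₗ[ZMod 2] ZMod 2, sgn (f p + (u p + c u) + (f q + (u q + c u))) = 0 := by
      have h3 : p + q ≠ 0 := fun h => hpq (vec_eq_of_add_eq_zero (V := V) h)
      rw [← mul_zero (sgn (f p + f q)), ← sum_dual_sgn_of_ne h3, Finset.mul_sum]
      refine Finset.sum_congr rfl fun u _ => ?_
      rw [← sgn_add, map_add]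
      congr 1
      linear_combination bit_add_self (c u)
    rw [hsum, hsum, h2, hD] at h1
    omega
  · intro b b' hb
    obtain ⟨u, rfl⟩ := E.surjective b
    obtain ⟨v, rfl⟩ := E.surjective b'
    rw [hpointsOf, hpointsOf]
    change ({x : V | f x + (u x + c u) = 1} ∩ {x : V | f x + (v x + c v) = 1} : Set V).ncard = 56
    have h1 := four_mul_ncard_inter (fun x => f x + (u x + c u)) (fun x => f x + (v x + c v))
    have h2 : ∑ x, sgn (f x + (u x + c u) + (f x + (v x + c v))) = 0 := by
      have h3 : u + v ≠ 0 := fun h => hb (congrArg E (vec_eq_of_add_eq_zero h))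
      rw [← mul_zero (sgn (c u + c v)), ← sum_linear_sgn_of_ne h3, Finset.mul_sum]
      refine Finset.sum_congr rfl fun x _ => ?_
      rw [← sgn_add, LinearMap.add_apply]
      congr 1
      linear_combination bit_add_self (f x)
    rw [hc, hc, h2, hV] at h1
    omega
  · rintro ⟨_, l1, hl1, rfl, -⟩ ⟨_, l2, hl2, rfl, -⟩ ⟨_, l3, hl3, rfl, -⟩
    have hl := (hl1.add hl2).add hl3
    have h1 : symmDiff (symmDiff {x | f x + l1 x = 1} {x | f x + l2 x = 1}) {x | f x + l3 x = 1}
        = {x | f x + (l1 x + l2 x + l3 x) = 1} := by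
      rw [symmDiff_setOf, symmDiff_setOf]
      ext x
      simp only [Set.mem_ofPred_eq]
      rw [show f x + l1 x + (f x + l2 x) + (f x + l3 x) = f x + (l1 x + l2 x + l3 x) by
        linear_combination bit_add_self (f x)]
    obtain ⟨a, ha⟩ := exists_sign hf hs2 hl
    let d : (bentDesign f).Block :=
      ⟨{x | f x + (l1 x + l2 x + l3 x + a) = 1}, _, hl.add (isAffine_const a), rfl, by
        rw [two_mul_ncard_lt_iff, ha]; norm_num⟩
    refine ⟨d, ?_⟩
    change symmDiff (symmDiff {x | f x + l1 x = 1} {x | f x + l2 x = 1}) {x | f x + l3 x = 1}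
        = {x : V | f x + (l1 x + l2 x + l3 x + a) = 1} ∨
      symmDiff (symmDiff {x | f x + l1 x = 1} {x | f x + l2 x = 1}) {x | f x + l3 x = 1}
        = {x : V | f x + (l1 x + l2 x + l3 x + a) = 1}ᶜ
    rw [h1]
    rcases zmod_two_cases a with h | h
    · left; simp [h]
    · right
      rw [h, compl_setOf]
      ext x
      simp only [Set.mem_ofPred_eq]
      rw [show f x + (l1 x + l2 x + l3 x + 1) + 1 = f x + (l1 x + l2 x + l3 x) by
        linear_combination bit_add_self 1]

end Design

end BentDesign

namespace BentDesign

/-! ### Developments of bent functions on groups -/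

section Translates

/-- Distinct left translates of the sign function of `F` are orthogonal. -/
def HasOrthogonalTranslates {G : Type*} [Group G] [Fintype G] (F : G → ZMod 2) : Prop :=
  ∀ g : G, g ≠ 1 → ∑ x, sgn (F (g⁻¹ * x) + F x) = 0

/-- Under the bijection `e` of the group `G` with a vector space, left translations change `f` by
affine functions only. -/
def HasAffineTranslates {G V : Type*} [Group G] [AddCommGroup V] (e : G ≃ V) (f : V → ZMod 2) :
    Prop :=
  ∀ g : G, ∃ l, IsAffine l ∧ ∀ x, f (e (g * x)) = f (e x) + l (e x)

lemma eq_zero_of_sum_eq {T : Type*} [Fintype T] {a : T → ℤ} (h : ∀ i, 0 ≤ a i) {i : T}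
    (hs : ∑ j, a j = a i) {j : T} (hj : j ≠ i) : a j = 0 := by
  classical
  rw [← Finset.add_sum_erase _ _ (Finset.mem_univ i)] at hs
  have h1 : ∑ j ∈ Finset.univ.erase i, a j = 0 := by omega
  exact (Finset.sum_eq_zero_iff_of_nonneg fun k _ => h k).1 h1 j (by simp [hj])

variable {G : Type u} [Group G] [Fintype G]

lemma sum_sgn_translate (F : G → ZMod 2) (g : G) :
    ∑ x, sgn (F (g⁻¹ * x)) = ∑ x, sgn (F x) :=
  Equiv.sum_comp (Equiv.mulLeft g⁻¹) fun x => sgn (F x)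

lemma sum_translates_eq_sq (F : G → ZMod 2) :
    ∑ g : G, ∑ x, sgn (F (g⁻¹ * x) + F x) = (∑ x, sgn (F x)) ^ 2 := by
  rw [Finset.sum_comm, pow_two, Finset.sum_mul]
  refine (Finset.sum_congr rfl fun x _ => ?_)
  simp only [sgn_add, ← Finset.sum_mul]
  rw [mul_comm]
  congr 1
  exact Equiv.sum_comp ((Equiv.inv G).trans (Equiv.mulRight x)) fun x => sgn (F x)

lemma HasOrthogonalTranslates.sq_sum {F : G → ZMod 2} (h : HasOrthogonalTranslates F) :
    (∑ x, sgn (F x)) ^ 2 = Fintype.card G := by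
  rw [← sum_translates_eq_sq, Finset.sum_eq_single 1 (fun g _ hg => h g hg) (by simp)]
  simp [bit_add_self]

/-- The left translates of a bent function that differ from it by affine functions are orthogonal:
all inner products are nonnegative, and their sum is the square of the total sum, that is, the
inner product of the function with itself. -/
lemma HasAffineTranslates.orthogonal {V : Type*} [AddCommGroup V] [Fintype V] {e : G ≃ V}
    {f : V → ZMod 2} (h : HasAffineTranslates e f) (hf : IsBent f) :
    HasOrthogonalTranslates fun x => f (e x) := by
  have hcard : (Fintype.card V : ℤ) = Fintype.card G := by rw [Fintype.card_congr e]
  have hsq : (∑ x, sgn (f (e x))) ^ 2 = (Fintype.card G : ℤ) := by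
    rw [← hcard, ← hf _ (isAffine_const 0), Equiv.sum_comp e fun x => sgn (f x)]
    simp
  have hpos : (0 : ℤ) < Fintype.card G := by exact_mod_cast Fintype.card_pos
  have hne : ∑ x, sgn (f (e x)) ≠ 0 := fun h0 => by rw [h0] at hsq; omega
  intro g hg
  refine eq_zero_of_sum_eq (a := fun g : G => ∑ x, sgn (f (e (g⁻¹ * x)) + f (e x)))
    (i := 1) (fun g => ?_) ?_ hg
  · obtain ⟨l, hl, h1⟩ := h g⁻¹
    have h2 : ∀ x, f (e (g⁻¹ * x)) + f (e x) = l (e x) := fun x => by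
      rw [h1]; linear_combination bit_add_self (f (e x))
    simp only [h2]
    rw [Equiv.sum_comp e fun x => sgn (l x)]
    by_cases hc : ∃ x, l x ≠ l 0
    · exact (hl.sum_sgn_eq_zero hc).ge
    · push Not at hc
      have h3 := sum_sgn_translate (fun x => f (e x)) g
      simp only [h1, hc, sgn_add, ← Finset.sum_mul] at h3
      have h4 : sgn (l 0) = 1 := by
        apply mul_left_cancel₀ hne
        rw [h3, mul_one]
      simp [hc, h4]
  · rw [sum_translates_eq_sq fun x => f (e x), hsq]
    simp [bit_add_self]

lemma pointsOf_development {G : Type u} [Group G] (F : G → ZMod 2) (g : G) :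
    (development {x | F x = 1}).pointsOf g = {x | F (g⁻¹ * x) = 1} := by
  ext x
  change x ∈ (fun d => g * d) '' {x | F x = 1} ↔ _
  rw [Set.image_mul_left]
  rfl

/-- The development of a bent function on a group whose translations change it by affine functions
is the design of the bent function. -/
lemma HasAffineTranslates.development_isomorphic {V : Type*} [AddCommGroup V]
    [Module (ZMod 2) V] [Fintype V] {e : G ≃ V} {f : V → ZMod 2} (h : HasAffineTranslates e f)
    (hf : IsBent f) (hpos : 0 < ∑ x, sgn (f x)) :
    (development {x | f (e x) = 1}).Isomorphic (bentDesign f) := by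
  have hort := h.orthogonal hf
  have hsq : (∑ x, sgn (f x)) ^ 2 = (Fintype.card V : ℤ) := by
    rw [← hf _ (isAffine_const 0)]; simp
  have hinj : Function.Injective (development {x | f (e x) = 1}).pointsOf := by
    intro (a : G) (b : G) hab
    by_contra hne
    rw [pointsOf_development (fun x => f (e x)) a, pointsOf_development (fun x => f (e x)) b] at hab
    have h1 := eq_of_setOf_eq hab
    have h2 := hort (a⁻¹ * b) fun h3 => hne (inv_mul_eq_one (G := G).1 h3)
    have h3 : ∀ x, f (e ((a⁻¹ * b)⁻¹ * x)) = f (e x) := fun x => by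
      have := congrFun h1 (a * x)
      simp only [inv_mul_cancel_left] at this
      rw [this]
      congr 2
      group
    simp only [h3, bit_add_self] at h2
    simp at h2
  have hblock : ∀ g : G, ∃ c : (bentDesign f).Block,
      e '' (development {x | f (e x) = 1}).pointsOf g = (bentDesign f).pointsOf c := by
    intro g
    obtain ⟨l, hl, h1⟩ := h g⁻¹
    have h2 : e '' (development {x | f (e x) = 1}).pointsOf g = {y | f y + l y = 1} := by
      rw [pointsOf_development (fun x => f (e x)) g]
      simp only [h1]
      ext y
      obtain ⟨x, rfl⟩ := e.surjective y
      rw [e.injective.mem_set_image]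
      rfl
    refine ⟨⟨_, l, hl, rfl, ?_⟩, h2⟩
    rw [two_mul_ncard_lt_iff]
    convert hpos using 1
    rw [← Equiv.sum_comp e, ← Equiv.sum_comp e fun x => sgn (f x),
      ← sum_sgn_translate (fun x => f (e x)) g]
    simp only [h1]
  choose ψ hψ using hblock
  have hψi : Function.Injective ψ := fun a b hab =>
    hinj (e.injective.image_injective ((hψ a).trans ((congrArg _ hab).trans (hψ b).symm)))
  have hψs : Function.Surjective ψ := by
    have : Finite (bentDesign f).Block := by
      obtain ⟨c, E, -, -⟩ := exists_blockEquiv hf hpos hsq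
      exact Finite.of_equiv _ E
    refine ((Nat.bijective_iff_injective_and_card ψ).2 ⟨hψi, ?_⟩).surjective
    rw [card_block_bentDesign hf hpos hsq, Nat.card_eq_fintype_card, Fintype.card_congr e]
  refine isomorphic_of_pointsOf (X := development {x | f (e x) = 1}) (Y := bentDesign f) e hinj
    (pointsOf_bentDesign_injective f) (fun g => ⟨ψ g, hψ g⟩) fun c => ?_
  obtain ⟨g, rfl⟩ := hψs c
  exact ⟨g, hψ g⟩

lemma HasOrthogonalTranslates.exists_isDifferenceSet {F : G → ZMod 2}
    (h : HasOrthogonalTranslates F) : ∃ n k l, IsDifferenceSet {x | F x = 1} n k l := by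
  refine ⟨_, _, ((Fintype.card G - 2 * ∑ x, sgn (F x)) / 4).toNat, inferInstance, rfl, rfl,
    fun g hg => ?_⟩
  have h1 : {d : G × G | d.1 ∈ {x | F x = 1} ∧ d.2 ∈ {x | F x = 1} ∧ d.1 * d.2⁻¹ = g}
      = (fun x => (x, g⁻¹ * x)) '' ({x | F (g⁻¹ * x) = 1} ∩ {x | F x = 1}) := by
    ext ⟨a, b⟩
    simp only [Set.mem_ofPred_eq, Set.mem_image, Set.mem_inter_iff, Prod.mk.injEq]
    constructor
    · rintro ⟨ha, hb, rfl⟩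
      have h2 : (a * b⁻¹)⁻¹ * a = b := by group
      exact ⟨a, ⟨by rwa [h2], ha⟩, rfl, h2⟩
    · rintro ⟨x, ⟨h2, h3⟩, rfl, rfl⟩
      exact ⟨h3, h2, by group⟩
  rw [h1, Set.ncard_image_of_injective _ fun a b hab => (Prod.ext_iff.1 hab).1]
  have h2 := four_mul_ncard_inter (fun x => F (g⁻¹ * x)) F
  rw [h g hg, sum_sgn_translate] at h2
  omega

lemma productConstruction_setOf {G₁ G₂ : Type u} (F₁ : G₁ → ZMod 2) (F₂ : G₂ → ZMod 2) :
    productConstruction {x | F₁ x = 1} {x | F₂ x = 1} = {x | F₁ x.1 + F₂ x.2 = 1} := by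
  have h1 : ∀ a b : ZMod 2, (a = 1 ∧ ¬ b = 1 ∨ ¬ a = 1 ∧ b = 1) ↔ a + b = 1 := by decide
  ext x
  exact h1 _ _

lemma HasAffineTranslates.prod {G₁ G₂ V₁ V₂ : Type*} [Group G₁] [Group G₂] [AddCommGroup V₁]
    [AddCommGroup V₂] {e₁ : G₁ ≃ V₁} {e₂ : G₂ ≃ V₂} {f₁ : V₁ → ZMod 2} {f₂ : V₂ → ZMod 2}
    (h₁ : HasAffineTranslates e₁ f₁) (h₂ : HasAffineTranslates e₂ f₂) :
    HasAffineTranslates (e₁.prodCongr e₂) (boxSum f₁ f₂) := by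
  intro g
  obtain ⟨l₁, hl₁, k₁⟩ := h₁ g.1
  obtain ⟨l₂, hl₂, k₂⟩ := h₂ g.2
  refine ⟨fun p => l₁ p.1 + l₂ p.2, (hl₁.comp isAffine_fst).add (hl₂.comp isAffine_snd),
    fun x => ?_⟩
  have e1 := k₁ x.1
  have e2 := k₂ x.2
  change f₁ (e₁ (g.1 * x.1)) + f₂ (e₂ (g.2 * x.2)) = f₁ (e₁ x.1) + f₂ (e₂ x.2) +
    (l₁ (e₁ x.1) + l₂ (e₂ x.2))
  linear_combination e1 + e2

lemma sum_sgn_boxSum {T₁ T₂ : Type*} [Fintype T₁] [Fintype T₂] (f₁ : T₁ → ZMod 2)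
    (f₂ : T₂ → ZMod 2) : ∑ x : T₁ × T₂, sgn (f₁ x.1 + f₂ x.2) = (∑ x, sgn (f₁ x)) *
      ∑ x, sgn (f₂ x) := by
  rw [Fintype.sum_prod_type, Finset.sum_mul_sum]
  simp only [sgn_add]

lemma isFromProductConstruction_boxSum {G₁ G₂ V₁ V₂ : Type u} [Group G₁] [Group G₂]
    [Fintype G₁] [Fintype G₂] [Nontrivial G₁] [Nontrivial G₂]
    [AddCommGroup V₁] [Module (ZMod 2) V₁] [Fintype V₁]
    [AddCommGroup V₂] [Module (ZMod 2) V₂] [Fintype V₂]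
    {e₁ : G₁ ≃ V₁} {e₂ : G₂ ≃ V₂} {f₁ : V₁ → ZMod 2} {f₂ : V₂ → ZMod 2}
    (h₁ : HasAffineTranslates e₁ f₁) (h₂ : HasAffineTranslates e₂ f₂) (hf₁ : IsBent f₁)
    (hf₂ : IsBent f₂) (hpos : 0 < (∑ x, sgn (f₁ x)) * ∑ x, sgn (f₂ x)) :
    IsFromProductConstruction (bentDesign (boxSum f₁ f₂)) := by
  obtain ⟨n₁, k₁, l₁, d₁⟩ := (h₁.orthogonal hf₁).exists_isDifferenceSet
  obtain ⟨n₂, k₂, l₂, d₂⟩ := (h₂.orthogonal hf₂).exists_isDifferenceSet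
  refine ⟨G₁, G₂, _, _, _, _, n₁, k₁, l₁, n₂, k₂, l₂, inferInstance, inferInstance, d₁, d₂, ?_⟩
  rw [productConstruction_setOf (fun x => f₁ (e₁ x)) (fun x => f₂ (e₂ x))]
  refine isomorphic_symm ((h₁.prod h₂).development_isomorphic (hf₁.boxSum hf₂) ?_)
  rw [← sum_sgn_boxSum] at hpos
  exact hpos

end Translates

end BentDesign

namespace BentDesign

/-! ### Coordinates on a group from the symmetric difference property -/

section Coordinates

variable {G : Type u} [Group G] [Fintype G]

/-- If the translates of `F` are orthogonal and the sum of any three of them is a translate up to a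
constant, then `G` is in bijection with a binary vector space on which `F` is bent and has affine
translates. The functions `F (g⁻¹ x) + F x`, normalised to vanish at `1`, form a space of
functions as large as `G`, and `G` is identified with the dual of this space by evaluation. -/
lemma HasOrthogonalTranslates.exists_coordinates {F : G → ZMod 2}
    (h0 : HasOrthogonalTranslates F)
    (h1 : ∀ a b : G, ∃ (d : G) (c : ZMod 2), ∀ x, F (a⁻¹ * x) + F (b⁻¹ * x) + F x
      = F (d⁻¹ * x) + c) :
    ∃ (V : Type u) (_ : AddCommGroup V) (_ : Module (ZMod 2) V) (_ : Fintype V) (e : G ≃ V)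
      (f : V → ZMod 2), (∀ x, f (e x) = F x) ∧ IsBent f ∧ HasAffineTranslates e f := by
  classical
  have hpos : (0 : ℤ) < Fintype.card G := by exact_mod_cast Fintype.card_pos
  let lam : G → G → ZMod 2 := fun g x => F (g⁻¹ * x) + F x + (F g⁻¹ + F 1)
  have hlam1 : ∀ g, lam g 1 = 0 := fun g => by
    simp only [lam, mul_one]; exact bit_add_self _
  have hlam0 : lam 1 = 0 := by
    funext x
    simp [lam, bit_add_self]
  have hadd : ∀ a b, ∃ d, lam a + lam b = lam d := by
    intro a b
    obtain ⟨d, c, hd⟩ := h1 a b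
    have h2 : ∀ x, lam a x + lam b x = lam d x + (c + F a⁻¹ + F 1 + F b⁻¹ + F d⁻¹) := fun x => by
      simp only [lam]
      linear_combination hd x + bit_add_self (F 1) - bit_add_self (F d⁻¹) - bit_add_self (F 1)
    have h3 := h2 1
    rw [hlam1, hlam1, hlam1] at h3
    refine ⟨d, funext fun x => ?_⟩
    rw [Pi.add_apply, h2, ← zero_add (c + F a⁻¹ + F 1 + F b⁻¹ + F d⁻¹), ← h3]
    simp
  let L : Submodule (ZMod 2) (G → ZMod 2) :=
    { carrier := Set.range lam
      zero_mem' := ⟨1, hlam0⟩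
      add_mem' := by
        rintro _ _ ⟨a, rfl⟩ ⟨b, rfl⟩
        obtain ⟨d, hd⟩ := hadd a b
        exact ⟨d, hd.symm⟩
      smul_mem' := by
        rintro c _ ⟨a, rfl⟩
        rcases zmod_two_cases c with rfl | rfl
        · exact ⟨1, by simp [hlam0]⟩
        · exact ⟨a, by simp⟩ }
  let _ : Fintype L := Fintype.ofFinite L
  have hinj : Function.Injective lam := by
    intro a b hab
    by_contra hne
    have h2 := h0 (a⁻¹ * b) fun h3 => hne (inv_mul_eq_one.1 h3)
    have h3 : ∀ x, F ((a⁻¹ * b)⁻¹ * x) + F x = F b⁻¹ + F a⁻¹ := fun x => by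
      have h4 := congrFun hab (a * x)
      simp only [lam, inv_mul_cancel_left] at h4
      have h5 : (a⁻¹ * b)⁻¹ * x = b⁻¹ * (a * x) := by group
      rw [h5]
      linear_combination h4 + bit_add_self (F x) - bit_add_self (F a⁻¹)
        + bit_add_self (F (b⁻¹ * (a * x))) - bit_add_self (F x)
    simp only [h3, Finset.sum_const, Finset.card_univ, nsmul_eq_mul] at h2
    rcases mul_eq_zero.1 h2 with h | h
    · omega
    · rcases sgn_eq (F b⁻¹ + F a⁻¹) with k | k <;> omega
  let E : G ≃ L := Equiv.ofBijective (fun g => ⟨lam g, g, rfl⟩)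
    ⟨fun a b hab => hinj (congrArg Subtype.val hab), by rintro ⟨_, g, rfl⟩; exact ⟨g, rfl⟩⟩
  have hcardL : Fintype.card L = Fintype.card G := (Fintype.card_congr E).symm
  let ev : G → (L →ₗ[ZMod 2] ZMod 2) := fun x =>
    { toFun := fun l => l.1 x
      map_add' := fun _ _ => rfl
      map_smul' := fun _ _ => rfl }
  -- for fixed `x`, the sums over `L` of the signs of `l x + l y` are nonnegative, and add up to the
  -- one with `y = x`
  have hev : Function.Injective ev := by
    intro x y hxy
    by_contra hne
    have h2 := eq_zero_of_sum_eq (a := fun y => ∑ l : L, sgn ((ev x + ev y) l)) (i := x)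
      (j := y) (fun y => ?_) ?_ (Ne.symm hne)
    · simp only [hxy, LinearMap.add_apply, bit_add_self, sgn_zero] at h2
      simp at h2
    · by_cases h3 : ev x + ev y = 0
      · rw [h3]; simp
      · exact (sum_linear_sgn_of_ne h3).ge
    · simp only [LinearMap.add_apply, bit_add_self, sgn_zero]
      simp only [sgn_add]
      rw [Finset.sum_comm, ← Equiv.sum_comp E, Finset.sum_eq_single 1]
      · have h3 : ∀ y, ev y (E 1) = 0 := fun y => congrFun hlam0 y
        simp [h3, hcardL]
      · intro g _ hg
        rw [← Finset.mul_sum]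
        have h3 : ∀ y, ev y (E g) = F (g⁻¹ * y) + F y + (F g⁻¹ + F 1) := fun y => rfl
        simp only [h3]
        simp only [sgn_add _ (F g⁻¹ + F 1), ← Finset.sum_mul]
        rw [h0 g hg]
        simp
      · simp
  have hevb : Function.Bijective ev :=
    (Fintype.bijective_iff_injective_and_card ev).2 ⟨hev, by rw [card_dual, hcardL]⟩
  let e : G ≃ (L →ₗ[ZMod 2] ZMod 2) := Equiv.ofBijective ev hevb
  refine ⟨L →ₗ[ZMod 2] ZMod 2, inferInstance, inferInstance, inferInstance, e,
    fun v => F (e.symm v), fun x => by simp, ?_, ?_⟩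
  -- a functional on the dual is the evaluation at some `lam g`, so that the correlation of `f` with
  -- it is, up to sign, the sum over a translate of `F`
  · intro l hl
    obtain ⟨u, hu⟩ := hl.exists_linear
    obtain ⟨m, hm⟩ := (Module.evalEquiv (ZMod 2) L).surjective u
    obtain ⟨g, rfl⟩ := E.surjective m
    have h2 : ∀ x, u (e x) = lam g x := fun x => by rw [← hm]; rfl
    rw [← Equiv.sum_comp e, ← Fintype.card_congr e, ← h0.sq_sum, ← sum_sgn_translate F g]
    have h3 : ∀ x, sgn (F (e.symm (e x)) + l (e x))
        = sgn (F (g⁻¹ * x)) * sgn (F g⁻¹ + F 1 + l 0) := fun x => by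
      rw [← sgn_add, e.symm_apply_apply, hu, h2]
      congr 1
      simp only [lam]
      linear_combination bit_add_self (F x)
    simp only [h3, ← Finset.sum_mul]
    rw [mul_pow, pow_two (sgn _), sgn_mul_self, mul_one]
  · intro g
    refine ⟨fun v => v (E g⁻¹) + (F g + F 1), ?_, fun x => ?_⟩
    · exact (isAffine_linear (Module.evalEquiv (ZMod 2) L (E g⁻¹))).add (isAffine_const _)
    · have h2 : (e x) (E g⁻¹) = F (g * x) + F x + (F g + F 1) := by
        change lam g⁻¹ x = _
        simp only [lam, inv_inv]
      simp only [e.symm_apply_apply, h2]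
      linear_combination -bit_add_self (F x) - bit_add_self (F g) - bit_add_self (F 1)

end Coordinates

end BentDesign

namespace BentDesign

/-! ### SDP designs from the product construction -/

section Product

open IncidenceStructure

lemma isomorphic_blocksOf {X : IncidenceStructure.{u}} {Y : IncidenceStructure.{v}}
    {φ : X.Point ≃ Y.Point} {ψ : X.Block ≃ Y.Block}
    (h : ∀ p b, X.incident p b ↔ Y.incident (φ p) (ψ b)) (p : X.Point) :
    Y.blocksOf (φ p) = ψ '' X.blocksOf p := by
  ext b
  obtain ⟨b, rfl⟩ := ψ.surjective b
  rw [ψ.injective.mem_set_image]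
  exact (h p b).symm

lemma isSDPDesign_congr {X : IncidenceStructure.{u}} {Y : IncidenceStructure.{v}}
    (h : X.Isomorphic Y) {n : ℕ} (hX : X.IsSDPDesign n) : Y.IsSDPDesign n := by
  obtain ⟨φ, ψ, h⟩ := h
  have hp := isomorphic_pointsOf h
  have hb := isomorphic_blocksOf h
  obtain ⟨k, l, hk, hkn, ⟨a1, a2, a3, a4, a5, a6, a7, a8⟩, hs⟩ := hX
  refine ⟨k, l, hk, hkn, ⟨Finite.of_equiv _ φ, Finite.of_equiv _ ψ, ?_, ?_, ?_, ?_, ?_, ?_⟩, ?_⟩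
  · rw [← a3, Nat.card_congr φ]
  · rw [← a4, Nat.card_congr ψ]
  · intro p
    obtain ⟨p, rfl⟩ := φ.surjective p
    rw [hb, Set.ncard_image_of_injective _ ψ.injective, a5]
  · intro b
    obtain ⟨b, rfl⟩ := ψ.surjective b
    rw [hp, Set.ncard_image_of_injective _ φ.injective, a6]
  · intro p q hpq
    obtain ⟨p, rfl⟩ := φ.surjective p
    obtain ⟨q, rfl⟩ := φ.surjective q
    rw [hb, hb, ← Set.image_inter ψ.injective, Set.ncard_image_of_injective _ ψ.injective,
      a7 _ _ fun e => hpq (congrArg _ e)]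
  · intro b c hbc
    obtain ⟨b, rfl⟩ := ψ.surjective b
    obtain ⟨c, rfl⟩ := ψ.surjective c
    rw [hp, hp, ← Set.image_inter φ.injective, Set.ncard_image_of_injective _ φ.injective,
      a8 _ _ fun e => hbc (congrArg _ e)]
  · intro a b c
    obtain ⟨a, rfl⟩ := ψ.surjective a
    obtain ⟨b, rfl⟩ := ψ.surjective b
    obtain ⟨c, rfl⟩ := ψ.surjective c
    obtain ⟨d, hd⟩ := hs a b c
    refine ⟨ψ d, ?_⟩
    rw [hp, hp, hp, hp, ← Set.image_symmDiff φ.injective, ← Set.image_symmDiff φ.injective,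
      ← Set.image_compl_eq φ.bijective]
    exact hd.imp (congrArg _) (congrArg _)

lemma exists_indicator {T : Type*} (D : Set T) : ∃ F : T → ZMod 2, D = {x | F x = 1} := by
  classical
  exact ⟨fun x => if x ∈ D then 1 else 0, by ext x; by_cases h : x ∈ D <;> simp [h]⟩

/-- The translates of each of the two functions defining a product construction with the symmetric
difference property are orthogonal: if `μ` is the inner product of any two translates of the sum,
then `μ ^ 2 = n₁ n₂ μ`, and `μ = n₁ n₂` would make all the blocks equal. -/
lemma orthogonal_of_isSDPDesign {G₁ G₂ : Type u} [Group G₁] [Group G₂] [Fintype G₁] [Fintype G₂]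
    [Nontrivial G₁] [Nontrivial G₂] {F₁ : G₁ → ZMod 2} {F₂ : G₂ → ZMod 2} {n : ℕ}
    (h : (development {x : G₁ × G₂ | F₁ x.1 + F₂ x.2 = 1}).IsSDPDesign n) :
    HasOrthogonalTranslates F₁ ∧ HasOrthogonalTranslates F₂ ∧
      0 ≤ (∑ x, sgn (F₁ x)) * ∑ x, sgn (F₂ x) ∧ Fintype.card G₁ * Fintype.card G₂ = n := by
  obtain ⟨k, l, hk, hkn, hD, -⟩ := h
  have hpts := pointsOf_development (G := G₁ × G₂) fun x => F₁ x.1 + F₂ x.2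
  set F : G₁ × G₂ → ZMod 2 := fun x => F₁ x.1 + F₂ x.2 with hF
  have hcard : Fintype.card (G₁ × G₂) = n := by
    rw [← hD.card_point, ← Nat.card_eq_fintype_card]; rfl
  have hcard' : Fintype.card G₁ * Fintype.card G₂ = n := by rw [← hcard, Fintype.card_prod]
  have hk' : ∀ g : G₁ × G₂, {x | F (g⁻¹ * x) = 1}.ncard = k := fun g => by
    rw [← hpts, ← hD.ncard_pointsOf g]; rfl
  have hS : ∑ x, sgn (F x) = n - 2 * k := by
    have h1 := two_mul_ncard F
    have h2 := hk' 1
    simp only [inv_one, one_mul] at h2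
    rw [hcard, h2] at h1
    omega
  have hmu : ∀ g : G₁ × G₂, g ≠ 1 →
      ∑ x, sgn (F (g⁻¹ * x) + F x) = n - 4 * k + 4 * l := by
    intro g hg
    have h1 := four_mul_ncard_inter (fun x => F (g⁻¹ * x)) F
    have h2 : ({x | F (g⁻¹ * x) = 1} ∩ {x | F x = 1}).ncard = l := by
      have h3 := hD.ncard_pointsOf_inter g (1 : G₁ × G₂) hg
      rw [hpts, hpts] at h3
      simp only [inv_one, one_mul] at h3
      exact h3
    rw [h2, sum_sgn_translate, hS, hcard] at h1
    omega
  set μ : ℤ := n - 4 * k + 4 * l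
  let A : G₁ → ℤ := fun g => ∑ x, sgn (F₁ (g⁻¹ * x) + F₁ x)
  let B : G₂ → ℤ := fun g => ∑ x, sgn (F₂ (g⁻¹ * x) + F₂ x)
  have hA1 : A 1 = Fintype.card G₁ := by simp [A, bit_add_self]
  have hB1 : B 1 = Fintype.card G₂ := by simp [B, bit_add_self]
  have hAB : ∀ a b, (a, b) ≠ 1 → A a * B b = μ := by
    intro a b hab
    rw [← hmu _ hab, ← sum_sgn_boxSum]
    refine Finset.sum_congr rfl fun x _ => congrArg sgn ?_
    simp only [hF, Prod.fst_mul, Prod.snd_mul, Prod.fst_inv, Prod.snd_inv]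
    ring
  have hn1 : (0 : ℤ) < Fintype.card G₁ := by exact_mod_cast Fintype.card_pos
  have hn2 : (0 : ℤ) < Fintype.card G₂ := by exact_mod_cast Fintype.card_pos
  have hn : (Fintype.card G₁ : ℤ) * Fintype.card G₂ = n := by exact_mod_cast hcard'
  have hμ : μ = 0 := by
    obtain ⟨a, ha⟩ := exists_ne (1 : G₁)
    obtain ⟨b, hb⟩ := exists_ne (1 : G₂)
    have e1 := hAB a b (by simp [ha])
    have e2 := hAB a 1 (by simp [ha])
    have e3 := hAB 1 b (by simp [hb])
    rw [hB1] at e2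
    rw [hA1] at e3
    have e4 : μ * (μ - n) = 0 := by
      rw [← hn]
      linear_combination (-Fintype.card G₁ * B b) * e2 - μ * e3
        + Fintype.card G₁ * Fintype.card G₂ * e1
    rcases mul_eq_zero.1 e4 with e | e
    · exact e
    · exfalso
      have e5 := sum_translates_eq_sq F
      have e6 : ∀ g : G₁ × G₂, ∑ x, sgn (F (g⁻¹ * x) + F x) = n := fun g => by
        by_cases hg : g = 1
        · subst hg; simp only [inv_one, one_mul, bit_add_self, sgn_zero]; simp [hcard']
        · rw [hmu g hg]; omega
      simp only [e6] at e5
      rw [hS, Finset.sum_const, Finset.card_univ, hcard, nsmul_eq_mul] at e5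
      have e7 : (k : ℤ) * (n - k) = 0 := by
        have : 4 * ((k : ℤ) * (n - k)) = 0 := by linear_combination e5
        omega
      rcases mul_eq_zero.1 e7 with h | h <;> omega
  refine ⟨fun g hg => ?_, fun g hg => ?_, ?_, hcard'⟩
  · have e := hAB g 1 (by simp [hg])
    rw [hB1, hμ] at e
    exact (mul_eq_zero.1 e).resolve_right hn2.ne'
  · have e := hAB 1 g (by simp [hg])
    rw [hA1, hμ] at e
    exact (mul_eq_zero.1 e).resolve_left hn1.ne'
  · rw [← sum_sgn_boxSum, hS]
    omega

lemma exists_translate_of_hasSDP {G : Type u} [Group G] {F : G → ZMod 2}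
    (h : (development {x | F x = 1}).HasSDP) (a b : G) :
    ∃ (d : G) (c : ZMod 2), ∀ x, F (a⁻¹ * x) + F (b⁻¹ * x) + F x = F (d⁻¹ * x) + c := by
  obtain ⟨(d : G), hd⟩ := h a b (1 : G)
  have hd' : symmDiff (symmDiff {x | F (a⁻¹ * x) = 1} {x | F (b⁻¹ * x) = 1})
        {x | F (1⁻¹ * x) = 1} = {x | F (d⁻¹ * x) = 1} ∨
      symmDiff (symmDiff {x | F (a⁻¹ * x) = 1} {x | F (b⁻¹ * x) = 1})
        {x | F (1⁻¹ * x) = 1} = {x | F (d⁻¹ * x) = 1}ᶜ := by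
    rw [← pointsOf_development, ← pointsOf_development, ← pointsOf_development,
      ← pointsOf_development]
    exact hd
  rw [symmDiff_setOf, symmDiff_setOf, compl_setOf] at hd'
  rcases hd' with hd | hd
  · exact ⟨d, 0, fun x => by simpa using congrFun (eq_of_setOf_eq hd) x⟩
  · exact ⟨d, 1, fun x => by simpa using congrFun (eq_of_setOf_eq hd) x⟩

lemma exists_translate_left {G₁ G₂ : Type u} [Group G₁] [Group G₂] {F₁ : G₁ → ZMod 2}
    {F₂ : G₂ → ZMod 2} (h : (development {x : G₁ × G₂ | F₁ x.1 + F₂ x.2 = 1}).HasSDP) (a b : G₁) :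
    ∃ (d : G₁) (c : ZMod 2), ∀ x, F₁ (a⁻¹ * x) + F₁ (b⁻¹ * x) + F₁ x = F₁ (d⁻¹ * x) + c := by
  obtain ⟨d, c, hc⟩ := exists_translate_of_hasSDP (F := fun x : G₁ × G₂ => F₁ x.1 + F₂ x.2) h
    (a, 1) (b, 1)
  refine ⟨d.1, F₂ d.2⁻¹ + c + F₂ 1, fun x => ?_⟩
  have e := hc (x, 1)
  simp only [Prod.fst_mul, Prod.snd_mul, Prod.fst_inv, Prod.snd_inv, inv_one, mul_one] at e
  linear_combination e - bit_add_self (F₂ 1) - bit_add_self (F₂ 1)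

lemma exists_translate_right {G₁ G₂ : Type u} [Group G₁] [Group G₂] {F₁ : G₁ → ZMod 2}
    {F₂ : G₂ → ZMod 2} (h : (development {x : G₁ × G₂ | F₁ x.1 + F₂ x.2 = 1}).HasSDP) (a b : G₂) :
    ∃ (d : G₂) (c : ZMod 2), ∀ x, F₂ (a⁻¹ * x) + F₂ (b⁻¹ * x) + F₂ x = F₂ (d⁻¹ * x) + c := by
  obtain ⟨d, c, hc⟩ := exists_translate_of_hasSDP (F := fun x : G₁ × G₂ => F₁ x.1 + F₂ x.2) h
    (1, a) (1, b)
  refine ⟨d.2, F₁ d.1⁻¹ + c + F₁ 1, fun x => ?_⟩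
  have e := hc (1, x)
  simp only [Prod.fst_mul, Prod.snd_mul, Prod.fst_inv, Prod.snd_inv, inv_one, mul_one] at e
  linear_combination e - bit_add_self (F₁ 1) - bit_add_self (F₁ 1)

/-- An SDP design from the product construction is the design of the orthogonal sum of two bent
functions. -/
lemma exists_boxSum_of_product {X : IncidenceStructure.{u}} {n : ℕ} (hX : X.IsSDPDesign n)
    (hp : IsFromProductConstruction X) :
    ∃ (V₁ V₂ : Type u) (_ : AddCommGroup V₁) (_ : Module (ZMod 2) V₁) (_ : Fintype V₁)
      (_ : AddCommGroup V₂) (_ : Module (ZMod 2) V₂) (_ : Fintype V₂) (f₁ : V₁ → ZMod 2)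
      (f₂ : V₂ → ZMod 2), IsBent f₁ ∧ IsBent f₂ ∧ Nontrivial V₁ ∧ Nontrivial V₂ ∧
      Fintype.card V₁ * Fintype.card V₂ = n ∧ X.Isomorphic (bentDesign (boxSum f₁ f₂)) := by
  obtain ⟨G₁, G₂, _, _, D₁, D₂, n₁, k₁, l₁, n₂, k₂, l₂, _, _, hD₁, hD₂, hiso⟩ := hp
  have := hD₁.finite_group
  have := hD₂.finite_group
  let _ := Fintype.ofFinite G₁
  let _ := Fintype.ofFinite G₂
  obtain ⟨F₁, rfl⟩ := exists_indicator D₁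
  obtain ⟨F₂, rfl⟩ := exists_indicator D₂
  rw [productConstruction_setOf] at hiso
  have hdev := isSDPDesign_congr hiso hX
  obtain ⟨o₁, o₂, hs, hn⟩ := orthogonal_of_isSDPDesign hdev
  obtain ⟨k, l, -, -, -, hsdp⟩ := hdev
  obtain ⟨V₁, _, _, _, e₁, f₁, r₁, b₁, t₁⟩ :=
    o₁.exists_coordinates (exists_translate_left hsdp)
  obtain ⟨V₂, _, _, _, e₂, f₂, r₂, b₂, t₂⟩ :=
    o₂.exists_coordinates (exists_translate_right hsdp)
  refine ⟨V₁, V₂, inferInstance, inferInstance, inferInstance, inferInstance, inferInstance,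
    inferInstance, f₁, f₂, b₁, b₂, e₁.symm.nontrivial, e₂.symm.nontrivial, ?_, ?_⟩
  · rw [← hn, Fintype.card_congr e₁, Fintype.card_congr e₂]
  · refine isomorphic_trans hiso ?_
    have hpos : 0 < (∑ x, sgn (F₁ x)) * ∑ x, sgn (F₂ x) := by
      refine lt_of_le_of_ne hs fun h => ?_
      have h1 : ((∑ x, sgn (F₁ x)) * ∑ x, sgn (F₂ x)) ^ 2 = 0 := by rw [← h]; rfl
      rw [mul_pow, o₁.sq_sum, o₂.sq_sum] at h1
      have hn1 : (0 : ℤ) < Fintype.card G₁ := by exact_mod_cast Fintype.card_pos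
      have hn2 : (0 : ℤ) < Fintype.card G₂ := by exact_mod_cast Fintype.card_pos
      exact (mul_pos hn1 hn2).ne' h1
    have hsum : 0 < ∑ x, sgn (boxSum f₁ f₂ x) := by
      rw [← Equiv.sum_comp (e₁.prodCongr e₂)]
      convert hpos using 1
      rw [← sum_sgn_boxSum]
      refine Finset.sum_congr rfl fun x _ => ?_
      change sgn (f₁ (e₁ x.1) + f₂ (e₂ x.2)) = _
      rw [r₁, r₂]
    have h1 := (t₁.prod t₂).development_isomorphic (b₁.boxSum b₂) hsum
    have h2 : {x : G₁ × G₂ | F₁ x.1 + F₂ x.2 = 1}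
        = {x | boxSum f₁ f₂ ((e₁.prodCongr e₂) x) = 1} := by
      ext x
      change _ ↔ f₁ (e₁ x.1) + f₂ (e₂ x.2) = 1
      rw [r₁, r₂]
      rfl
    rw [h2]
    exact h1

end Product

end BentDesign

namespace BentDesign

section Classification

lemma boxSum_comm {V W : Type*} [AddCommGroup V] [AddCommGroup W] (f : V → ZMod 2)
    (g : W → ZMod 2) : EAEquiv (boxSum f g) (boxSum g f) := by
  have h := EAEquiv.of_equiv (boxSum f g) (Equiv.prodComm W V) (isAffine_snd.prodMk isAffine_fst)
  convert h using 2 with p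
  exact add_comm _ _

/-- The sum of two quadratic bent functions of four bits is the quadratic bent function of eight
bits. -/
lemma boxSum_bentFour : EAEquiv (boxSum bentFour bentFour) (boxSum bentTwo (bentRep 0)) := by
  let e : Bits2 × (Bits3 × Bits3) ≃ (Bits2 × Bits2) × (Bits2 × Bits2) :=
    { toFun := fun p => (((p.1.1, p.2.1.1), (p.1.2, p.2.2.1)), (p.2.1.2, p.2.2.2))
      invFun := fun q => ((q.1.1.1, q.1.2.1), ((q.1.1.2, q.2.1), (q.1.2.2, q.2.2)))
      left_inv := fun _ => rfl
      right_inv := fun _ => rfl }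
  have he : IsAffine e := fun x y => by simp [e]
  convert EAEquiv.of_equiv (boxSum bentFour bentFour) e he using 2 with p
  simp only [boxSum, bentTwo, bentRep, mm3, mmForm, repPerm, bentFour, dual2_apply, dual3_apply, e,
    Equiv.coe_fn_mk]
  ring

lemma card_cases {V : Type*} [AddCommGroup V] [Fintype V] [Nontrivial V] {W : Type*}
    [AddCommGroup W] [Fintype W] [Nontrivial W] {f : V → ZMod 2} {g : W → ZMod 2} (hf : IsBent f)
    (hg : IsBent g) (h : Fintype.card V * Fintype.card W = 256) :
    Fintype.card V = 4 ∧ Fintype.card W = 64 ∨ Fintype.card V = 16 ∧ Fintype.card W = 16 ∨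
      Fintype.card V = 64 ∧ Fintype.card W = 4 := by
  have h1 : ∃ a, a ^ 2 = Fintype.card V := ⟨_, by
    have := congrArg Int.natAbs (hf _ (isAffine_const 0))
    rwa [Int.natAbs_pow, Int.natAbs_natCast] at this⟩
  have h2 : ∃ a, a ^ 2 = Fintype.card W := ⟨_, by
    have := congrArg Int.natAbs (hg _ (isAffine_const 0))
    rwa [Int.natAbs_pow, Int.natAbs_natCast] at this⟩
  obtain ⟨a, ha⟩ := h1
  obtain ⟨b, hb⟩ := h2
  have hV : 1 < Fintype.card V := Fintype.one_lt_card
  have hW : 1 < Fintype.card W := Fintype.one_lt_card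
  rw [← ha, ← hb] at h ⊢
  rw [← ha] at hV
  rw [← hb] at hW
  have h16 : a * b = 16 := by
    have : (a * b) ^ 2 = 16 ^ 2 := by rw [mul_pow, h]; norm_num
    exact Nat.pow_left_injective two_ne_zero this
  have hd : a ∈ Nat.divisors 16 := Nat.mem_divisors.2 ⟨⟨b, h16.symm⟩, by norm_num⟩
  have hd' : Nat.divisors 16 = {1, 2, 4, 8, 16} := by decide +kernel
  rw [hd'] at hd
  simp only [Finset.mem_insert, Finset.mem_singleton] at hd
  rcases hd with rfl | rfl | rfl | rfl | rfl
  · omega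
  · obtain rfl : b = 8 := by omega
    simp
  · obtain rfl : b = 4 := by omega
    simp
  · obtain rfl : b = 2 := by omega
    simp
  · obtain rfl : b = 1 := by omega
    omega

/-- Every SDP design on 256 points from the product construction is one of four designs. The factors
have `4` and `64`, or `16` and `16` elements, and the second case gives nothing new. -/
lemma exists_isomorphic_of_product {X : IncidenceStructure.{u}} (hX : X.IsSDPDesign 256)
    (hp : IsFromProductConstruction X) :
    ∃ j, X.Isomorphic (bentDesign (boxSum bentTwo (bentRep j))) := by
  obtain ⟨V, W, _, _, _, _, _, _, f, g, hf, hg, _, _, hc, hiso⟩ := exists_boxSum_of_product hX hp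
  suffices h : ∃ j, EAEquiv (boxSum f g) (boxSum bentTwo (bentRep j)) by
    obtain ⟨j, hj⟩ := h
    exact ⟨j, isomorphic_trans hiso hj.isomorphic⟩
  rcases card_cases hf hg hc with ⟨h1, h2⟩ | ⟨h1, h2⟩ | ⟨h1, h2⟩
  · obtain ⟨j, hj⟩ := hg.exists_equiv_bentRep h2
    exact ⟨j, (hf.equiv_bentTwo h1).boxSum hj⟩
  · exact ⟨0, ((hf.equiv_bentFour h1).boxSum (hg.equiv_bentFour h2)).trans boxSum_bentFour⟩
  · obtain ⟨j, hj⟩ := hf.exists_equiv_bentRep h1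
    exact ⟨j, (boxSum_comm f g).trans ((hg.equiv_bentTwo h2).boxSum hj)⟩

end Classification

end BentDesign

namespace BentDesign

/-! ### Non-isomorphism -/

section Invariant

variable {V W : Type*} [AddCommGroup V] [AddCommGroup W]

/-- An isomorphism between the designs of bent functions is an equivalence of the functions: since
the differences of blocks are affine functions, it maps affine functions to affine functions. -/
lemma EAEquiv.of_isomorphic [Module (ZMod 2) W] [Fintype W] {f : V → ZMod 2}
    {g : W → ZMod 2} (hg : IsBent g) {s : ℤ} (hs : 0 < s) (hs2 : s ^ 2 = Fintype.card W)
    (h : (bentDesign f).Isomorphic (bentDesign g)) : EAEquiv f g := by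
  obtain ⟨φ, ψ, h⟩ := h
  change V ≃ W at φ
  have h1 : ∀ m : W → ZMod 2, IsAffine m → IsAffine fun x => g (φ x) + f x + m (φ x) := by
    intro m hm
    obtain ⟨c, hc⟩ := exists_sign hg hs2 hm
    let B : (bentDesign g).Block := ⟨{y | g y + (m y + c) = 1}, _, hm.add (isAffine_const c), rfl,
      by rw [two_mul_ncard_lt_iff, hc]; exact hs⟩
    obtain ⟨⟨S, l, hl, rfl, hlt⟩, hA⟩ := ψ.surjective B
    have h2 : (fun x => f x + l x) = fun x => g (φ x) + (m (φ x) + c) := by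
      refine eq_of_setOf_eq ?_
      ext x
      have := h x ⟨{x | f x + l x = 1}, l, hl, rfl, hlt⟩
      rw [hA] at this
      exact this
    have h3 : (fun x => g (φ x) + f x + m (φ x)) = fun x => l x + c := by
      funext x
      linear_combination congrFun h2 x + bit_add_self (g (φ x)) + bit_add_self (m (φ x))
        - bit_add_self (l x)
    rw [h3]
    exact hl.add (isAffine_const c)
  have h2 : IsAffine fun x => g (φ x) + f x := by
    simpa using h1 _ (isAffine_const 0)
  refine ⟨φ, fun x y => ?_, h2⟩
  by_contra hne
  have hne' : φ (x + y) + φ 0 + (φ x + φ y) ≠ 0 := fun h0 => hne (vec_eq_of_add_eq_zero h0)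
  obtain ⟨u, hu⟩ := exists_dual_eq_one hne'
  have h3 := (h1 _ (isAffine_linear u)).add h2
  have h4 := h3 x y
  simp only [map_add] at hu
  have h5 : (1 : ZMod 2) = 0 := by
    rw [← hu]
    linear_combination h4 + bit_add_self (u (φ x)) + bit_add_self (u (φ y))
      - bit_add_self (g (φ (x + y)) + f (x + y)) - bit_add_self (g (φ 0) + f 0)
      + bit_add_self (g (φ x) + f x) + bit_add_self (g (φ y) + f y)
  exact absurd h5 (by decide)

/-- The directions in which the derivative of a Boolean function is affine. Their number is
invariant under equivalence, and separates the four representatives. -/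
def affineDirections (f : V → ZMod 2) : Set V := {a | IsAffine fun x => f (x + a) + f x}

lemma mem_affineDirections {f : V → ZMod 2} {a : V} :
    a ∈ affineDirections f ↔ IsAffine fun x => f (x + a) + f x := Iff.rfl

lemma EAEquiv.ncard_affineDirections {f : V → ZMod 2} {g : W → ZMod 2} (h : EAEquiv f g) :
    (affineDirections f).ncard = (affineDirections g).ncard := by
  obtain ⟨φ, h1, h2⟩ := h
  have hφ : ∀ x a, φ (x + a) = φ x + (φ a - φ 0) := fun x a => by
    have := h1 x a
    rw [add_sub, ← this, add_sub_cancel_right]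
  let τ : V ≃ W := φ.trans (Equiv.subRight (φ 0))
  have h3 : ∀ a, IsAffine fun x => g (φ x + τ a) + f (x + a) + (g (φ x) + f x) := fun a => by
    have h4 := (h2.comp (isAffine_id.add (isAffine_const a))).add h2
    simp only [hφ, id] at h4
    exact h4
  have h4 : affineDirections g = τ '' affineDirections f := by
    ext b
    obtain ⟨a, rfl⟩ := τ.surjective b
    rw [τ.injective.mem_set_image]
    constructor
    · intro hb
      rw [mem_affineDirections]
      have h5 := (h3 a).add (IsAffine.comp (mem_affineDirections.1 hb) h1)
      convert h5 using 2 with x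
      linear_combination -bit_add_self (g (φ x + τ a)) - bit_add_self (g (φ x))
    · intro ha
      rw [mem_affineDirections]
      have h5 := ((h3 a).add (mem_affineDirections.1 ha)).comp h1.symm
      convert h5 using 2 with y
      simp only [φ.apply_symm_apply]
      linear_combination -bit_add_self (f (φ.symm y + a)) - bit_add_self (f (φ.symm y))
  rw [h4, Set.ncard_image_of_injective _ τ.injective]

lemma affineDirections_boxSum_bentTwo (f : V → ZMod 2) :
    affineDirections (boxSum bentTwo f) = Set.univ ×ˢ affineDirections f := by
  ext ⟨a, b⟩
  have h1 : IsAffine fun x : Bits2 => bentTwo (x + a) + bentTwo x := fun x y => by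
    simp only [bentTwo, Prod.fst_add, Prod.snd_add, Prod.fst_zero, Prod.snd_zero]
    linear_combination bit_add_self (x.1 * y.2) + bit_add_self (x.2 * y.1)
  simp only [Set.mem_prod, Set.mem_univ, true_and]
  constructor
  · intro h
    rw [mem_affineDirections] at h ⊢
    have h2 : IsAffine fun v : V => boxSum bentTwo f ((0, v) + (a, b)) +
        boxSum bentTwo f (0, v) :=
      IsAffine.comp h ((isAffine_const 0).prodMk isAffine_id)
    convert h2.add (isAffine_const (bentTwo (0 + a) + bentTwo 0)) using 2 with v
    simp only [boxSum, Prod.mk_add_mk]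
    linear_combination -bit_add_self (bentTwo (0 + a)) - bit_add_self (bentTwo 0)
  · intro h
    rw [mem_affineDirections] at h ⊢
    have h2 := (h1.comp (isAffine_fst (W := V))).add (IsAffine.comp h (isAffine_snd (V := Bits2)))
    convert h2 using 2 with p
    simp only [boxSum, Prod.fst_add, Prod.snd_add]
    ring

end Invariant

section Representatives

lemma isBent_bentTwo : IsBent bentTwo := by
  unfold IsBent IsAffine
  decide +kernel

/-- The affine directions of the four representatives. -/
def repDirections : Fin 4 → Finset (Bits3 × Bits3)
  | 0 => Finset.univ
  | 1 => Finset.univ.filter fun a => a.1.2.2 = 0 ∧ a.2.1 = 0 ∧ a.2.2.1 = 0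
  | 2 => Finset.univ.filter fun a => a.1.2 = 0 ∧ a.2 = 0
  | 3 => {0}

/-- The unit vectors. -/
def unitVectors : Finset (Bits3 × Bits3) :=
  {((1, 0, 0), 0), ((0, 1, 0), 0), ((0, 0, 1), 0), (0, (1, 0, 0)), (0, (0, 1, 0)), (0, (0, 0, 1))}

/-- For functions of degree three it suffices to test the third derivatives on the unit vectors. -/
lemma mem_repDirections_or : ∀ (j : Fin 4) (a : Bits3 × Bits3),
    a ∈ repDirections j ∨
    ∃ x ∈ unitVectors, ∃ y ∈ unitVectors,
      bentRep j (x + y + a) + bentRep j (x + y) + (bentRep j (0 + a) + bentRep j 0)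
        ≠ bentRep j (x + a) + bentRep j x + (bentRep j (y + a) + bentRep j y) := by
  decide +kernel

lemma affineDirections_bentRep (j : Fin 4) : affineDirections (bentRep j) = repDirections j := by
  ext a
  refine ⟨fun h => (mem_repDirections_or j a).resolve_right fun ⟨x, _, y, _, hne⟩ =>
    hne (h x y), fun h x y => ?_⟩
  obtain ⟨⟨a1, a2, a3⟩, b1, b2, b3⟩ := a
  obtain ⟨⟨x1, x2, x3⟩, y1, y2, y3⟩ := x
  obtain ⟨⟨z1, z2, z3⟩, w1, w2, w3⟩ := y
  fin_cases j <;> simp [repDirections] at h <;>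
    simp only [bentRep, mm3, mmForm, repPerm, dual3_apply, Prod.mk_add_mk, Prod.fst_zero,
      Prod.snd_zero, Prod.fst_add, Prod.snd_add] <;>
    grind

lemma card_repDirections : ∀ j, (repDirections j).card = ![64, 8, 2, 1] j := by
  decide +kernel

/-- The designs of the four sums are pairwise non-isomorphic. -/
lemma eq_of_isomorphic {i j : Fin 4}
    (h : (bentDesign (boxSum bentTwo (bentRep i))).Isomorphic
      (bentDesign (boxSum bentTwo (bentRep j)))) : i = j := by
  have hb : IsBent (boxSum bentTwo (bentRep j)) := isBent_bentTwo.boxSum (isBent_bentRep j)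
  have h1 := (EAEquiv.of_isomorphic hb (s := 16) (by norm_num) (by simp) h).ncard_affineDirections
  rw [affineDirections_boxSum_bentTwo, affineDirections_boxSum_bentTwo, Set.ncard_prod,
    Set.ncard_prod, Set.ncard_univ, affineDirections_bentRep, affineDirections_bentRep,
    Set.ncard_coe_finset, Set.ncard_coe_finset] at h1
  have h2 := Nat.eq_of_mul_eq_mul_left (Nat.card_pos (α := Bits2)) h1
  rw [card_repDirections, card_repDirections] at h2
  clear h hb h1
  revert i j
  decide

end Representatives

end BentDesign

namespace BentDesign

/-! ### Groups realising the representatives -/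

section Groups

lemma bit_mul_self (a : ZMod 2) : a * a = a := by revert a; decide

/-- For each of the four representatives, a group law on six bits whose left translations are affine
maps that change the representative by affine functions only. The laws for `1`, `2` and `3`
come from regular subgroups of the group of all affine maps with this property. -/
def repLaw : Fin 4 → Bits3 × Bits3 → Bits3 × Bits3 → Bits3 × Bits3
  | 0, ⟨⟨a1, a2, a3⟩, b1, b2, b3⟩, ⟨⟨x1, x2, x3⟩, y1, y2, y3⟩ =>
    ((a1 + x1, a2 + x2, a3 + x3), b1 + y1, b2 + y2, b3 + y3)
  | 1, ⟨⟨a1, a2, a3⟩, b1, b2, b3⟩, ⟨⟨x1, x2, x3⟩, y1, y2, y3⟩ =>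
    ((a1 + x1 + b2 * x3 + a3 * y2, a2 + x2, a3 + x3), b1 + y1, b2 + y2,
      b3 + y3 + b2 * x3 + b1 * y2)
  | 2, ⟨⟨a1, a2, a3⟩, b1, b2, b3⟩, ⟨⟨x1, x2, x3⟩, y1, y2, y3⟩ =>
    ((a1 + x1 + (b2 + b1 * b3) * x3 + (a2 + a3 * b1) * y3, a2 + x2 + b1 * x3 + a3 * y1, a3 + x3),
      b1 + y1, b2 + y2 + b3 * y1 + b1 * y3, b3 + y3)
  | 3, ⟨⟨a1, a2, a3⟩, b1, b2, b3⟩, ⟨⟨x1, x2, x3⟩, y1, y2, y3⟩ =>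
    ((a1 + x1 + (b2 + b1 * b2 + b3 + b2 * b3) * x2 + b2 * x3
        + (a1 + a2 + a3 + a2 * b1 + a1 * b2 + a2 * b3) * y2 + a2 * y3, a2 + x2,
      a3 + x3 + (b1 + b2 * b3) * x2 + (a1 + a2 * b2 + a3 * b2 + a2 * b3) * y2),
      b1 + y1 + (b1 + b1 * b2 + b3) * y2 + b2 * y3, b2 + y2, b3 + y3 + (b1 + b2 * b3) * y2)

/-- Associativity is a polynomial identity modulo `b ^ 2 = b` for the coordinates that occur with
higher exponents. -/
lemma repLaw_assoc (j : Fin 4) (u v w : Bits3 × Bits3) :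
    repLaw j (repLaw j u v) w = repLaw j u (repLaw j v w) := by
  obtain ⟨⟨a1, a2, a3⟩, b1, b2, b3⟩ := u
  obtain ⟨⟨x1, x2, x3⟩, y1, y2, y3⟩ := v
  obtain ⟨⟨z1, z2, z3⟩, w1, w2, w3⟩ := w
  have h1 := bit_mul_self b1
  have h2 := bit_mul_self b2
  have h3 := bit_mul_self b3
  have h4 := bit_mul_self y1
  have h5 := bit_mul_self y2
  have h6 := bit_mul_self y3
  fin_cases j <;> simp only [repLaw, Prod.mk.injEq] <;>
    refine ⟨⟨?_, ?_, ?_⟩, ?_, ?_, ?_⟩ <;> grind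

lemma repLaw_zero_left : ∀ (j : Fin 4) (v : Bits3 × Bits3), repLaw j 0 v = v := by
  decide +kernel

lemma repLaw_pow_four : ∀ (j : Fin 4) (v : Bits3 × Bits3),
    repLaw j (repLaw j v (repLaw j v v)) v = 0 := by
  decide +kernel

/-- The group with the law `repLaw j`. -/
def RepGroup (_ : Fin 4) : Type := Bits3 × Bits3

instance (j : Fin 4) : Fintype (RepGroup j) := inferInstanceAs (Fintype (Bits3 × Bits3))

instance (j : Fin 4) : Nontrivial (RepGroup j) := inferInstanceAs (Nontrivial (Bits3 × Bits3))

/-- The exponent of the group divides four, so that the inverse of `v` is its cube. -/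
instance (j : Fin 4) : Group (RepGroup j) :=
  letI : Mul (RepGroup j) := ⟨repLaw j⟩
  letI : One (RepGroup j) := ⟨(0 : Bits3 × Bits3)⟩
  letI : Inv (RepGroup j) := ⟨fun v => repLaw j v (repLaw j v v)⟩
  Group.ofLeftAxioms (repLaw_assoc j) (repLaw_zero_left j) (repLaw_pow_four j)

/-- The identification of the group with six bits. -/
def repEquiv (j : Fin 4) : RepGroup j ≃ Bits3 × Bits3 := Equiv.refl _

/-- The affine function with the same values as `φ` at zero and at the unit vectors. -/
def affineInterpolation (φ : Bits3 × Bits3 → ZMod 2) (x : Bits3 × Bits3) : ZMod 2 :=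
  dual3 (φ ((1, 0, 0), 0, 0, 0) + φ ((0, 0, 0), 0, 0, 0),
      φ ((0, 1, 0), 0, 0, 0) + φ ((0, 0, 0), 0, 0, 0),
      φ ((0, 0, 1), 0, 0, 0) + φ ((0, 0, 0), 0, 0, 0)) x.1 +
    dual3 (φ ((0, 0, 0), 1, 0, 0) + φ ((0, 0, 0), 0, 0, 0),
      φ ((0, 0, 0), 0, 1, 0) + φ ((0, 0, 0), 0, 0, 0),
      φ ((0, 0, 0), 0, 0, 1) + φ ((0, 0, 0), 0, 0, 0)) x.2 + φ ((0, 0, 0), 0, 0, 0)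

lemma isAffine_affineInterpolation (φ : Bits3 × Bits3 → ZMod 2) :
    IsAffine (affineInterpolation φ) :=
  (((isAffine_linear _).comp isAffine_fst).add ((isAffine_linear _).comp isAffine_snd)).add
    (isAffine_const _)

lemma bentRep_repLaw (j : Fin 4) (g x : Bits3 × Bits3) : bentRep j (repLaw j g x) =
    bentRep j x + affineInterpolation (fun x => bentRep j (repLaw j g x) + bentRep j x) x := by
  obtain ⟨⟨a1, a2, a3⟩, b1, b2, b3⟩ := g
  obtain ⟨⟨x1, x2, x3⟩, y1, y2, y3⟩ := x
  have h1 := bit_mul_self b1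
  have h2 := bit_mul_self b2
  have h3 := bit_mul_self b3
  have h4 := bit_mul_self y1
  have h5 := bit_mul_self y2
  have h6 := bit_mul_self y3
  have h7 := bit_mul_self x3
  fin_cases j <;>
    simp only [affineInterpolation, repLaw, bentRep, mm3, mmForm, repPerm, dual3_apply,
      mul_zero, add_zero, mul_one] <;>
    grind

lemma hasAffineTranslates_repEquiv (j : Fin 4) : HasAffineTranslates (repEquiv j) (bentRep j) :=
  fun g => ⟨_, isAffine_affineInterpolation _, fun x => bentRep_repLaw j g x⟩

lemma hasAffineTranslates_bentTwo :
    HasAffineTranslates (Multiplicative.toAdd : Multiplicative Bits2 ≃ Bits2) bentTwo := by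
  intro g
  refine ⟨fun x => bentTwo (g.toAdd + x) + bentTwo x, fun x y => ?_, fun x => ?_⟩
  · simp only [bentTwo, Prod.fst_add, Prod.snd_add, Prod.fst_zero, Prod.snd_zero]
    linear_combination bit_add_self (x.1 * y.2) + bit_add_self (x.2 * y.1)
  · rw [toAdd_mul]
    linear_combination -bit_add_self (bentTwo x.toAdd)

lemma sum_sgn_bentTwo : ∑ x, sgn (bentTwo x) = 2 := by decide +kernel

lemma sum_sgn_bentRep : ∀ j, ∑ x, sgn (bentRep j x) = 8 := by decide +kernel

lemma isFromProductConstruction_bentDesign (j : Fin 4) :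
    IsFromProductConstruction (bentDesign (boxSum bentTwo (bentRep j))) :=
  isFromProductConstruction_boxSum hasAffineTranslates_bentTwo (hasAffineTranslates_repEquiv j)
    isBent_bentTwo (isBent_bentRep j) (by rw [sum_sgn_bentTwo, sum_sgn_bentRep]; norm_num)

end Groups

end BentDesign

theorem corollary5p3 :
    ∃ E : Fin 4 → IncidenceStructure.{0},
      (∀ i, (E i).IsSDPDesign 256 ∧ IsFromProductConstruction (E i)) ∧
      (∀ i j, (E i).Isomorphic (E j) → i = j) ∧
      (∀ X : IncidenceStructure.{u}, X.IsSDPDesign 256 → IsFromProductConstruction X →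
        ∃ i, X.Isomorphic (E i)) :=
  ⟨fun j => BentDesign.bentDesign (BentDesign.boxSum BentDesign.bentTwo (BentDesign.bentRep j)),
    fun j => ⟨(BentDesign.isBent_bentTwo.boxSum (BentDesign.isBent_bentRep j)).isSDPDesign
      (by simp), BentDesign.isFromProductConstruction_bentDesign j⟩,
    fun _ _ h => BentDesign.eq_of_isomorphic h,
    fun _ hX hp => BentDesign.exists_isomorphic_of_product hX hp⟩
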